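/- Let $Z\ge 0$ and $N\in\mathbb N$. Let $\Gamma=\mathbb R^3\times\{1,2\}$, with $\int_\Gamma dx=\sum_{\sigma=1}^2\int_{\mathbb R^3}d\mathbf x$ and $x=(\mathbf x,\sigma)$. Let $\mathcal D$ be the set of trace class operators $\gamma$ on $L^2(\Gamma)$ with $0\le\gamma\le 1$ for which $(-\Delta+1)\gamma$ is also trace class, and put $$\mathcal D_N=\{\gamma\in\mathcal D:\operatorname{tr}\gamma\le N\},\qquad \mathcal D_{\partial N}=\{\gamma\in\mathcal D:\operatorname{tr}\gamma=N\}.$$ For $\gamma\in\mathcal D$ with integral kernel $\gamma(x,y)$, eigenvalues $\lambda_n$ and a corresponding complete orthonormal set of eigenvectors $\xi_n$, let $\rho_\gamma(\mathbf x)=\sum_{\sigma}\sum_n\lambda_n|\xi_n(\mathbf x,\sigma)|^2$ and let $$\mathcal E^{\mathrm{HF}}_Z(\gamma)=\operatorname{tr}\bigl(-\tfrac12\Delta\gamma\bigr)-\int_{\mathbb R^3}\frac{Z\rho_\gamma(\mathbf x)}{|\mathbf x|}\,d\mathbf x+\frac12\int_{\mathbb R^3}\!\int_{\mathbb R^3}\frac{\rho_\gamma(\mathbf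 x)\rho_\gamma(\mathbf y)}{|\mathbf x-\mathbf y|}\,d\mathbf x\,d\mathbf y-\frac12\int_\Gamma\!\int_\Gamma\frac{|\gamma(x,y)|^2}{|\mathbf x-\mathbf y|}\,dx\,dy$$ be the Hartree--Fock functional. Let $H_{Z,N}$ be the selfadjoint operator on the space of antisymmetric functions in $L^2(\Gamma^N)$ that is associated with the closed, semibounded quadratic form $$\psi\mapsto\int_{\Gamma^N}\Bigl[\sum_{n=1}^N\Bigl(\tfrac12|\nabla_{\mathbf x_n}\psi|^2-\frac{Z}{|\mathbf x_n|}|\psi|^2\Bigr)+\sum_{1\le m<n\le N}\frac{|\psi|^2}{|\mathbf x_m-\mathbf x_n|}\Bigr]dx$$ with the antisymmetric functions in $H^1(\Gamma^N)$ as form domain, and let $E^{\mathrm S}(Z,N)=\inf\sigma(H_{Z,N})$ be the $N$-electron ground-state energy. **Theorem.** If the infimum of $\mathcal E^{\mathrm{HF}}_Z$ on $\mathcal D_{\partial N}$ is attained, then for every $\gamma\in\mathcal D_N$ $$E^{\mathrm S}(Z,N)\le\mathcal E^{\mathrm{HF}}_Z(\gamma).$$ -/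

import Mathlib

open MeasureTheory
open scoped InnerProductSpace ContDiff

noncomputable section

namespace ElectronGas

/-! ## Trace class operators and operators given by forms -/

section Hilbert

variable {H : Type*} [NormedAddCommGroup H] [InnerProductSpace ℂ H]

/-- The operator associated with a sesquilinear form `q` with form domain `Q`, given by its graph:
`u` lies in the domain and is mapped to `v` iff `u ∈ Q` and `q(φ, u) = ⟪φ, v⟫` for all `φ ∈ Q`.
For a densely defined, closed and semibounded form, this is the selfadjoint operator of the form
(Friedrichs). -/
def FormOperator (Q : Set H) (q : H → H → ℂ) (u v : H) : Prop :=
  u ∈ Q ∧ ∀ φ ∈ Q, q φ u = ⟪φ, v⟫_ℂ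

/-- The spectrum of an operator with graph `A`: `z` is in the resolvent set iff there is a bounded,
everywhere defined operator `B` which inverts `A - z`, i.e., `(A - z) ψ = η` iff `ψ = B η`. -/
def graphSpectrum (A : H → H → Prop) : Set ℂ :=
  {z | ¬ ∃ B : H →L[ℂ] H, ∀ ψ η : H, A ψ (η + z • ψ) ↔ ψ = B η}

variable [CompleteSpace H]

/-- `T` is trace class: `∑ₙ ⟪eₙ, |T| eₙ⟫ < ∞` for orthonormal bases `e`, where `|T| = √(T* T)`. -/
def IsTraceClass (T : H →L[ℂ] H) : Prop :=
  ∀ (w : Set H) (e : HilbertBasis w ℂ H), Summable fun n => (⟪e n, CFC.abs T (e n)⟫_ℂ).re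

/-- Some orthonormal basis of `H`. -/
def someHilbertBasis (H : Type*) [NormedAddCommGroup H] [InnerProductSpace ℂ H]
    [CompleteSpace H] : HilbertBasis (exists_hilbertBasis ℂ H).choose ℂ H :=
  (exists_hilbertBasis ℂ H).choose_spec.choose

/-- The trace `∑ₙ ⟪eₙ, T eₙ⟫`; for trace class `T` it does not depend on the basis. -/
def trace (T : H →L[ℂ] H) : ℂ :=
  ∑' n, ⟪someHilbertBasis H n, T (someHilbertBasis H n)⟫_ℂ

end Hilbert

/-! ## Weak derivatives -/

/-- `g` is the weak derivative of `f : V → ℂ` in direction `v`. -/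
def IsWeakDeriv {V : Type*} [NormedAddCommGroup V] [NormedSpace ℝ V] [MeasureSpace V]
    (v : V) (f g : V → ℂ) : Prop :=
  ∀ φ : V → ℝ, ContDiff ℝ ∞ φ → HasCompactSupport φ →
    ∫ x, fderiv ℝ φ x v • f x = - ∫ x, φ x • g x

/-! ## The one-electron space -/

/-- Position space `ℝ³`. -/
abbrev Space := EuclideanSpace ℝ (Fin 3)

/-- The space-spin configurations `Γ = ℝ³ × {1, 2}` of one electron. -/
abbrev SpaceSpin := Space × Fin 2

/-- `∫_Γ dx = ∑_σ ∫_{ℝ³} d𝐱`. -/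
abbrev spaceSpinMeasure : Measure SpaceSpin := (volume : Measure Space).prod Measure.count

/-- The one-electron Hilbert space `L²(Γ)`. -/
abbrev L2One := Lp ℂ 2 spaceSpinMeasure

/-- `g = ∂ᵢ f` weakly, for each value of the spin. -/
def IsWeakPartialOne (i : Fin 3) (f g : L2One) : Prop :=
  ∀ s : Fin 2, IsWeakDeriv (EuclideanSpace.single i (1 : ℝ))
    (fun x : Space => f (x, s)) (fun x : Space => g (x, s))

/-- The Sobolev space `H¹(Γ)`. -/
def sobolevOne : Set L2One := {f | ∀ i, ∃ g, IsWeakPartialOne i f g}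

open Classical in
/-- The weak derivative `∂ᵢ f` in `L²(Γ)` (and `0` if there is none). -/
def partialOne (i : Fin 3) (f : L2One) : L2One :=
  if h : ∃ g, IsWeakPartialOne i f g then h.choose else 0

/-- The Dirichlet form `∫_Γ conj(∇f) · ∇g`. -/
def dirichletForm (f g : L2One) : ℂ := ∑ i, ⟪partialOne i f, partialOne i g⟫_ℂ

/-- `v = -Δ u` for the selfadjoint Laplacian on `L²(Γ)` (in particular, `u` is in its domain). -/
def IsNegLaplacian (u v : L2One) : Prop := FormOperator sobolevOne dirichletForm u v

open Classical in
/-- The bounded operator `-Δ γ` (and `0` if this is not a bounded, everywhere defined operator). -/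
def negLaplacianMul (γ : L2One →L[ℂ] L2One) : L2One →L[ℂ] L2One :=
  if h : ∃ K : L2One →L[ℂ] L2One, ∀ f, IsNegLaplacian (γ f) (K f) then h.choose else 0

/-! ## One-particle density matrices and the Hartree-Fock functional -/

/-- The set `𝒟` of trace class operators `γ` with `0 ≤ γ ≤ 1` such that `T = (-Δ + 1) γ` is
trace class. -/
def densityMatrices : Set (L2One →L[ℂ] L2One) :=
  {γ | IsTraceClass γ ∧ 0 ≤ γ ∧ γ ≤ 1 ∧
    ∃ T : L2One →L[ℂ] L2One, IsTraceClass T ∧ ∀ f, IsNegLaplacian (γ f) (T f - γ f)}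

/-- `𝒟_N`: particle number at most `N`. -/
def densityMatricesLE (N : ℕ) : Set (L2One →L[ℂ] L2One) :=
  {γ ∈ densityMatrices | (trace γ).re ≤ N}

/-- `𝒟_{∂N}`: particle number equal to `N`. -/
def densityMatricesEQ (N : ℕ) : Set (L2One →L[ℂ] L2One) :=
  {γ ∈ densityMatrices | trace γ = N}

/-- The `ξₙ` form a complete orthonormal set of eigenvectors of `γ` with eigenvalues `λₙ`. -/
def IsEigenbasis (γ : L2One →L[ℂ] L2One) (lam : ℕ → ℝ) (ξ : HilbertBasis ℕ ℂ L2One) : Prop :=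
  ∀ n, γ (ξ n) = (lam n : ℂ) • ξ n

open Classical in
/-- The spin-summed density `ρ_γ(𝐱) = ∑_σ ∑ₙ λₙ |ξₙ(𝐱, σ)|²`. -/
def density (γ : L2One →L[ℂ] L2One) (x : Space) : ℝ :=
  if h : ∃ p : (ℕ → ℝ) × HilbertBasis ℕ ℂ L2One, IsEigenbasis γ p.1 p.2 then
    ∑ s : Fin 2, ∑' n, h.choose.1 n * ‖h.choose.2 n (x, s)‖ ^ 2
  else 0

/-- `k` is a square integrable integral kernel of `γ`. -/
def IsIntegralKernel (γ : L2One →L[ℂ] L2One) (k : SpaceSpin × SpaceSpin → ℂ) : Prop :=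
  MemLp k 2 (spaceSpinMeasure.prod spaceSpinMeasure) ∧
    ∀ f : L2One, ∀ᵐ x ∂spaceSpinMeasure, γ f x = ∫ y, k (x, y) * f y ∂spaceSpinMeasure

open Classical in
/-- The integral kernel `γ(x, y)` (and `0` if there is none). -/
def integralKernel (γ : L2One →L[ℂ] L2One) : SpaceSpin × SpaceSpin → ℂ :=
  if h : ∃ k, IsIntegralKernel γ k then h.choose else 0

/-- The classical Coulomb energy `D[ρ]`. -/
def coulombEnergy (ρ : Space → ℝ) : ℝ :=
  (1 / 2) * ∫ x : Space, ∫ y : Space, ρ x * ρ y / ‖x - y‖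

/-- The exchange energy `X[γ]`. -/
def exchangeEnergy (γ : L2One →L[ℂ] L2One) : ℝ :=
  (1 / 2) * ∫ x : SpaceSpin, ∫ y : SpaceSpin,
    ‖integralKernel γ (x, y)‖ ^ 2 / ‖x.1 - y.1‖ ∂spaceSpinMeasure ∂spaceSpinMeasure

/-- The Hartree-Fock functional. -/
def hartreeFock (Z : ℝ) (γ : L2One →L[ℂ] L2One) : ℝ :=
  (1 / 2) * (trace (negLaplacianMul γ)).re - (∫ x : Space, Z * density γ x / ‖x‖)
    + coulombEnergy (density γ) - exchangeEnergy γ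

/-! ## The `N`-electron space and Hamiltonian -/

/-- The product measure on `Γ^N`. -/
abbrev configMeasure (N : ℕ) : Measure (Fin N → SpaceSpin) :=
  Measure.pi fun _ => spaceSpinMeasure

/-- `L²(Γ^N)`. -/
abbrev L2N (N : ℕ) := Lp ℂ 2 (configMeasure N)

theorem measurePreserving_perm (N : ℕ) (σ : Equiv.Perm (Fin N)) :
    MeasurePreserving (fun x : Fin N → SpaceSpin => fun n => x (σ n))
      (configMeasure N) (configMeasure N) := by
  exact measurePreserving_arrowCongr' (μ := fun _ => spaceSpinMeasure) (ν := fun _ => spaceSpinMeasure) σ.symm (MeasurableEquiv.refl _) (fun _ => MeasurePreserving.id _)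

/-- The `N`-electron Hilbert space: all `ψ ∈ L²(Γ^N)` with
`ψ(x_{σ(1)}, …, x_{σ(N)}) = sgn(σ) ψ(x_1, …, x_N)` for all permutations `σ`. -/
def antisymmetric (N : ℕ) : Submodule ℂ (L2N N) where
  carrier := {ψ | ∀ σ : Equiv.Perm (Fin N),
    Lp.compMeasurePreserving _ (measurePreserving_perm N σ) ψ
      = ((Equiv.Perm.sign σ : ℤ) : ℂ) • ψ}
  add_mem' := by
    intro a b ha hb σ
    rw [map_add, ha σ, hb σ, smul_add]
  zero_mem' := by
    intro σ
    rw [map_zero, smul_zero]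
  smul_mem' := by
    intro c a ha σ
    have h := (Lp.compMeasurePreservingₗ ℂ _ (measurePreserving_perm N σ)).map_smul c a
    change Lp.compMeasurePreserving _ (measurePreserving_perm N σ) (c • a)
      = c • Lp.compMeasurePreserving _ (measurePreserving_perm N σ) a at h
    rw [h, ha σ, smul_comm]

/-- `g = ∂ψ/∂x_{n,i}` weakly, for all values of the spins. -/
def IsWeakPartial {N : ℕ} (n : Fin N) (i : Fin 3) (ψ g : L2N N) : Prop :=
  ∀ s : Fin N → Fin 2, IsWeakDeriv (Pi.single n (EuclideanSpace.single i (1 : ℝ)))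
    (fun x : Fin N → Space => ψ fun m => (x m, s m))
    (fun x : Fin N → Space => g fun m => (x m, s m))

open Classical in
/-- The weak derivative `∂ψ/∂x_{n,i}` in `L²(Γ^N)` (and `0` if there is none). -/
def weakPartial {N : ℕ} (n : Fin N) (i : Fin 3) (ψ : L2N N) : L2N N :=
  if h : ∃ g, IsWeakPartial n i ψ g then h.choose else 0

/-- The form domain: antisymmetric functions in `H¹(Γ^N)`. -/
def formDomain (N : ℕ) : Set (antisymmetric N) :=
  {ψ | ∀ n i, ∃ g, IsWeakPartial n i (ψ : L2N N) g}

/-- The sesquilinear form of the energy of `N` electrons in the external potential `V`. -/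
def energyForm (V : Space → ℝ) (N : ℕ) (φ ψ : antisymmetric N) : ℂ :=
  ∑ n : Fin N,
      ((1 / 2) * (∑ i, ⟪weakPartial n i (φ : L2N N), weakPartial n i (ψ : L2N N)⟫_ℂ)
        + ∫ x, (V (x n).1 : ℂ) * (starRingEnd ℂ ((φ : L2N N) x) * (ψ : L2N N) x)
            ∂configMeasure N)
    + ∑ n : Fin N, ∑ m ∈ Finset.univ.filter (· < n),
        ∫ x, starRingEnd ℂ ((φ : L2N N) x) * (ψ : L2N N) x / (‖(x m).1 - (x n).1‖ : ℂ)
          ∂configMeasure N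

/-- The graph of the `N`-electron Hamiltonian
`H_{V,N} = ∑ₙ (-Δₙ/2 + V(𝐱ₙ)) + ∑_{m<n} 1/|𝐱ₘ - 𝐱ₙ|`. -/
def IsHamiltonian (V : Space → ℝ) (N : ℕ) : antisymmetric N → antisymmetric N → Prop :=
  FormOperator (formDomain N) (energyForm V N)

/-- The `N`-electron ground-state energy `E^S(Z, N) = inf σ(H_{-Z/|·|, N})`. -/
def groundStateEnergy (Z : ℝ) (N : ℕ) : ℝ :=
  sInf {E : ℝ | (E : ℂ) ∈ graphSpectrum (IsHamiltonian (fun x => -Z / ‖x‖) N)}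

end ElectronGas

end

/-! This is Lieb's variational principle: up to an arbitrarily small error, the Hartree-Fock energy
of a density matrix dominates the energy of some Slater determinant.

Formally, if γ has eigenvectors ξₙ with eigenvalues λₙ, its energy is ∑ λₙ hₙ + ½ ∑ λᵢ λⱼ Wᵢⱼ with
one-body energies hₙ (`orbitalEnergy`) and W the direct minus the exchange integral (`pairEnergy`).
Two properties of W matter: Wᵢⱼ ≥ 0, and Wᵢᵢ = 0, because the self-interaction cancels between
Coulomb and exchange term. Hence the energy is a concave function of the amount of charge shifted
from one orbital to another, and an affine function of any single occupation number. Fractional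
occupation numbers can therefore be removed one after the other without raising the energy, and ∑ λₙ
≤ N is preserved because N is an integer (`exists_finset_le_occupationEnergy`).

What remains is a set of k ≤ N orthonormal orbitals. For k = N the energy is the expectation value
of the Hamiltonian in a Slater determinant (`groundStateEnergy_le_slaterEnergy`). For k < N the
missing electrons are put into orbitals so widely spread that they cost almost nothing
(`exists_slaterEnergy_succ_le`).

A γ of infinite rank is truncated to its first M eigenvectors. The one-body sums converge as M → ∞.
For the pair energies one inequality is enough: by Lagrange's identity and the eigenvector expansion
of the kernel, the first M orbitals contribute at most the Coulomb minus the exchange energy of γ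
(`IsEigenbasis.sum_pairEnergy_le`).

The link to the spectrum is a Hardy inequality, 2 ∫ |u|²/|x - a| ≤ t ‖∇u‖² + t⁻¹ ‖u‖² for every t >
0. It makes the Coulomb terms bounded on the form domain and the attraction small relative to the
kinetic energy, so that `sInf_graphSpectrum_mul_le` applies: the bottom of the spectrum is at most
the form on any normalized vector. -/

namespace ElectronGas

/-! ### Weak derivatives and mollification. -/

section WeakDeriv

open Filter Topology Convolution ContinuousLinearMap

variable {V : Type*} [NormedAddCommGroup V] [NormedSpace ℝ V] [FiniteDimensional ℝ V]
  [MeasureSpace V] [BorelSpace V] [(volume : Measure V).IsAddHaarMeasure]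

theorem isWeakDeriv_of_contDiff {f : V → ℂ} (hf : ContDiff ℝ 1 f) (v : V) :
    IsWeakDeriv v f (fun x => fderiv ℝ f x v) := by
  intro φ hφ hc
  have hφ1 : ContDiff ℝ 1 φ := hφ.of_le (by simp)
  have hφ' : Continuous fun x => fderiv ℝ φ x v :=
    (hφ1.continuous_fderiv one_ne_zero).clm_apply continuous_const
  have hf' : Continuous fun x => fderiv ℝ f x v :=
    (hf.continuous_fderiv one_ne_zero).clm_apply continuous_const
  have hc' : HasCompactSupport fun x => fderiv ℝ φ x v := hc.fderiv_apply ℝ v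
  have h := integral_bilinear_fderiv_right_eq_neg_left_of_integrable (μ := volume)
    (f := φ) (g := f) (v := v) (B := ContinuousLinearMap.lsmul ℝ ℝ)
    ((hφ'.smul hf.continuous).integrable_of_hasCompactSupport hc'.smul_right)
    ((hφ.continuous.smul hf').integrable_of_hasCompactSupport hc.smul_right)
    ((hφ.continuous.smul hf.continuous).integrable_of_hasCompactSupport hc.smul_right)
    (fun x _ => (hφ1.differentiable one_ne_zero) x)
    (fun x _ => (hf.differentiable one_ne_zero) x)
  simp only [lsmul_apply] at h
  rw [h, neg_neg]

theorem IsWeakDeriv.ae_eq {v : V} {f g g' : V → ℂ} (h : IsWeakDeriv v f g)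
    (h' : IsWeakDeriv v f g') (hg : LocallyIntegrable g) (hg' : LocallyIntegrable g') :
    g =ᵐ[volume] g' :=
  ae_eq_of_integral_contDiff_smul_eq hg hg' fun φ hφ hc => by
    rw [← neg_inj, ← h φ hφ hc, ← h' φ hφ hc]

theorem fderiv_convolution_of_isWeakDeriv {v : V} {f g : V → ℂ} (h : IsWeakDeriv v f g)
    (hf : LocallyIntegrable f) {ρ : V → ℝ} (hρ : ContDiff ℝ ∞ ρ) (hc : HasCompactSupport ρ)
    (x : V) :
    fderiv ℝ (ρ ⋆[lsmul ℝ ℝ, volume] f) x v = (ρ ⋆[lsmul ℝ ℝ, volume] g) x := by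
  have hρ1 : ContDiff ℝ 1 ρ := hρ.of_le (by simp)
  have hd := hc.hasFDerivAt_convolution_left (μ := volume) (lsmul ℝ ℝ : ℝ →L[ℝ] ℂ →L[ℝ] ℂ) hρ1 hf x
  rw [hd.fderiv]
  have hint : Integrable fun t => ((lsmul ℝ ℝ : ℝ →L[ℝ] ℂ →L[ℝ] ℂ).precompL V) (fderiv ℝ ρ t) (f (x - t)) :=
    HasCompactSupport.convolutionExists_left ((lsmul ℝ ℝ : ℝ →L[ℝ] ℂ →L[ℝ] ℂ).precompL V) (hc.fderiv ℝ)
      (hρ1.continuous_fderiv one_ne_zero) hf x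
  rw [convolution_def, ContinuousLinearMap.integral_apply hint]
  have h1 : ∫ t, ((lsmul ℝ ℝ : ℝ →L[ℝ] ℂ →L[ℝ] ℂ).precompL V) (fderiv ℝ ρ t) (f (x - t)) v
      = ∫ y, fderiv ℝ ρ (x - y) v • f y := by
    rw [← integral_sub_left_eq_self _ volume x]
    simp only [precompL_apply, lsmul_apply, sub_sub_cancel]
  rw [h1]
  -- The reflected translate of the mollifier is itself a test function, and moving the derivative
  -- from it onto `f` is the definition of the weak derivative.
  have hψ : ContDiff ℝ ∞ fun y => ρ (x - y) := hρ.comp (contDiff_const.sub contDiff_id)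
  have hψc : HasCompactSupport fun y => ρ (x - y) :=
    hc.comp_homeomorph (Homeomorph.subLeft x)
  have h2 := h _ hψ hψc
  have h3 : ∀ y, fderiv ℝ (fun y => ρ (x - y)) y v = - fderiv ℝ ρ (x - y) v := by
    intro y
    have : HasFDerivAt (fun y => ρ (x - y)) ((fderiv ℝ ρ (x - y)).comp (-ContinuousLinearMap.id ℝ V)) y :=
      ((hρ1.differentiable one_ne_zero) (x - y)).hasFDerivAt.comp y ((hasFDerivAt_id y).const_sub x)
    rw [this.fderiv]; simp
  simp only [h3, neg_smul, integral_neg, neg_inj] at h2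
  rw [h2, convolution_eq_swap]
  simp

/-- Averaging against a probability density contracts L²: Cauchy-Schwarz for the factorization ρ =
ρ^(1/2) ρ^(1/2), then Tonelli and translation invariance. -/
theorem lintegral_enorm_convolution_sq_le {f : V → ℂ} (hf : AEStronglyMeasurable f)
    {ρ : V → ℝ} (hρ : Continuous ρ) (h0 : ∀ x, 0 ≤ ρ x) (h1 : ∫ x, ρ x = 1) :
    ∫⁻ x, ‖(ρ ⋆[lsmul ℝ ℝ, volume] f) x‖ₑ ^ 2 ≤ ∫⁻ x, ‖f x‖ₑ ^ 2 := by
  have hρi : Integrable ρ := by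
    by_contra h; rw [integral_undef h] at h1; exact one_ne_zero h1.symm
  have hρ1 : ∫⁻ t, ‖ρ t‖ₑ = 1 := by
    have := ofReal_integral_eq_lintegral_ofReal hρi (ae_of_all _ h0)
    rw [h1, ENNReal.ofReal_one] at this
    rw [this]
    exact lintegral_congr fun t => by rw [Real.enorm_of_nonneg (h0 t)]
  have hm : AEMeasurable (fun p : V × V => ‖ρ p.2‖ₑ * ‖f (p.1 - p.2)‖ₑ ^ 2)
      (volume.prod volume) := by
    refine ((hρ.measurable.comp measurable_snd).enorm.aemeasurable).mul (AEMeasurable.pow_const ?_ _)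
    exact (hf.comp_quasiMeasurePreserving
      (quasiMeasurePreserving_sub_of_right_invariant volume volume)).enorm
  calc ∫⁻ x, ‖(ρ ⋆[lsmul ℝ ℝ, volume] f) x‖ₑ ^ 2
      ≤ ∫⁻ x, ∫⁻ t, ‖ρ t‖ₑ * ‖f (x - t)‖ₑ ^ 2 := by
        refine lintegral_mono fun x => ?_
        have hfx : AEMeasurable (fun t => ‖f (x - t)‖ₑ) volume :=
          (hf.comp_quasiMeasurePreserving (quasiMeasurePreserving_sub_left volume x)).enorm
        have hρm : Measurable fun t => ‖ρ t‖ₑ := hρ.measurable.enorm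
        calc ‖(ρ ⋆[lsmul ℝ ℝ, volume] f) x‖ₑ ^ 2
            ≤ (∫⁻ t, ‖ρ t‖ₑ * ‖f (x - t)‖ₑ) ^ 2 := by
              gcongr
              refine (enorm_integral_le_lintegral_enorm _).trans (lintegral_mono fun t => ?_)
              rw [lsmul_apply, enorm_smul]
          _ = (∫⁻ t, (‖ρ t‖ₑ ^ (1 / 2 : ℝ)) * (‖ρ t‖ₑ ^ (1 / 2 : ℝ) * ‖f (x - t)‖ₑ)) ^ 2 := by
              congr 2; ext t
              rw [← mul_assoc, ← ENNReal.rpow_add_of_nonneg _ _ (by norm_num) (by norm_num)]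
              norm_num
          _ ≤ ((∫⁻ t, (‖ρ t‖ₑ ^ (1 / 2 : ℝ)) ^ (2 : ℝ)) ^ (1 / 2 : ℝ) *
              (∫⁻ t, (‖ρ t‖ₑ ^ (1 / 2 : ℝ) * ‖f (x - t)‖ₑ) ^ (2 : ℝ)) ^ (1 / 2 : ℝ)) ^ 2 := by
              gcongr
              exact ENNReal.lintegral_mul_le_Lp_mul_Lq volume Real.HolderConjugate.two_two
                (hρm.pow_const _).aemeasurable ((hρm.pow_const _).aemeasurable.mul hfx)
          _ = ∫⁻ t, ‖ρ t‖ₑ * ‖f (x - t)‖ₑ ^ 2 := by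
              rw [mul_pow, ← ENNReal.rpow_two, ← ENNReal.rpow_two, ← ENNReal.rpow_mul,
                ← ENNReal.rpow_mul]
              simp only [ENNReal.mul_rpow_of_nonneg _ _ zero_le_two, ← ENNReal.rpow_mul]
              norm_num [hρ1]
    _ = ∫⁻ t, ∫⁻ x, ‖ρ t‖ₑ * ‖f (x - t)‖ₑ ^ 2 := lintegral_lintegral_swap hm
    _ = ∫⁻ t, ‖ρ t‖ₑ * ∫⁻ x, ‖f x‖ₑ ^ 2 := by
        refine lintegral_congr fun t => ?_
        rw [lintegral_const_mul' _ _ (by simp)]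
        congr 1
        exact lintegral_sub_right_eq_self (fun x => ‖f x‖ₑ ^ 2) t
    _ = ∫⁻ x, ‖f x‖ₑ ^ 2 := by
        rw [lintegral_mul_const _ hρ.measurable.enorm, hρ1, one_mul]

end WeakDeriv
-- Hardy's inequality in three of the variables.
section Hardy

open Filter Topology Convolution ContinuousLinearMap

variable {V : Type*} [NormedAddCommGroup V] [NormedSpace ℝ V] [FiniteDimensional ℝ V]
  [MeasureSpace V] [BorelSpace V] [(volume : Measure V).IsAddHaarMeasure]

/-- The three right-hand sides add up to the divergence of the bounded field p / √(|p|² + δ²), which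
drives the integration by parts in `hardy_of_contDiff`. -/
theorem hasDerivAt_regularized_direction (p : Space) {δ : ℝ} (hδ : 0 < δ) (i : Fin 3) :
    HasDerivAt (fun τ : ℝ => (p + τ • EuclideanSpace.single i (1 : ℝ)) i
        / √(‖p + τ • EuclideanSpace.single i (1 : ℝ)‖ ^ 2 + δ ^ 2))
      (1 / √(‖p‖ ^ 2 + δ ^ 2) - p i ^ 2 / √(‖p‖ ^ 2 + δ ^ 2) ^ 3) 0 := by
  have hpos : 0 < ‖p‖ ^ 2 + δ ^ 2 := by positivity
  have e1 : ∀ τ : ℝ, (p + τ • EuclideanSpace.single i (1 : ℝ)) i = p i + τ := by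
    intro τ; simp
  have e2 : ∀ τ : ℝ, ‖p + τ • EuclideanSpace.single i (1 : ℝ)‖ ^ 2
      = ‖p‖ ^ 2 + 2 * τ * p i + τ ^ 2 := by
    intro τ
    rw [norm_add_sq_real, inner_smul_right, EuclideanSpace.inner_single_right, norm_smul,
      PiLp.norm_single]
    simp; ring
  simp only [e1, e2]
  have h1 : HasDerivAt (fun τ : ℝ => p i + τ) 1 0 := (hasDerivAt_id 0).const_add _
  have h2 : HasDerivAt (fun τ : ℝ => ‖p‖ ^ 2 + 2 * τ * p i + τ ^ 2 + δ ^ 2) (2 * p i) 0 := by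
    have := (((((hasDerivAt_id (0 : ℝ)).const_mul 2).mul_const (p i)).const_add (‖p‖ ^ 2)).add
      ((hasDerivAt_id (0 : ℝ)).pow 2)).add_const (δ ^ 2)
    simpa using this
  have h3 := h1.div (h2.sqrt (by simpa using hpos.ne')) (by simpa using (Real.sqrt_pos.2 hpos).ne')
  refine h3.congr_deriv ?_ |>.congr_of_eventuallyEq (Eventually.of_forall fun _ => rfl)
  have hs : 0 < √(‖p‖ ^ 2 + δ ^ 2) := Real.sqrt_pos.2 hpos
  simp only [mul_zero, zero_mul, add_zero, ne_eq, OfNat.ofNat_ne_zero, not_false_eq_true, zero_pow]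
  field_simp

/-- Put y = L x - a and s = √(|y|² + δ²). The field F = y / s satisfies |F| ≤ 1 and div F ≥ 2 / s in
the three directions `v i`. Integrating |u|² div F by parts leaves -2 Re(conj(u) ∇u) · F, to which
the weighted inequality between arithmetic and geometric mean applies. The regularization δ keeps F
differentiable with bounded derivatives, so no boundary term arises at y = 0. -/
theorem hardy_of_contDiff {u : V → ℂ} (hu : ContDiff ℝ 1 u) (hu2 : MemLp u 2) {v : Fin 3 → V}
    (hd : ∀ i, MemLp (fun x => fderiv ℝ u x (v i)) 2) (L : V →L[ℝ] Space)
    (hL : ∀ i, L (v i) = EuclideanSpace.single i 1) (a : Space) {δ t : ℝ} (hδ : 0 < δ)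
    (ht : 0 < t) :
    ∫ x, 2 * ‖u x‖ ^ 2 / √(‖L x - a‖ ^ 2 + δ ^ 2)
      ≤ ∫ x, (t * ∑ i, ‖fderiv ℝ u x (v i)‖ ^ 2 + t⁻¹ * ‖u x‖ ^ 2) := by
  set s : V → ℝ := fun x => √(‖L x - a‖ ^ 2 + δ ^ 2) with hs
  have hpos : ∀ x, 0 < ‖L x - a‖ ^ 2 + δ ^ 2 := fun x => by positivity
  have hs0 : ∀ x, 0 < s x := fun x => Real.sqrt_pos.2 (hpos x)
  have hs2 : ∀ x, s x ^ 2 = ‖L x - a‖ ^ 2 + δ ^ 2 := fun x => Real.sq_sqrt (hpos x).le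
  have hsδ : ∀ x, δ ≤ s x := fun x => Real.le_sqrt_of_sq_le (by nlinarith [sq_nonneg ‖L x - a‖])
  have hsc : Continuous s := by fun_prop
  have hcoord : ∀ x i, (L x - a) i ^ 2 ≤ s x ^ 2 := by
    intro x i
    rw [hs2, EuclideanSpace.real_norm_sq_eq]
    have := Finset.single_le_sum (f := fun j => (L x - a) j ^ 2) (fun j _ => sq_nonneg _)
      (Finset.mem_univ i)
    nlinarith [sq_nonneg δ]
  set F : Fin 3 → V → ℝ := fun i x => (L x - a) i / s x with hF
  set F' : Fin 3 → V → ℝ := fun i x => 1 / s x - (L x - a) i ^ 2 / s x ^ 3 with hF'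
  have hFc : ∀ i, Continuous (F i) := fun i =>
    Continuous.div (by fun_prop) hsc fun x => (hs0 x).ne'
  have hF'c : ∀ i, Continuous (F' i) := fun i =>
    (Continuous.div continuous_const hsc fun x => (hs0 x).ne').sub
      (Continuous.div (by fun_prop) (hsc.pow 3) fun x => (pow_pos (hs0 x) 3).ne')
  have hF1 : ∀ i x, ‖F i x‖ ≤ 1 := by
    intro i x
    rw [hF, Real.norm_eq_abs, abs_div, abs_of_pos (hs0 x), div_le_one (hs0 x)]
    exact abs_le_of_sq_le_sq (hcoord x i) (hs0 x).le
  have hF'1 : ∀ i x, ‖F' i x‖ ≤ 1 / δ := by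
    intro i x
    have h1 : (L x - a) i ^ 2 / s x ^ 3 ≤ 1 / s x := by
      rw [div_le_div_iff₀ (pow_pos (hs0 x) 3) (hs0 x)]
      nlinarith [hcoord x i, hs0 x]
    have h2 : 1 / s x ≤ 1 / δ := one_div_le_one_div_of_le hδ (hsδ x)
    have h3 : 0 ≤ (L x - a) i ^ 2 / s x ^ 3 := div_nonneg (sq_nonneg _) (pow_pos (hs0 x) 3).le
    rw [Real.norm_eq_abs, abs_le]
    constructor
    · have : (0 : ℝ) ≤ 1 / δ := by positivity
      simp only [hF']; linarith
    · simp only [hF']; linarith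
  have hw : Integrable fun x => ‖u x‖ ^ 2 := hu2.integrable_norm_pow two_ne_zero
  have hdw : ∀ i, Integrable fun x => ‖fderiv ℝ u x (v i)‖ ^ 2 := fun i =>
    (hd i).integrable_norm_pow two_ne_zero
  have huc : Continuous u := hu.continuous
  have hudc : ∀ i, Continuous fun x => fderiv ℝ u x (v i) := fun i =>
    (hu.continuous_fderiv one_ne_zero).clm_apply continuous_const
  have hw' : ∀ i, Integrable fun x => 2 * inner ℝ (u x) (fderiv ℝ u x (v i)) := by
    intro i
    refine (hw.add (hdw i)).mono' (by fun_prop) (ae_of_all _ fun x => ?_)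
    rw [norm_mul, Real.norm_ofNat, Real.norm_eq_abs]
    have := abs_real_inner_le_norm (u x) (fderiv ℝ u x (v i))
    simp only [Pi.add_apply]
    nlinarith [sq_nonneg (‖u x‖ - ‖fderiv ℝ u x (v i)‖)]
  have hibp : ∀ i, ∫ x, ‖u x‖ ^ 2 * F' i x
      = - ∫ x, (2 * inner ℝ (u x) (fderiv ℝ u x (v i))) * F i x := by
    intro i
    refine integral_bilinear_hasLineDerivAt_right_eq_neg_left_of_integrable (μ := volume)
      (f := fun x => ‖u x‖ ^ 2) (g := F i) (v := v i) (B := ContinuousLinearMap.mul ℝ ℝ)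
      ((hw' i).mul_bdd (c := 1) (hFc i).aestronglyMeasurable (ae_of_all _ (hF1 i)))
      (hw.mul_bdd (c := 1 / δ) (hF'c i).aestronglyMeasurable (ae_of_all _ (hF'1 i)))
      (hw.mul_bdd (c := 1) (hFc i).aestronglyMeasurable (ae_of_all _ (hF1 i))) ?_ ?_
    · intro x _
      have := (((hu.differentiable one_ne_zero) x).hasFDerivAt.norm_sq).hasLineDerivAt (v i)
      simpa only [smul_apply, ContinuousLinearMap.comp_apply, innerSL_apply_apply, nsmul_eq_mul, Nat.cast_ofNat] using this
    · intro x _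
      have := hasDerivAt_regularized_direction (L x - a) hδ i
      rw [HasLineDerivAt]
      have e : ∀ τ : ℝ, L (x + τ • v i) - a = L x - a + τ • EuclideanSpace.single i (1 : ℝ) := by
        intro τ; rw [map_add, map_smul, hL]; abel
      simp only [hF, hs, e]
      exact this
  -- The divergence is 3/s - |y|²/s³, and |y|² ≤ s²; the dimension 3 leaves 2/s.
  have hsum : ∀ x, 2 * ‖u x‖ ^ 2 / s x ≤ ∑ i, ‖u x‖ ^ 2 * F' i x := by
    intro x
    have h1 : ∑ i, F' i x = 3 / s x - ‖L x - a‖ ^ 2 / s x ^ 3 := by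
      rw [EuclideanSpace.real_norm_sq_eq]
      simp only [hF', Fin.sum_univ_three]; ring
    have h2 : ‖L x - a‖ ^ 2 / s x ^ 3 ≤ 1 / s x := by
      rw [div_le_div_iff₀ (pow_pos (hs0 x) 3) (hs0 x)]
      have := hs2 x
      nlinarith [hs0 x, sq_nonneg δ, mul_nonneg (hs0 x).le (sq_nonneg δ)]
    rw [← Finset.mul_sum, h1]
    have : 2 / s x ≤ 3 / s x - ‖L x - a‖ ^ 2 / s x ^ 3 := by
      have : 3 / s x = 2 / s x + 1 / s x := by ring
      linarith
    calc 2 * ‖u x‖ ^ 2 / s x = ‖u x‖ ^ 2 * (2 / s x) := by ring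
      _ ≤ _ := by gcongr
  have hpt : ∀ x, ∑ i, -((2 * inner ℝ (u x) (fderiv ℝ u x (v i))) * F i x)
      ≤ t * ∑ i, ‖fderiv ℝ u x (v i)‖ ^ 2 + t⁻¹ * ‖u x‖ ^ 2 := by
    intro x
    have h1 : ∀ i, -((2 * inner ℝ (u x) (fderiv ℝ u x (v i))) * F i x)
        ≤ t * ‖fderiv ℝ u x (v i)‖ ^ 2 + t⁻¹ * ‖u x‖ ^ 2 * F i x ^ 2 := by
      intro i
      have h2 := abs_real_inner_le_norm (u x) (fderiv ℝ u x (v i))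
      have h3 : -((2 * inner ℝ (u x) (fderiv ℝ u x (v i))) * F i x)
          ≤ 2 * (‖u x‖ * ‖fderiv ℝ u x (v i)‖) * |F i x| := by
        refine (le_abs_self _).trans ?_
        rw [abs_neg, abs_mul, abs_mul, abs_two]
        gcongr
      refine h3.trans ?_
      have h4 := sq_nonneg (t * ‖fderiv ℝ u x (v i)‖ - ‖u x‖ * |F i x|)
      have h5 : t⁻¹ * (t * ‖fderiv ℝ u x (v i)‖ - ‖u x‖ * |F i x|) ^ 2
          = t * ‖fderiv ℝ u x (v i)‖ ^ 2 + t⁻¹ * ‖u x‖ ^ 2 * F i x ^ 2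
            - 2 * (‖u x‖ * ‖fderiv ℝ u x (v i)‖) * |F i x| := by
        rw [← sq_abs (F i x)]; field_simp; ring
      have h6 : 0 ≤ t⁻¹ * (t * ‖fderiv ℝ u x (v i)‖ - ‖u x‖ * |F i x|) ^ 2 := by positivity
      linarith
    refine (Finset.sum_le_sum fun i _ => h1 i).trans ?_
    rw [Finset.sum_add_distrib, ← Finset.mul_sum, ← Finset.mul_sum]
    have h7 : ∑ i, F i x ^ 2 ≤ 1 := by
      simp only [hF, div_pow, ← Finset.sum_div]
      rw [div_le_one (by have := hs0 x; positivity), hs2, EuclideanSpace.real_norm_sq_eq]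
      nlinarith [sq_nonneg δ]
    have h8 : 0 ≤ t⁻¹ * ‖u x‖ ^ 2 := by positivity
    nlinarith
  have hFi : ∀ i, Integrable fun x => ‖u x‖ ^ 2 * F' i x := fun i =>
    hw.mul_bdd (c := 1 / δ) (hF'c i).aestronglyMeasurable (ae_of_all _ (hF'1 i))
  have hFi' : ∀ i, Integrable fun x => (2 * inner ℝ (u x) (fderiv ℝ u x (v i))) * F i x := fun i =>
    (hw' i).mul_bdd (c := 1) (hFc i).aestronglyMeasurable (ae_of_all _ (hF1 i))
  calc ∫ x, 2 * ‖u x‖ ^ 2 / s x ≤ ∫ x, ∑ i, ‖u x‖ ^ 2 * F' i x := by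
        refine integral_mono_of_nonneg (ae_of_all _ fun x => ?_)
          (integrable_finsetSum _ fun i _ => hFi i) (ae_of_all _ hsum)
        have := hs0 x; simp only [Pi.zero_apply]; positivity
    _ = ∫ x, ∑ i, -((2 * inner ℝ (u x) (fderiv ℝ u x (v i))) * F i x) := by
        rw [integral_finsetSum _ fun i _ => hFi i,
          integral_finsetSum _ fun i _ => (show Integrable (fun x => -((2 * inner ℝ (u x) (fderiv ℝ u x (v i))) * F i x)) from (hFi' i).neg)]
        exact Finset.sum_congr rfl fun i _ => by rw [hibp i, integral_neg]
    _ ≤ _ := by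
        refine integral_mono (integrable_finsetSum _ fun i _ => (hFi' i).neg) ?_ hpt
        exact ((integrable_finsetSum _ fun i _ => hdw i).const_mul _).add (hw.const_mul _)

theorem memLp_two_iff_lintegral {X : Type*} [MeasurableSpace X] {μ : Measure X} {f : X → ℂ}
    (hf : AEStronglyMeasurable f μ) : MemLp f 2 μ ↔ ∫⁻ x, ‖f x‖ₑ ^ 2 ∂μ < ⊤ := by
  rw [MemLp, and_iff_right hf, eLpNorm_lt_top_iff_lintegral_rpow_enorm_lt_top two_ne_zero
    ENNReal.ofNat_ne_top]
  simp

theorem ofReal_integral_norm_sq {X : Type*} [MeasurableSpace X] {μ : Measure X} {f : X → ℂ}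
    (hf : MemLp f 2 μ) : ENNReal.ofReal (∫ x, ‖f x‖ ^ 2 ∂μ) = ∫⁻ x, ‖f x‖ₑ ^ 2 ∂μ := by
  rw [ofReal_integral_eq_lintegral_ofReal (hf.integrable_norm_pow two_ne_zero)
    (ae_of_all _ fun x => by positivity)]
  refine lintegral_congr fun x => ?_
  rw [ENNReal.ofReal_pow (norm_nonneg _), ofReal_norm]

/-- A weak form of Hardy's inequality in three of the variables of `V`. -/
theorem hardy_inequality {f : V → ℂ} (hf : MemLp f 2) {v : Fin 3 → V} {g : Fin 3 → V → ℂ}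
    (hg : ∀ i, MemLp (g i) 2) (hfg : ∀ i, IsWeakDeriv (v i) f (g i)) (L : V →L[ℝ] Space)
    (hL : ∀ i, L (v i) = EuclideanSpace.single i 1) (a : Space) {t : ℝ} (ht : 0 < t) :
    ∫⁻ x, ENNReal.ofReal (2 * ‖f x‖ ^ 2 / ‖L x - a‖)
      ≤ ENNReal.ofReal (t * (∑ i, ∫ x, ‖g i x‖ ^ 2) + t⁻¹ * ∫ x, ‖f x‖ ^ 2) := by
  have hfl : LocallyIntegrable f := hf.locallyIntegrable one_le_two
  have hgl : ∀ i, LocallyIntegrable (g i) := fun i => (hg i).locallyIntegrable one_le_two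
  -- The outer radius is twice the inner one for all n. This bounded ratio lets Lebesgue
  -- differentiation give convergence of the mollifications almost everywhere.
  let b : ℕ → ContDiffBump (0 : V) := fun n =>
    ⟨1 / (n + 1), 2 / (n + 1), by positivity, by gcongr; norm_num⟩
  let ρ : ℕ → V → ℝ := fun n => (b n).normed volume
  have hρ : ∀ n, ContDiff ℝ ∞ (ρ n) := fun n => (b n).contDiff_normed
  have hρc : ∀ n, HasCompactSupport (ρ n) := fun n => (b n).hasCompactSupport_normed
  have hρ0 : ∀ n x, 0 ≤ ρ n x := fun n x => (b n).nonneg_normed x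
  have hρ1 : ∀ n, ∫ x, ρ n x = 1 := fun n => (b n).integral_normed
  let u : ℕ → V → ℂ := fun n => ρ n ⋆[lsmul ℝ ℝ, volume] f
  have hu : ∀ n, ContDiff ℝ 1 (u n) := fun n =>
    (hρc n).contDiff_convolution_left (n := 1) (lsmul ℝ ℝ : ℝ →L[ℝ] ℂ →L[ℝ] ℂ)
      ((hρ n).of_le (by simp)) hfl
  have hdu : ∀ n i x, fderiv ℝ (u n) x (v i) = (ρ n ⋆[lsmul ℝ ℝ, volume] g i) x :=
    fun n i x => fderiv_convolution_of_isWeakDeriv (hfg i) hfl (hρ n) (hρc n) x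
  have hu2 : ∀ n, MemLp (u n) 2 := fun n => by
    rw [memLp_two_iff_lintegral (hu n).continuous.aestronglyMeasurable]
    refine (lintegral_enorm_convolution_sq_le hf.1 (hρ n).continuous (hρ0 n) (hρ1 n)).trans_lt ?_
    exact (memLp_two_iff_lintegral hf.1).1 hf
  have hdu2 : ∀ n i, MemLp (fun x => fderiv ℝ (u n) x (v i)) 2 := fun n i => by
    rw [memLp_two_iff_lintegral (((hu n).continuous_fderiv one_ne_zero).clm_apply
      continuous_const).aestronglyMeasurable]
    simp only [hdu]
    refine (lintegral_enorm_convolution_sq_le (hg i).1 (hρ n).continuous (hρ0 n)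
      (hρ1 n)).trans_lt ?_
    exact (memLp_two_iff_lintegral (hg i).1).1 (hg i)
  have hule : ∀ n, ∫ x, ‖u n x‖ ^ 2 ≤ ∫ x, ‖f x‖ ^ 2 := fun n => by
    rw [← ENNReal.ofReal_le_ofReal_iff (integral_nonneg fun x => by positivity),
      ofReal_integral_norm_sq (hu2 n), ofReal_integral_norm_sq hf]
    exact lintegral_enorm_convolution_sq_le hf.1 (hρ n).continuous (hρ0 n) (hρ1 n)
  have hdule : ∀ n i, ∫ x, ‖fderiv ℝ (u n) x (v i)‖ ^ 2 ≤ ∫ x, ‖g i x‖ ^ 2 := fun n i => by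
    rw [← ENNReal.ofReal_le_ofReal_iff (integral_nonneg fun x => by positivity),
      ofReal_integral_norm_sq (hdu2 n i), ofReal_integral_norm_sq (hg i)]
    simp only [hdu]
    exact lintegral_enorm_convolution_sq_le (hg i).1 (hρ n).continuous (hρ0 n) (hρ1 n)
  have hlim : ∀ᵐ x, Tendsto (fun n => u n x) atTop (𝓝 (f x)) := by
    refine ContDiffBump.ae_convolution_tendsto_right_of_locallyIntegrable (K := 2) ?_
      (Eventually.of_forall fun n => ?_) hfl
    · have := (tendsto_one_div_add_atTop_nhds_zero_nat (𝕜 := ℝ)).const_mul 2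
      simpa [b, div_eq_mul_inv] using this
    · simp only [b]; apply le_of_eq; ring
  let δ : ℕ → ℝ := fun n => 1 / (n + 1)
  have hδ : ∀ n, 0 < δ n := fun n => by positivity
  have hδlim : Tendsto δ atTop (𝓝 0) := tendsto_one_div_add_atTop_nhds_zero_nat
  -- Mollification and regularization of the Coulomb singularity are removed together, by Fatou's
  -- lemma; the bound on the right is uniform in n.
  let W : ℕ → V → ℝ := fun n x => 2 * ‖u n x‖ ^ 2 / √(‖L x - a‖ ^ 2 + δ n ^ 2)
  have hWc : ∀ n, Continuous (W n) := fun n => by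
    have := (hu n).continuous
    refine Continuous.div (by fun_prop) (by fun_prop) fun x => ?_
    have := hδ n
    positivity
  have hW0 : ∀ n x, 0 ≤ W n x := fun n x => by positivity
  have hWi : ∀ n, ∫⁻ x, ENNReal.ofReal (W n x)
      ≤ ENNReal.ofReal (t * (∑ i, ∫ x, ‖g i x‖ ^ 2) + t⁻¹ * ∫ x, ‖f x‖ ^ 2) := by
    intro n
    have hint : Integrable (W n) := by
      refine (((hu2 n).integrable_norm_pow two_ne_zero).const_mul (2 / δ n)).mono'
        (hWc n).aestronglyMeasurable (ae_of_all _ fun x => ?_)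
      rw [Real.norm_of_nonneg (hW0 n x)]
      have h1 : δ n ≤ √(‖L x - a‖ ^ 2 + δ n ^ 2) :=
        Real.le_sqrt_of_sq_le (by nlinarith [sq_nonneg ‖L x - a‖])
      calc W n x ≤ 2 * ‖u n x‖ ^ 2 / δ n := by
            have := hδ n
            simp only [W]; gcongr
        _ = _ := by ring
    rw [← ofReal_integral_eq_lintegral_ofReal hint (ae_of_all _ (hW0 n))]
    refine ENNReal.ofReal_le_ofReal ((hardy_of_contDiff (hu n) (hu2 n) (hdu2 n) L hL a (hδ n)
      ht).trans ?_)
    rw [integral_add ((integrable_finsetSum _ fun i _ =>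
        (hdu2 n i).integrable_norm_pow two_ne_zero).const_mul _)
        (((hu2 n).integrable_norm_pow two_ne_zero).const_mul _),
      integral_const_mul, integral_const_mul, integral_finsetSum _ fun i _ =>
        (hdu2 n i).integrable_norm_pow two_ne_zero]
    exact add_le_add (mul_le_mul_of_nonneg_left (Finset.sum_le_sum fun i _ => hdule n i) ht.le)
      (mul_le_mul_of_nonneg_left (hule n) (by positivity))
  calc ∫⁻ x, ENNReal.ofReal (2 * ‖f x‖ ^ 2 / ‖L x - a‖)
      ≤ ∫⁻ x, liminf (fun n => ENNReal.ofReal (W n x)) atTop := by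
        refine lintegral_mono_ae ?_
        filter_upwards [hlim] with x hx
        -- At the singularity the integrand on the left is 0 by the convention for division by zero,
        -- so no null set has to be excluded there.
        rcases eq_or_ne (L x - a) 0 with h0 | h0
        · simp [h0]
        · refine le_of_eq (Tendsto.liminf_eq ?_).symm
          refine ENNReal.tendsto_ofReal (Tendsto.div ((hx.norm.pow 2).const_mul 2) ?_
            (norm_ne_zero_iff.2 h0))
          have : Tendsto (fun n => √(‖L x - a‖ ^ 2 + δ n ^ 2)) atTop
              (𝓝 (√(‖L x - a‖ ^ 2 + 0 ^ 2))) :=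
            ((hδlim.pow 2).const_add _).sqrt
          simpa using this
    _ ≤ liminf (fun n => ∫⁻ x, ENNReal.ofReal (W n x)) atTop :=
        lintegral_liminf_le fun n => (hWc n).measurable.ennreal_ofReal
    _ ≤ _ := by
        refine liminf_le_of_frequently_le' (Frequently.of_forall hWi)

end Hardy
-- Semibounded forms and the bottom of the spectrum.
section Forms

variable {G H : Type*} [NormedAddCommGroup G] [InnerProductSpace ℂ G] [CompleteSpace G]
  [NormedAddCommGroup H] [InnerProductSpace ℂ H] [CompleteSpace H]

open ContinuousLinearMap

theorem inner_self_eq_ofReal {H : Type*} [NormedAddCommGroup H] [InnerProductSpace ℂ H] (z : H) : ⟪z, z⟫_ℂ = ((‖z‖ ^ 2 : ℝ) : ℂ) := by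
  rw [inner_self_eq_norm_sq_to_K]; simp

/-- Real numbers far below a semibounded closed form are in the resolvent set of its operator. -/
theorem notMem_graphSpectrum_of_coercive (J : G →L[ℂ] H) (T : G →L[ℂ] G) {c C : ℝ} (hc : 0 < c)
    (hcoer : ∀ x, c * ‖x‖ ^ 2 ≤ (⟪x, T x⟫_ℂ).re + C * ‖J x‖ ^ 2) {Q : Set H} {q : H → H → ℂ}
    (hQ : Q = Set.range J) (hq : ∀ x y, q (J x) (J y) = ⟪x, T y⟫_ℂ) {E : ℝ} (hE : E ≤ -C) :
    (E : ℂ) ∉ graphSpectrum (FormOperator Q q) := by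
  -- Here `G` is the form domain as a Hilbert space of its own, `J` its map into `H`, and `T`
  -- represents the form on `G`. Then `S` represents the form shifted by `E`. It is coercive for `E
  -- ≤ -C`, hence invertible (Lax-Milgram), and J S⁻¹ J* is the resolvent at `E`.
  set S : G →L[ℂ] G := T - (E : ℂ) • (adjoint J ∘L J) with hS
  have hSx : ∀ x y, ⟪x, S y⟫_ℂ = ⟪x, T y⟫_ℂ - E * ⟪J x, J y⟫_ℂ := by
    intro x y
    simp [hS, inner_sub_right, inner_smul_right, adjoint_inner_right]
  have hunit : IsUnit S := by
    refine isUnit_of_forall_le_norm_inner_map S (c := ⟨c, hc.le⟩) hc fun x => ?_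
    rw [norm_inner_symm]
    refine le_trans ?_ (Complex.re_le_norm _)
    rw [hSx, Complex.sub_re, inner_self_eq_ofReal,
      ← Complex.ofReal_mul, Complex.ofReal_re]
    have := hcoer x
    have h2 : E * ‖J x‖ ^ 2 ≤ -C * ‖J x‖ ^ 2 := by gcongr
    change ‖x‖ ^ 2 * c ≤ _
    linarith
  obtain ⟨U, hU⟩ := hunit
  have hr : ∀ y, S ((↑U⁻¹ : G →L[ℂ] G) y) = y := fun y => by
    rw [← hU, ← mul_apply_eq_comp, Units.mul_inv, one_apply_eq_self]
  have hl : ∀ y, (↑U⁻¹ : G →L[ℂ] G) (S y) = y := fun y => by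
    rw [← hU, ← mul_apply_eq_comp, Units.inv_mul, one_apply_eq_self]
  simp only [graphSpectrum, Set.mem_ofPred_eq, not_not]
  refine ⟨J ∘L (↑U⁻¹ : G →L[ℂ] G) ∘L adjoint J, fun ψ η => ?_⟩
  constructor
  · rintro ⟨hψ, h⟩
    rw [hQ] at hψ
    obtain ⟨y, rfl⟩ := hψ
    have h1 : S y = adjoint J η := by
      refine ext_inner_left ℂ fun x => ?_
      have h2 := h (J x) (hQ ▸ ⟨x, rfl⟩)
      rw [hq, inner_add_right, inner_smul_right] at h2
      rw [hSx, adjoint_inner_right, h2]; ring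
    simp [← h1, hl]
  · intro h
    have h' : ψ = J ((↑U⁻¹ : G →L[ℂ] G) (adjoint J η)) := h
    subst h'
    refine ⟨hQ ▸ ⟨_, rfl⟩, fun φ hφ => ?_⟩
    rw [hQ] at hφ
    obtain ⟨x, rfl⟩ := hφ
    have h2 := hSx x ((↑U⁻¹ : G →L[ℂ] G) (adjoint J η))
    rw [hr, adjoint_inner_right] at h2
    rw [hq, inner_add_right, inner_smul_right, h2]; ring

/-- The greatest lower bound of a form lies in the spectrum of its operator. -/
theorem exists_gt_lower_bound_of_notMem_graphSpectrum (J : G →L[ℂ] H) (T : G →L[ℂ] G)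
    (hT : ∀ x y, ⟪T x, y⟫_ℂ = ⟪x, T y⟫_ℂ) {Q : Set H} {q : H → H → ℂ}
    (hQ : Q = Set.range J) (hq : ∀ x y, q (J x) (J y) = ⟪x, T y⟫_ℂ) {m : ℝ}
    (hm : ∀ x, m * ‖J x‖ ^ 2 ≤ (⟪x, T x⟫_ℂ).re)
    (hspec : (m : ℂ) ∉ graphSpectrum (FormOperator Q q)) :
    ∃ β > 0, ∀ x, (m + β) * ‖J x‖ ^ 2 ≤ (⟪x, T x⟫_ℂ).re := by
  simp only [graphSpectrum, Set.mem_ofPred_eq, not_not] at hspec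
  obtain ⟨B, hB⟩ := hspec
  -- The gap above `m` comes from the size of the resolvent `B`: all that is used below is β ‖B‖ ≤
  -- 1.
  set β : ℝ := 1 / (‖B‖ + 1) with hβ
  have hβ0 : 0 < β := by positivity
  refine ⟨β, hβ0, fun x => ?_⟩
  obtain ⟨hψ, h⟩ := (hB (B (J x)) (J x)).2 rfl
  rw [hQ] at hψ
  obtain ⟨y, hy⟩ := hψ
  have hform : ∀ z, ⟪z, T y⟫_ℂ = ⟪J z, J x⟫_ℂ + m * ⟪J z, J y⟫_ℂ := by
    intro z
    have := h (J z) (hQ ▸ ⟨z, rfl⟩)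
    rw [← hy, hq, inner_add_right, inner_smul_right] at this
    exact this
  -- With J y = B J x, the form shifted by `m` maps (z, y) to ⟪J z, J x⟫. Its nonnegativity on x - β
  -- y thus reads q(x) - m ‖J x‖² ≥ 2 β ‖J x‖² - β² ⟪J y, J x⟫, and the last term eats up at most
  -- one of the two β ‖J x‖².
  have h0 := hm (x - (β : ℂ) • y)
  have e1 : (⟪x - (β : ℂ) • y, T (x - (β : ℂ) • y)⟫_ℂ).re
      = (⟪x, T x⟫_ℂ).re - 2 * β * (⟪x, T y⟫_ℂ).re + β ^ 2 * (⟪y, T y⟫_ℂ).re := by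
    have hyx : ⟪y, T x⟫_ℂ = starRingEnd ℂ ⟪x, T y⟫_ℂ := by
      rw [← hT, inner_conj_symm]
    simp only [map_sub, map_smul, inner_sub_left, inner_sub_right, inner_smul_left,
      inner_smul_right, hyx, Complex.conj_ofReal, Complex.sub_re, Complex.re_ofReal_mul,
      Complex.conj_re]
    ring
  have e2 : ‖J (x - (β : ℂ) • y)‖ ^ 2
      = ‖J x‖ ^ 2 - 2 * β * (⟪J x, J y⟫_ℂ).re + β ^ 2 * ‖J y‖ ^ 2 := by
    rw [map_sub, map_smul, @norm_sub_sq ℂ, inner_smul_right, norm_smul, mul_pow]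
    simp
    ring
  rw [e1, e2, hform x, hform y, inner_self_eq_ofReal, inner_self_eq_ofReal] at h0
  simp only [Complex.add_re, Complex.re_ofReal_mul, Complex.ofReal_re] at h0
  have h3 : (⟪J y, J x⟫_ℂ).re ≤ ‖B‖ * ‖J x‖ ^ 2 := by
    refine (Complex.re_le_norm _).trans ((norm_inner_le_norm _ _).trans ?_)
    rw [hy, pow_two, ← mul_assoc]
    gcongr
    exact B.le_opNorm _
  have h4 : β * ‖B‖ ≤ 1 := by
    rw [hβ, one_div, inv_mul_le_iff₀ (by positivity)]; linarith
  have h5 : β ^ 2 * (⟪J y, J x⟫_ℂ).re ≤ β * ‖J x‖ ^ 2 := by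
    calc β ^ 2 * (⟪J y, J x⟫_ℂ).re ≤ β ^ 2 * (‖B‖ * ‖J x‖ ^ 2) := by gcongr
      _ = (β * ‖B‖) * (β * ‖J x‖ ^ 2) := by ring
      _ ≤ 1 * (β * ‖J x‖ ^ 2) := by gcongr
      _ = _ := one_mul _
  nlinarith

/-- The bottom of the spectrum is at most the form on a normalized vector. -/
theorem sInf_graphSpectrum_mul_le (J : G →L[ℂ] H) (T : G →L[ℂ] G)
    (hT : ∀ x y, ⟪T x, y⟫_ℂ = ⟪x, T y⟫_ℂ) {c C : ℝ} (hc : 0 < c)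
    (hcoer : ∀ x, c * ‖x‖ ^ 2 ≤ (⟪x, T x⟫_ℂ).re + C * ‖J x‖ ^ 2) {Q : Set H} {q : H → H → ℂ}
    (hQ : Q = Set.range J) (hq : ∀ x y, q (J x) (J y) = ⟪x, T y⟫_ℂ) (x : G) :
    sInf {E : ℝ | (E : ℂ) ∈ graphSpectrum (FormOperator Q q)} * ‖J x‖ ^ 2 ≤ (⟪x, T x⟫_ℂ).re := by
  by_cases hx : J x = 0
  · have := hcoer x
    have h1 : 0 ≤ c * ‖x‖ ^ 2 := by positivity
    rw [hx] at this ⊢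
    simp only [norm_zero] at this ⊢
    linarith
  have hx0 : 0 < ‖J x‖ ^ 2 := by have := norm_pos_iff.2 hx; positivity
  -- `S` consists of the lower bounds of the form. Its supremum is again a lower bound; were it in
  -- the resolvent set, it could be increased.
  set S : Set ℝ := {r | ∀ x, r * ‖J x‖ ^ 2 ≤ (⟪x, T x⟫_ℂ).re} with hS
  have hSC : -C ∈ S := fun y => by
    have := hcoer y
    have h1 : 0 ≤ c * ‖y‖ ^ 2 := by positivity
    linarith
  have hSb : BddAbove S := ⟨(⟪x, T x⟫_ℂ).re / ‖J x‖ ^ 2, fun r hr => by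
    rw [le_div_iff₀ hx0]; exact hr x⟩
  have hScl : IsClosed S := by
    rw [hS, Set.ofPred_forall]
    exact isClosed_iInter fun y => isClosed_le (by fun_prop) continuous_const
  have hm : sSup S ∈ S := hScl.csSup_mem ⟨_, hSC⟩ hSb
  refine le_trans ?_ (hm x)
  gcongr
  -- That the spectrum is bounded below is essential: the real `sInf` of a set unbounded below would
  -- be the default value 0.
  refine csInf_le ⟨-C, fun E hE => ?_⟩ ?_
  · by_contra hlt
    exact notMem_graphSpectrum_of_coercive J T hc hcoer hQ hq (not_le.1 hlt).le hE
  · by_contra hspec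
    obtain ⟨β, hβ, hβS⟩ := exists_gt_lower_bound_of_notMem_graphSpectrum J T hT hQ hq hm hspec
    have := le_csSup hSb (show sSup S + β ∈ S from hβS)
    linarith

end Forms
/-! ### Measures consisting of finitely many copies of Lebesgue measure -/

/-- `μ` is the sum of the images of Lebesgue measure on `V` under the embeddings `e s`. -/
structure IsSlicing {S V X : Type*} [MeasureSpace V] [MeasurableSpace X]
    (e : S → V → X) (μ : Measure X) : Prop where
  emb : ∀ s, MeasurableEmbedding (e s)
  eq_sum : μ = Measure.sum fun s => Measure.map (e s) volume

namespace IsSlicing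

variable {S V X : Type*} [Fintype S] [MeasureSpace V] [MeasurableSpace X] {e : S → V → X}
  {μ : Measure X}

theorem ae_iff (h : IsSlicing e μ) {p : X → Prop} :
    (∀ᵐ x ∂μ, p x) ↔ ∀ s, ∀ᵐ v : V, p (e s v) := by
  rw [h.eq_sum, Measure.ae_sum_iff]
  exact forall_congr' fun s => (h.emb s).ae_map_iff

theorem lintegral_eq (h : IsSlicing e μ) (f : X → ENNReal) :
    ∫⁻ x, f x ∂μ = ∑ s, ∫⁻ v, f (e s v) := by
  rw [h.eq_sum, lintegral_sum_measure, tsum_fintype]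
  exact Finset.sum_congr rfl fun s _ => (h.emb s).lintegral_map _

theorem map_le (h : IsSlicing e μ) (s : S) : Measure.map (e s) volume ≤ μ := by
  rw [h.eq_sum]; exact Measure.le_sum _ s

theorem memLp (h : IsSlicing e μ) {E : Type*} [NormedAddCommGroup E] {f : X → E} {p : ENNReal}
    (hf : MemLp f p μ) (s : S) : MemLp (fun v => f (e s v)) p :=
  (h.emb s).memLp_map_measure_iff.1 (hf.mono_measure (h.map_le s))

theorem integrable_iff (h : IsSlicing e μ) {E : Type*} [NormedAddCommGroup E] {f : X → E} :
    Integrable f μ ↔ ∀ s, Integrable fun v => f (e s v) := by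
  constructor
  · intro hf s
    exact (h.emb s).integrable_map_iff.1 (hf.mono_measure (h.map_le s))
  · intro hf
    rw [h.eq_sum]
    exact integrable_sum_measure (fun s => (h.emb s).integrable_map_iff.2 (hf s))
      Summable.of_finite

theorem integral_eq (h : IsSlicing e μ) {E : Type*} [NormedAddCommGroup E] [NormedSpace ℝ E]
    {f : X → E} (hf : Integrable f μ) : ∫ x, f x ∂μ = ∑ s, ∫ v, f (e s v) := by
  rw [h.eq_sum] at hf ⊢
  rw [integral_sum_measure hf, tsum_fintype]
  exact Finset.sum_congr rfl fun s _ => (h.emb s).integral_map _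

theorem ae_eq_comp (h : IsSlicing e μ) {E : Type*} {f g : X → E} (hfg : f =ᵐ[μ] g) (s : S) :
    (fun v => f (e s v)) =ᵐ[volume] fun v => g (e s v) :=
  h.ae_iff.1 hfg s

end IsSlicing

/-- The slices are the spin values, here for one electron and in `isSlicing_config` for N. All facts
about weak derivatives on sliced spaces serve both cases. -/
theorem isSlicing_spaceSpin :
    IsSlicing (fun (s : Fin 2) (x : Space) => ((x, s) : SpaceSpin)) spaceSpinMeasure where
  emb s := measurableEmbedding_prod_mk_right s
  eq_sum := by
    rw [spaceSpinMeasure, Measure.count, Measure.prod_sum_right]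
    simp only [Measure.prod_dirac]

theorem pi_count_eq_count (N : ℕ) :
    Measure.pi (fun _ : Fin N => (Measure.count : Measure (Fin 2))) = Measure.count := by
  refine Measure.ext_of_singleton fun s => ?_
  rw [Measure.pi_singleton]
  simp

theorem isSlicing_config (N : ℕ) :
    IsSlicing (fun (s : Fin N → Fin 2) (x : Fin N → Space) => fun m => ((x m, s m) : SpaceSpin))
      (configMeasure N) where
  emb s := by
    exact (MeasurableEquiv.arrowProdEquivProdArrow Space (Fin 2) (Fin N)).symm.measurableEmbedding.comp
      (measurableEmbedding_prod_mk_right s)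
  eq_sum := by
    have h := (measurePreserving_arrowProdEquivProdArrow Space (Fin 2) (Fin N)
      (fun _ => volume) (fun _ => Measure.count)).symm.map_eq
    rw [pi_count_eq_count, Measure.count, Measure.prod_sum_right,
      Measure.map_sum (MeasurableEquiv.measurable _).aemeasurable] at h
    simp only [Measure.prod_dirac] at h
    rw [configMeasure, ← h]
    congr 1; ext1 s
    rw [Measure.map_map (MeasurableEquiv.measurable _) measurable_prodMk_right]
    rfl


/-! ### Weak derivatives in `L²` -/

section HasWeakDeriv

variable {S V X ι : Type*} [NormedAddCommGroup V] [NormedSpace ℝ V]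
  [MeasureSpace V] [MeasurableSpace X] {e : S → V → X} {μ : Measure X}

/-- `g` is the weak derivative of `f` in direction `v` on each slice. -/
def HasWeakDeriv (e : S → V → X) (v : V) (f g : Lp ℂ 2 μ) : Prop :=
  ∀ s, IsWeakDeriv v (fun x => f (e s x)) (fun x => g (e s x))

variable [Fintype S]

/-- The restriction of an `L²` function to one slice. -/
noncomputable def IsSlicing.slice (h : IsSlicing e μ) (s : S) : Lp ℂ 2 μ →L[ℂ] Lp ℂ 2 (volume : Measure V) :=
  LinearMap.mkContinuous
    { toFun := fun f => (h.memLp (Lp.memLp f) s).toLp _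
      map_add' := fun f g => by
        rw [← MemLp.toLp_add]
        exact (MemLp.toLp_eq_toLp_iff _ _).2 (h.ae_eq_comp (Lp.coeFn_add f g) s)
      map_smul' := fun c f => by
        rw [RingHom.id_apply, ← MemLp.toLp_const_smul]
        exact (MemLp.toLp_eq_toLp_iff _ _).2 (h.ae_eq_comp (Lp.coeFn_smul c f) s) } 1
    fun f => by
      rw [one_mul]
      change ‖(h.memLp (Lp.memLp f) s).toLp _‖ ≤ _
      rw [Lp.norm_toLp, Lp.norm_def]
      refine ENNReal.toReal_mono (Lp.eLpNorm_ne_top f) ?_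
      change eLpNorm (f ∘ e s) 2 volume ≤ _
      rw [← (h.emb s).eLpNorm_map_measure]
      exact eLpNorm_mono_measure _ (h.map_le s)

theorem IsSlicing.coeFn_slice (h : IsSlicing e μ) (s : S) (f : Lp ℂ 2 μ) :
    h.slice s f =ᵐ[volume] fun x => f (e s x) :=
  (h.memLp (Lp.memLp f) s).coeFn_toLp

variable [BorelSpace V] [FiniteDimensional ℝ V] [(volume : Measure V).IsAddHaarMeasure]

theorem memLp_ofReal_of_hasCompactSupport {φ : V → ℝ} (hφ : Continuous φ)
    (hc : HasCompactSupport φ) : MemLp (fun x => (φ x : ℂ)) 2 :=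
  (Complex.continuous_ofReal.comp hφ).memLp_of_hasCompactSupport (hc.comp_left Complex.ofReal_zero)

theorem IsSlicing.inner_toLp_slice (h : IsSlicing e μ) (s : S) (f : Lp ℂ 2 μ) {φ : V → ℝ} (hφ : Continuous φ)
    (hc : HasCompactSupport φ) :
    ⟪(memLp_ofReal_of_hasCompactSupport hφ hc).toLp _, h.slice s f⟫_ℂ
      = ∫ x, φ x • f (e s x) := by
  rw [L2.inner_def]
  refine integral_congr_ae ?_
  filter_upwards [h.coeFn_slice s f,
    (memLp_ofReal_of_hasCompactSupport hφ hc).coeFn_toLp] with x h1 h2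
  rw [h1, h2]
  simp [RCLike.inner_apply, mul_comm]

theorem continuous_fderiv_apply_of_contDiff {φ : V → ℝ} (hφ : ContDiff ℝ ∞ φ) (v : V) :
    Continuous fun x => fderiv ℝ φ x v :=
  (hφ.continuous_fderiv (by simp)).clm_apply continuous_const

/-- Written with inner products against fixed L² vectors, the relation is visibly linear and stable
under L² limits. Linearity gives sums and multiples, stability gives the completeness of the form
domain. -/
theorem hasWeakDeriv_iff (h : IsSlicing e μ) {v : V} {f g : Lp ℂ 2 μ} :
    HasWeakDeriv e v f g ↔ ∀ s (φ : V → ℝ) (hφ : ContDiff ℝ ∞ φ) (hc : HasCompactSupport φ),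
      ⟪(memLp_ofReal_of_hasCompactSupport (continuous_fderiv_apply_of_contDiff hφ v)
          (hc.fderiv_apply ℝ v)).toLp _, h.slice s f⟫_ℂ
        = - ⟪(memLp_ofReal_of_hasCompactSupport hφ.continuous hc).toLp _, h.slice s g⟫_ℂ := by
  refine forall_congr' fun s => forall_congr' fun φ => forall_congr' fun hφ =>
    forall_congr' fun hc => ?_
  rw [h.inner_toLp_slice s f (continuous_fderiv_apply_of_contDiff hφ v) (hc.fderiv_apply ℝ v),
    h.inner_toLp_slice s g hφ.continuous hc]

theorem HasWeakDeriv.add (h : IsSlicing e μ) {v : V} {f g f' g' : Lp ℂ 2 μ} (h1 : HasWeakDeriv e v f g)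
    (h2 : HasWeakDeriv e v f' g') : HasWeakDeriv e v (f + f') (g + g') := by
  rw [hasWeakDeriv_iff h] at *
  intro s φ hφ hc
  rw [map_add, map_add, inner_add_right, inner_add_right, h1 s φ hφ hc, h2 s φ hφ hc, neg_add]

theorem HasWeakDeriv.smul (h : IsSlicing e μ) {v : V} {f g : Lp ℂ 2 μ} (c : ℂ) (h1 : HasWeakDeriv e v f g) :
    HasWeakDeriv e v (c • f) (c • g) := by
  rw [hasWeakDeriv_iff h] at *
  intro s φ hφ hc
  rw [map_smul, map_smul, inner_smul_right, inner_smul_right, h1 s φ hφ hc, mul_neg]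

theorem HasWeakDeriv.zero (h : IsSlicing e μ) (v : V) : HasWeakDeriv e v (0 : Lp ℂ 2 μ) 0 := by
  rw [hasWeakDeriv_iff h]
  intro s φ hφ hc
  simp

theorem HasWeakDeriv.sum (h : IsSlicing e μ) {v : V} {α : Type*} (A : Finset α) {f g : α → Lp ℂ 2 μ}
    (h1 : ∀ a ∈ A, HasWeakDeriv e v (f a) (g a)) :
    HasWeakDeriv e v (∑ a ∈ A, f a) (∑ a ∈ A, g a) := by
  classical
  induction A using Finset.induction_on with
  | empty => simpa using HasWeakDeriv.zero h v
  | insert a A ha ih =>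
    rw [Finset.sum_insert ha, Finset.sum_insert ha]
    exact HasWeakDeriv.add h (h1 a (Finset.mem_insert_self a A))
      (ih fun b hb => h1 b (Finset.mem_insert_of_mem hb))

theorem HasWeakDeriv.unique (h : IsSlicing e μ) {v : V} {f g g' : Lp ℂ 2 μ} (h1 : HasWeakDeriv e v f g)
    (h2 : HasWeakDeriv e v f g') : g = g' := by
  refine Lp.ext (h.ae_iff.2 fun s => ?_)
  exact (h1 s).ae_eq (h2 s) ((h.memLp (Lp.memLp g) s).locallyIntegrable one_le_two)
    ((h.memLp (Lp.memLp g') s).locallyIntegrable one_le_two)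

theorem isClosed_hasWeakDeriv (h : IsSlicing e μ) (v : V) {Y : Type*} [TopologicalSpace Y] {a b : Y → Lp ℂ 2 μ}
    (ha : Continuous a) (hb : Continuous b) : IsClosed {y | HasWeakDeriv e v (a y) (b y)} := by
  simp only [hasWeakDeriv_iff h, Set.ofPred_forall]
  refine isClosed_iInter fun s => isClosed_iInter fun φ => isClosed_iInter fun hφ =>
    isClosed_iInter fun hc => isClosed_eq ?_ ?_
  · exact continuous_const.inner ((h.slice s).continuous.comp ha)
  · exact (continuous_const.inner ((h.slice s).continuous.comp hb)).neg

theorem integral_norm_sq_eq {X : Type*} [MeasurableSpace X] {μ : Measure X} (f : Lp ℂ 2 μ) :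
    ∫ x, ‖f x‖ ^ 2 ∂μ = ‖f‖ ^ 2 := by
  have h1 := inner_self_eq_ofReal f
  rw [L2.inner_def] at h1
  simp only [inner_self_eq_ofReal] at h1
  exact Complex.ofReal_injective (integral_ofReal.symm.trans h1)

/-- Hardy's inequality for `L²` functions on a sliced space. -/
theorem HasWeakDeriv.hardy (h : IsSlicing e μ) {f : Lp ℂ 2 μ} {v : Fin 3 → V} {g : Fin 3 → Lp ℂ 2 μ}
    (hfg : ∀ i, HasWeakDeriv e (v i) f (g i)) (L : V →L[ℝ] Space)
    (hL : ∀ i, L (v i) = EuclideanSpace.single i 1) (a : Space) (w : X → Space)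
    (hw : ∀ s x, w (e s x) = L x - a) {t : ℝ} (ht : 0 < t) :
    ∫⁻ x, ENNReal.ofReal (2 * ‖f x‖ ^ 2 / ‖w x‖) ∂μ
      ≤ ENNReal.ofReal (t * (∑ i, ‖g i‖ ^ 2) + t⁻¹ * ‖f‖ ^ 2) := by
  have hi : ∀ f : Lp ℂ 2 μ, ‖f‖ ^ 2 = ∑ s, ∫ x, ‖f (e s x)‖ ^ 2 := fun f => by
    rw [← integral_norm_sq_eq, h.integral_eq ((Lp.memLp f).integrable_norm_pow two_ne_zero)]
  rw [h.lintegral_eq]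
  simp only [hw]
  refine (Finset.sum_le_sum fun s _ => hardy_inequality (h.memLp (Lp.memLp f) s)
    (fun i => h.memLp (Lp.memLp (g i)) s) (fun i => hfg i s) L hL a ht).trans ?_
  rw [← ENNReal.ofReal_sum_of_nonneg]
  · apply le_of_eq
    congr 1
    simp only [hi]
    rw [Finset.sum_add_distrib, ← Finset.mul_sum, ← Finset.mul_sum, Finset.sum_comm]
  · intro s _
    have h1 : 0 ≤ ∑ i, ∫ x, ‖g i (e s x)‖ ^ 2 :=
      Finset.sum_nonneg fun i _ => integral_nonneg fun x => by positivity
    have h2 : 0 ≤ ∫ x, ‖f (e s x)‖ ^ 2 := integral_nonneg fun x => by positivity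
    positivity

end HasWeakDeriv

/-! ### One-electron Sobolev functions -/

theorem IsWeakPartialOne.partialOne_eq {i : Fin 3} {f g : L2One} (h : IsWeakPartialOne i f g) :
    partialOne i f = g := by
  have hex : ∃ g, IsWeakPartialOne i f g := ⟨g, h⟩
  rw [partialOne, dif_pos hex]
  exact HasWeakDeriv.unique isSlicing_spaceSpin hex.choose_spec h

theorem isWeakPartialOne_partialOne {f : L2One} (hf : f ∈ sobolevOne) (i : Fin 3) :
    IsWeakPartialOne i f (partialOne i f) := by
  obtain ⟨g, hg⟩ := hf i
  rwa [hg.partialOne_eq]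

theorem IsWeakPartialOne.sum {i : Fin 3} {α : Type*} (A : Finset α) {f g : α → L2One} (c : α → ℂ)
    (h : ∀ a ∈ A, IsWeakPartialOne i (f a) (g a)) :
    IsWeakPartialOne i (∑ a ∈ A, c a • f a) (∑ a ∈ A, c a • g a) :=
  HasWeakDeriv.sum isSlicing_spaceSpin A fun a ha =>
    HasWeakDeriv.smul isSlicing_spaceSpin (c a) (h a ha)

theorem smul_mem_sobolevOne {f : L2One} (c : ℂ) (hf : f ∈ sobolevOne) : c • f ∈ sobolevOne :=
  fun i => ⟨_, HasWeakDeriv.smul isSlicing_spaceSpin c (isWeakPartialOne_partialOne hf i)⟩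

theorem partialOne_smul {f : L2One} (c : ℂ) (hf : f ∈ sobolevOne) (i : Fin 3) :
    partialOne i (c • f) = c • partialOne i f :=
  IsWeakPartialOne.partialOne_eq
    (HasWeakDeriv.smul isSlicing_spaceSpin c (isWeakPartialOne_partialOne hf i))

/-- `‖∇f‖²`. -/
noncomputable def gradNormSq (f : L2One) : ℝ := ∑ i, ‖partialOne i f‖ ^ 2

theorem gradNormSq_nonneg (f : L2One) : 0 ≤ gradNormSq f :=
  Finset.sum_nonneg fun _ _ => by positivity

theorem hardy_one {f : L2One} (hf : f ∈ sobolevOne) (a : Space) {t : ℝ} (ht : 0 < t) :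
    ∫⁻ x, ENNReal.ofReal (2 * ‖f x‖ ^ 2 / ‖x.1 - a‖) ∂spaceSpinMeasure
      ≤ ENNReal.ofReal (t * gradNormSq f + t⁻¹ * ‖f‖ ^ 2) :=
  HasWeakDeriv.hardy isSlicing_spaceSpin (v := fun i => EuclideanSpace.single i (1 : ℝ))
    (fun i => isWeakPartialOne_partialOne hf i) (ContinuousLinearMap.id ℝ Space) (fun _ => rfl) a
    (fun x => x.1 - a) (fun _ _ => rfl) ht

/-! ### The form domain of the `N`-electron Hamiltonian -/

section NBody

variable {N : ℕ}

theorem IsWeakPartial.weakPartial_eq {n : Fin N} {i : Fin 3} {f g : L2N N}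
    (h : IsWeakPartial n i f g) : weakPartial n i f = g := by
  have hex : ∃ g, IsWeakPartial n i f g := ⟨g, h⟩
  rw [weakPartial, dif_pos hex]
  exact HasWeakDeriv.unique (isSlicing_config N) hex.choose_spec h

/-- The graph of the weak gradient on the antisymmetric functions. -/
def formGraph (N : ℕ) : Submodule ℂ (PiLp 2 fun _ : Option (Fin N × Fin 3) => L2N N) where
  carrier := {u | u none ∈ antisymmetric N ∧ ∀ n i, IsWeakPartial n i (u none) (u (some (n, i)))}
  add_mem' := fun ha hb => ⟨(antisymmetric N).add_mem ha.1 hb.1, fun n i =>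
    HasWeakDeriv.add (isSlicing_config N) (ha.2 n i) (hb.2 n i)⟩
  zero_mem' := ⟨(antisymmetric N).zero_mem, fun n i => HasWeakDeriv.zero (isSlicing_config N) _⟩
  smul_mem' := fun c _ ha => ⟨(antisymmetric N).smul_mem c ha.1, fun n i =>
    HasWeakDeriv.smul (isSlicing_config N) c (ha.2 n i)⟩

theorem isClosed_antisymmetric (N : ℕ) : IsClosed (antisymmetric N : Set (L2N N)) := by
  change IsClosed {ψ : L2N N | ∀ σ : Equiv.Perm (Fin N), _ = _}
  simp only [Set.ofPred_forall]
  refine isClosed_iInter fun σ => isClosed_eq ?_ (continuous_const_smul _)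
  exact (Lp.isometry_compMeasurePreserving (E := ℂ) (p := 2)
    (measurePreserving_perm N σ)).continuous

instance : CompleteSpace (antisymmetric N) :=
  (isClosed_antisymmetric N).completeSpace_coe

/-- Thus the graph of the gradient is a Hilbert space, and it plays the role of `G` in the results
about forms. -/
theorem isClosed_formGraph (N : ℕ) :
    IsClosed (formGraph N : Set (PiLp 2 fun _ : Option (Fin N × Fin 3) => L2N N)) := by
  refine IsClosed.inter ?_ ?_
  · exact (isClosed_antisymmetric N).preimage (PiLp.continuous_apply 2 _ none)
  · have h : IsClosed {u : PiLp 2 fun _ : Option (Fin N × Fin 3) => L2N N |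
        ∀ n i, IsWeakPartial n i (u none) (u (some (n, i)))} := by
      simp only [Set.ofPred_forall]
      exact isClosed_iInter fun n => isClosed_iInter fun i =>
        isClosed_hasWeakDeriv (isSlicing_config N)
        (Pi.single n (EuclideanSpace.single i (1 : ℝ)))
        (a := fun u : PiLp 2 fun _ : Option (Fin N × Fin 3) => L2N N => u none)
        (b := fun u => u (some (n, i))) (PiLp.continuous_apply 2 _ _)
        (PiLp.continuous_apply 2 _ _)
    exact h

instance : CompleteSpace (formGraph N) :=
  (isClosed_formGraph N).completeSpace_coe

/-- A component of an element of the graph of the weak gradient. -/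
noncomputable def formGraphProj (N : ℕ) (j : Option (Fin N × Fin 3)) : formGraph N →L[ℂ] L2N N :=
  (PiLp.proj 2 (fun _ : Option (Fin N × Fin 3) => L2N N) j).comp (formGraph N).subtypeL

/-- The function underlying an element of the graph of the weak gradient. -/
noncomputable def formGraphFst (N : ℕ) : formGraph N →L[ℂ] antisymmetric N :=
  (formGraphProj N none).codRestrict (antisymmetric N) fun u => u.2.1

theorem coe_formGraphFst (u : formGraph N) : (formGraphFst N u : L2N N) = formGraphProj N none u :=
  rfl

theorem weakPartial_formGraphFst (u : formGraph N) (n : Fin N) (i : Fin 3) :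
    weakPartial n i (formGraphFst N u : L2N N) = formGraphProj N (some (n, i)) u :=
  IsWeakPartial.weakPartial_eq (u.2.2 n i)

theorem formDomain_eq_range (N : ℕ) : formDomain N = Set.range (formGraphFst N) := by
  ext ψ
  constructor
  · intro h
    choose g hg using h
    refine ⟨⟨WithLp.toLp 2 fun j => j.elim (ψ : L2N N) fun p => g p.1 p.2, ψ.2,
      fun n i => hg n i⟩, Subtype.ext rfl⟩
  · rintro ⟨u, rfl⟩ n i
    exact ⟨_, u.2.2 n i⟩

theorem norm_sq_formGraph (u : formGraph N) :
    ‖u‖ ^ 2 = ‖formGraphFst N u‖ ^ 2 + ∑ n, ∑ i, ‖formGraphProj N (some (n, i)) u‖ ^ 2 := by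
  rw [Submodule.coe_norm, PiLp.norm_sq_eq_of_L2, Fintype.sum_option, Fintype.sum_prod_type]
  rfl

/-- A potential that is controlled by the form norm turns into a bounded operator on the form
domain, multiplication by its square root. Potential energies then become inner products ⟪M u, M v⟫.
-/
theorem exists_mul_sqrt_weight {G X : Type*} [NormedAddCommGroup G] [NormedSpace ℂ G]
    [MeasurableSpace X] {μ : Measure X} (p : G →L[ℂ] Lp ℂ 2 μ) {w : X → ℝ} (hw : Measurable w)
    (hw0 : ∀ x, 0 ≤ w x) {C : ℝ}
    (hC : ∀ u, ∫⁻ x, ENNReal.ofReal (w x * ‖p u x‖ ^ 2) ∂μ ≤ ENNReal.ofReal (C * ‖u‖ ^ 2)) :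
    ∃ M : G →L[ℂ] Lp ℂ 2 μ, ∀ u, M u =ᵐ[μ] fun x => (√(w x) : ℂ) * p u x := by
  have hm : ∀ u, MemLp (fun x => (√(w x) : ℂ) * p u x) 2 μ ∧
      ∫⁻ x, ‖(√(w x) : ℂ) * p u x‖ₑ ^ 2 ∂μ ≤ ENNReal.ofReal (C * ‖u‖ ^ 2) := fun u => by
    have hmeas : AEStronglyMeasurable (fun x => (√(w x) : ℂ) * p u x) μ :=
      (Complex.measurable_ofReal.comp hw.sqrt).aestronglyMeasurable.mul
        (Lp.aestronglyMeasurable _)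
    have h1 : ∫⁻ x, ‖(√(w x) : ℂ) * p u x‖ₑ ^ 2 ∂μ ≤ ENNReal.ofReal (C * ‖u‖ ^ 2) := by
      refine le_trans (le_of_eq (lintegral_congr fun x => ?_)) (hC u)
      rw [← ofReal_norm, ← ENNReal.ofReal_pow (norm_nonneg _), norm_mul, Complex.norm_real,
        mul_pow, Real.norm_eq_abs, sq_abs, Real.sq_sqrt (hw0 x)]
    exact ⟨(memLp_two_iff_lintegral hmeas).2 (h1.trans_lt ENNReal.ofReal_lt_top), h1⟩
  let M₀ : G →ₗ[ℂ] Lp ℂ 2 μ :=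
    { toFun := fun u => (hm u).1.toLp _
      map_add' := fun u v => by
        rw [← MemLp.toLp_add]
        refine (MemLp.toLp_eq_toLp_iff _ _).2 ?_
        rw [map_add]
        filter_upwards [Lp.coeFn_add (p u) (p v)] with x hx
        simp only [hx, Pi.add_apply, mul_add]
      map_smul' := fun c u => by
        rw [RingHom.id_apply, ← MemLp.toLp_const_smul]
        refine (MemLp.toLp_eq_toLp_iff _ _).2 ?_
        rw [map_smul]
        filter_upwards [Lp.coeFn_smul c (p u)] with x hx
        simp only [hx, Pi.smul_apply, smul_eq_mul]
        ring }
  refine ⟨M₀.mkContinuous (√C) fun u => ?_, fun u => (hm u).1.coeFn_toLp⟩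
  refine (abs_le_of_sq_le_sq' ?_ (by positivity)).2
  have h2 : ENNReal.ofReal (‖M₀ u‖ ^ 2) ≤ ENNReal.ofReal (C * ‖u‖ ^ 2) := by
    rw [← integral_norm_sq_eq, ofReal_integral_norm_sq (Lp.memLp _)]
    refine le_trans (le_of_eq (lintegral_congr_ae ?_)) (hm u).2
    filter_upwards [(hm u).1.coeFn_toLp] with x hx
    simp only [M₀, LinearMap.coe_mk, AddHom.coe_mk, hx]
  rcases le_or_gt 0 C with h0 | h0
  · rw [ENNReal.ofReal_le_ofReal_iff (by positivity)] at h2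
    rwa [mul_pow, Real.sq_sqrt h0]
  · rw [ENNReal.ofReal_of_nonpos (mul_nonpos_of_nonpos_of_nonneg h0.le (sq_nonneg _)),
      nonpos_iff_eq_zero, ENNReal.ofReal_eq_zero] at h2
    exact h2.trans (sq_nonneg _)

theorem inner_mul_sqrt_weight {X : Type*} [MeasurableSpace X] {μ : Measure X} {w : X → ℝ}
    (hw0 : ∀ x, 0 ≤ w x) {f g Mf Mg : Lp ℂ 2 μ} (hf : Mf =ᵐ[μ] fun x => (√(w x) : ℂ) * f x)
    (hg : Mg =ᵐ[μ] fun x => (√(w x) : ℂ) * g x) :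
    ⟪Mf, Mg⟫_ℂ = ∫ x, (w x : ℂ) * (starRingEnd ℂ (f x) * g x) ∂μ := by
  rw [L2.inner_def]
  refine integral_congr_ae ?_
  filter_upwards [hf, hg] with x h1 h2
  have h3 : (√(w x) : ℂ) * (√(w x) : ℂ) = w x := by
    rw [← Complex.ofReal_mul, Real.mul_self_sqrt (hw0 x)]
  rw [h1, h2, RCLike.inner_apply, map_mul, Complex.conj_ofReal, ← h3]
  ring

theorem norm_sq_mul_sqrt_weight_le {X : Type*} [MeasurableSpace X] {μ : Measure X} {w : X → ℝ}
    (hw0 : ∀ x, 0 ≤ w x) {f Mf : Lp ℂ 2 μ} (hf : Mf =ᵐ[μ] fun x => (√(w x) : ℂ) * f x)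
    {B : ℝ} (hB0 : 0 ≤ B)
    (hB : ∫⁻ x, ENNReal.ofReal (2 * (w x * ‖f x‖ ^ 2)) ∂μ ≤ ENNReal.ofReal B) :
    2 * ‖Mf‖ ^ 2 ≤ B := by
  rw [← ENNReal.ofReal_le_ofReal_iff hB0, ENNReal.ofReal_mul zero_le_two, ← integral_norm_sq_eq,
    ofReal_integral_norm_sq (Lp.memLp _), ← lintegral_const_mul' _ _ ENNReal.ofReal_ne_top]
  refine le_trans (le_of_eq (lintegral_congr_ae ?_)) hB
  filter_upwards [hf] with x hx
  rw [hx, ← ofReal_norm, ← ENNReal.ofReal_pow (norm_nonneg _), ← ENNReal.ofReal_mul zero_le_two,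
    norm_mul, Complex.norm_real, mul_pow, Real.norm_eq_abs, sq_abs, Real.sq_sqrt (hw0 x)]

/-- Multiplication by the square root of the Coulomb potential of a difference of positions. -/
theorem exists_coulomb_sqrt (n : Fin N) (L : (Fin N → Space) →L[ℝ] Space)
    (hL : ∀ i, L (Pi.single n (EuclideanSpace.single i 1)) = EuclideanSpace.single i 1) :
    ∃ M : formGraph N →L[ℂ] L2N N,
      (∀ u v, ⟪M u, M v⟫_ℂ = ∫ x, ((‖L fun m => (x m).1‖⁻¹ : ℝ) : ℂ)
        * (starRingEnd ℂ (formGraphProj N none u x) * formGraphProj N none v x) ∂configMeasure N) ∧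
      ∀ u t, 0 < t → 2 * ‖M u‖ ^ 2 ≤
        t * (∑ i, ‖formGraphProj N (some (n, i)) u‖ ^ 2) + t⁻¹ * ‖formGraphFst N u‖ ^ 2 := by
  set w : (Fin N → SpaceSpin) → ℝ := fun x => ‖L fun m => (x m).1‖⁻¹ with hw
  have hw0 : ∀ x, 0 ≤ w x := fun x => by positivity
  have hwm : Measurable w := by
    have : Measurable fun x : Fin N → SpaceSpin => fun m => (x m).1 := by fun_prop
    exact (L.continuous.measurable.comp this).norm.inv
  have hH : ∀ (u : formGraph N) (t : ℝ), 0 < t →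
      ∫⁻ x, ENNReal.ofReal (2 * (w x * ‖formGraphProj N none u x‖ ^ 2)) ∂configMeasure N
        ≤ ENNReal.ofReal (t * (∑ i, ‖formGraphProj N (some (n, i)) u‖ ^ 2)
          + t⁻¹ * ‖formGraphFst N u‖ ^ 2) := fun u t ht => by
    refine le_trans (le_of_eq (lintegral_congr fun x => ?_))
      (HasWeakDeriv.hardy (isSlicing_config N) (f := formGraphProj N none u)
        (v := fun i => Pi.single n (EuclideanSpace.single i (1 : ℝ)))
        (g := fun i => formGraphProj N (some (n, i)) u)
        (fun i => u.2.2 n i) L hL 0 (fun x => L fun m => (x m).1) (fun s x => by simp) ht)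
    congr 1
    simp only [hw]; ring
  have hsum : ∀ u : formGraph N, ∑ i, ‖formGraphProj N (some (n, i)) u‖ ^ 2 ≤
      ∑ n, ∑ i, ‖formGraphProj N (some (n, i)) u‖ ^ 2 := fun u =>
    Finset.single_le_sum (f := fun n => ∑ i, ‖formGraphProj N (some (n, i)) u‖ ^ 2)
      (fun _ _ => Finset.sum_nonneg fun _ _ => by positivity) (Finset.mem_univ n)
  obtain ⟨M, hM⟩ := exists_mul_sqrt_weight (formGraphProj N none) hwm hw0 (C := 1) fun u => by
    refine le_trans (lintegral_mono fun x => ENNReal.ofReal_le_ofReal ?_)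
      ((hH u 1 one_pos).trans (ENNReal.ofReal_le_ofReal ?_))
    · have : 0 ≤ w x * ‖formGraphProj N none u x‖ ^ 2 := mul_nonneg (hw0 x) (by positivity)
      linarith
    · rw [norm_sq_formGraph]
      linarith [hsum u]
  refine ⟨M, fun u v => inner_mul_sqrt_weight hw0 (hM u) (hM v), fun u t ht =>
    norm_sq_mul_sqrt_weight_le hw0 (hM u) ?_ (hH u t ht)⟩
  have : 0 ≤ ∑ i, ‖formGraphProj N (some (n, i)) u‖ ^ 2 :=
    Finset.sum_nonneg fun _ _ => by positivity
  positivity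

open ContinuousLinearMap in
theorem exists_operator_of_form {G H : Type*} [NormedAddCommGroup G] [InnerProductSpace ℂ G]
    [CompleteSpace G] [NormedAddCommGroup H] [InnerProductSpace ℂ H] [CompleteSpace H] (Z : ℝ)
    (D : Fin N → Fin 3 → G →L[ℂ] H) (A : Fin N → G →L[ℂ] H) (P : Fin N → Fin N → G →L[ℂ] H) :
    ∃ T : G →L[ℂ] G, (∀ x y, ⟪x, T y⟫_ℂ = ∑ n, ((1 / 2) * (∑ i, ⟪D n i x, D n i y⟫_ℂ)
      - Z * ⟪A n x, A n y⟫_ℂ) + ∑ n, ∑ m ∈ Finset.univ.filter (· < n), ⟪P n m x, P n m y⟫_ℂ) ∧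
      ∀ x y, ⟪T x, y⟫_ℂ = ⟪x, T y⟫_ℂ := by
  let T : G →L[ℂ] G :=
    ∑ n, ((1 / 2 : ℂ) • (∑ i, adjoint (D n i) ∘L D n i) - (Z : ℂ) • (adjoint (A n) ∘L A n))
      + ∑ n, ∑ m ∈ Finset.univ.filter (· < n), adjoint (P n m) ∘L P n m
  have hT : ∀ x y, ⟪x, T y⟫_ℂ = ∑ n, ((1 / 2) * (∑ i, ⟪D n i x, D n i y⟫_ℂ)
      - Z * ⟪A n x, A n y⟫_ℂ) + ∑ n, ∑ m ∈ Finset.univ.filter (· < n), ⟪P n m x, P n m y⟫_ℂ := by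
    intro x y
    simp only [T, add_apply, sum_apply, inner_add_right, inner_sum, sub_apply, smul_apply,
      inner_sub_right, inner_smul_right, comp_apply, adjoint_inner_right]
  refine ⟨T, hT, fun x y => ?_⟩
  rw [hT, (inner_conj_symm (T x) y).symm, hT]
  simp only [map_add, map_sum, map_sub, map_mul, inner_conj_symm, Complex.conj_ofReal, map_div₀,
    map_one, map_ofNat]

/-- Variational principle for the ground-state energy. -/
theorem groundStateEnergy_mul_le {Z : ℝ} (hZ : 0 ≤ Z) (N : ℕ) {ψ : antisymmetric N}
    (hψ : ψ ∈ formDomain N) :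
    groundStateEnergy Z N * ‖ψ‖ ^ 2 ≤ (energyForm (fun x => -Z / ‖x‖) N ψ ψ).re := by
  have h1 : ∀ n : Fin N, ∀ i, (ContinuousLinearMap.proj (R := ℝ) (φ := fun _ : Fin N => Space) n)
      (Pi.single n (EuclideanSpace.single i 1)) = EuclideanSpace.single i 1 := fun n i => by simp
  choose A hA hA' using fun n : Fin N => exists_coulomb_sqrt n _ (h1 n)
  have h2 : ∀ n m : Fin N, ∃ M : formGraph N →L[ℂ] L2N N, m < n →
      ∀ u v, ⟪M u, M v⟫_ℂ = ∫ x, ((‖(x m).1 - (x n).1‖⁻¹ : ℝ) : ℂ)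
        * (starRingEnd ℂ (formGraphProj N none u x) * formGraphProj N none v x)
          ∂configMeasure N := fun n m => by
    -- The difference of positions m and n has derivative +1 in the variables of electron m, so
    -- Hardy's inequality is used in these variables with the other electron fixed. Pairs with m ≥ n
    -- do not occur in the energy form.
    by_cases hmn : m < n
    · obtain ⟨M, hM, -⟩ := exists_coulomb_sqrt m
        (ContinuousLinearMap.proj (R := ℝ) (φ := fun _ : Fin N => Space) m
          - ContinuousLinearMap.proj (R := ℝ) (φ := fun _ : Fin N => Space) n) fun i => by
          simp [hmn.ne']
      exact ⟨M, fun _ u v => by simpa using hM u v⟩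
    · exact ⟨0, fun h => absurd h hmn⟩
  choose P hP using h2
  let D : Fin N → Fin 3 → formGraph N →L[ℂ] L2N N := fun n i => formGraphProj N (some (n, i))
  obtain ⟨T, hT, hTs⟩ := exists_operator_of_form Z D A P
  have hq : ∀ x y, energyForm (fun x => -Z / ‖x‖) N (formGraphFst N x) (formGraphFst N y)
      = ⟪x, T y⟫_ℂ := by
    intro x y
    rw [hT, energyForm]
    congr 1
    · refine Finset.sum_congr rfl fun n _ => ?_
      rw [sub_eq_add_neg]
      congr 1
      · simp only [weakPartial_formGraphFst, D]
      · rw [hA, ← neg_mul, ← integral_const_mul]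
        refine integral_congr_ae (ae_of_all _ fun z => ?_)
        simp [coe_formGraphFst, div_eq_mul_inv, mul_assoc]
    · refine Finset.sum_congr rfl fun n _ => Finset.sum_congr rfl fun m hm => ?_
      rw [hP n m (by simpa using hm)]
      refine integral_congr_ae (ae_of_all _ fun z => ?_)
      simp only [coe_formGraphFst, div_eq_mul_inv, Complex.ofReal_inv]
      ring
  have hre : ∀ x, (⟪x, T x⟫_ℂ).re = ∑ n, ((1 / 2) * (∑ i, ‖D n i x‖ ^ 2)
      - Z * ‖A n x‖ ^ 2) + ∑ n, ∑ m ∈ Finset.univ.filter (· < n), ‖P n m x‖ ^ 2 := by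
    intro x
    rw [hT]
    simp only [inner_self_eq_ofReal]
    rw [← Complex.ofReal_re (∑ n, _ + ∑ n, _)]
    push_cast
    rfl
  -- The repulsion is nonnegative and dropped. With t = 1 / (2 (Z + 1)) Hardy's inequality bounds
  -- the attraction of each electron by a quarter of ‖∇ₙψ‖² plus Z (Z + 1) ‖ψ‖², so half of the
  -- kinetic energy survives. The additional 1/4 supplies the L² part of the form norm.
  have hcoer : ∀ x, (1 / 4) * ‖x‖ ^ 2 ≤ (⟪x, T x⟫_ℂ).re
      + (N * (Z * (Z + 1)) + 1 / 4) * ‖formGraphFst N x‖ ^ 2 := by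
    intro x
    rw [hre, norm_sq_formGraph]
    have h3 : 0 ≤ ∑ n, ∑ m ∈ Finset.univ.filter (· < n), ‖P n m x‖ ^ 2 :=
      Finset.sum_nonneg fun _ _ => Finset.sum_nonneg fun _ _ => by positivity
    have h4 : ∀ n, (1 / 4) * (∑ i, ‖D n i x‖ ^ 2) - Z * (Z + 1) * ‖formGraphFst N x‖ ^ 2
        ≤ (1 / 2) * (∑ i, ‖D n i x‖ ^ 2) - Z * ‖A n x‖ ^ 2 := by
      intro n
      have h5 := hA' n x (1 / (2 * (Z + 1))) (by positivity)
      have h6 : 0 ≤ ∑ i, ‖D n i x‖ ^ 2 := Finset.sum_nonneg fun _ _ => by positivity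
      change 2 * ‖A n x‖ ^ 2 ≤ 1 / (2 * (Z + 1)) * (∑ i, ‖D n i x‖ ^ 2) + _ at h5
      have h7 : Z * (2 * ‖A n x‖ ^ 2) ≤ Z * (1 / (2 * (Z + 1)) * (∑ i, ‖D n i x‖ ^ 2)
          + (1 / (2 * (Z + 1)))⁻¹ * ‖formGraphFst N x‖ ^ 2) := by gcongr
      have h8 : Z * (1 / (2 * (Z + 1))) ≤ 1 / 2 := by
        rw [mul_one_div, div_le_div_iff₀ (by positivity) (by positivity)]; linarith
      have h9 : Z * (1 / (2 * (Z + 1))) * (∑ i, ‖D n i x‖ ^ 2) ≤ 1 / 2 * (∑ i, ‖D n i x‖ ^ 2) := by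
        gcongr
      have h10 : (1 / (2 * (Z + 1)))⁻¹ = 2 * (Z + 1) := by rw [one_div, inv_inv]
      rw [h10] at h7
      nlinarith
    have h11 := Finset.sum_le_sum fun n (_ : n ∈ Finset.univ) => h4 n
    rw [Finset.sum_sub_distrib, ← Finset.mul_sum, Finset.sum_const, Finset.card_univ,
      Fintype.card_fin, nsmul_eq_mul] at h11
    change _ * (_ + ∑ n, ∑ i, ‖D n i x‖ ^ 2) ≤ _
    linarith
  rw [formDomain_eq_range] at hψ
  obtain ⟨u, rfl⟩ := hψ
  rw [hq]
  exact sInf_graphSpectrum_mul_le (formGraphFst N) T hTs (by norm_num) hcoer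
    (formDomain_eq_range N) hq u

end NBody

/-! ### Splitting off coordinates -/

section Split

variable {ι : Type*} [Fintype ι] [DecidableEq ι] {X : Type*} [MeasurableSpace X]

/-- Split off the coordinate `n`. -/
noncomputable def splitOne (X : Type*) [MeasurableSpace X] (n : ι) :
    (ι → X) ≃ᵐ X × ({l : ι // ¬ l = n} → X) :=
  (MeasurableEquiv.piEquivPiSubtypeProd (fun _ => X) (fun l => l = n)).trans
    (MeasurableEquiv.prodCongr (MeasurableEquiv.funUnique _ X) (MeasurableEquiv.refl _))

theorem splitOne_apply (n : ι) (x : ι → X) : splitOne X n x = (x n, fun l : {l : ι // ¬ l = n} => x l.1) := rfl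

theorem measurePreserving_splitOne (μ : Measure X) [SigmaFinite μ] (n : ι) :
    MeasurePreserving (splitOne X n) (Measure.pi fun _ : ι => μ)
      (μ.prod (Measure.pi fun _ => μ)) := by
  have h : ∀ inst : Fintype {l : ι // l = n},
      MeasurePreserving (MeasurableEquiv.funUnique {l : ι // l = n} X)
        (@Measure.pi _ _ inst _ fun _ => μ) μ := by
    intro inst
    convert! measurePreserving_funUnique μ {l : ι // l = n}
  exact (measurePreserving_piEquivPiSubtypeProd (fun _ : ι => μ) (fun l => l = n)).trans
    ((h _).prod (MeasurePreserving.id _))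

theorem splitOne_symm_eq_update (n : ι) (y : X) (r : {l : ι // ¬ l = n} → X) (y₀ : X) :
    (splitOne X n).symm (y, r) = Function.update ((splitOne X n).symm (y₀, r)) n y := by
  rw [MeasurableEquiv.symm_apply_eq, splitOne_apply]
  ext l
  · simp
  · have h : splitOne X n ((splitOne X n).symm (y₀, r)) = (y₀, r) :=
      MeasurableEquiv.apply_symm_apply _ _
    rw [splitOne_apply] at h
    have h2 := congrFun (Prod.ext_iff.1 h).2 l
    simp only [Function.update_of_ne l.2]
    exact h2.symm

/-- The two coordinates `m` and `n` as an indexing of a subtype. -/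
noncomputable def pairEquiv {m n : ι} (hmn : m ≠ n) : Fin 2 ≃ {l : ι // l = m ∨ l = n} :=
  Equiv.ofBijective ![⟨m, Or.inl rfl⟩, ⟨n, Or.inr rfl⟩] (by
    constructor
    · intro a b hab
      fin_cases a <;> fin_cases b <;> simp_all [Subtype.ext_iff, eq_comm]
    · rintro ⟨l, rfl | rfl⟩
      · exact ⟨0, rfl⟩
      · exact ⟨1, rfl⟩)

/-- Split off the coordinates `m` and `n`. -/
noncomputable def splitTwo (X : Type*) [MeasurableSpace X] {m n : ι} (hmn : m ≠ n) :
    (ι → X) ≃ᵐ (X × X) × ({l : ι // ¬ (l = m ∨ l = n)} → X) :=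
  (MeasurableEquiv.piEquivPiSubtypeProd (fun _ => X) (fun l => l = m ∨ l = n)).trans
    (MeasurableEquiv.prodCongr
      ((MeasurableEquiv.piCongrLeft (fun _ => X) (pairEquiv hmn)).symm.trans
        MeasurableEquiv.finTwoArrow) (MeasurableEquiv.refl _))

theorem splitTwo_apply {m n : ι} (hmn : m ≠ n) (x : ι → X) :
    splitTwo X hmn x = ((x m, x n), fun l : {l : ι // ¬ (l = m ∨ l = n)} => x l.1) := rfl

theorem measurePreserving_splitTwo (μ : Measure X) [SigmaFinite μ] {m n : ι} (hmn : m ≠ n) :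
    MeasurePreserving (splitTwo X hmn) (Measure.pi fun _ : ι => μ)
      ((μ.prod μ).prod (Measure.pi fun _ => μ)) :=
  (measurePreserving_piEquivPiSubtypeProd (fun _ : ι => μ) (fun l => l = m ∨ l = n)).trans
    ((((measurePreserving_piCongrLeft (fun _ => μ) (pairEquiv hmn)).symm).trans
      (measurePreserving_finTwoArrow μ)).prod (MeasurePreserving.id _))

theorem prod_subtype_pair {M : Type*} [CommMonoid M] (p : ι → Prop) [DecidablePred p]
    (g : ι → M) : ∏ l ∈ Finset.univ.filter fun l => ¬ p l, g l = ∏ l : {l : ι // ¬ p l}, g l := by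
  rw [← Finset.prod_subtype]
  simp

theorem integral_pair_mul_prod (μ : Measure X) [SigmaFinite μ] {m n : ι} (hmn : m ≠ n)
    (F : X × X → ℂ) (g : ι → X → ℂ) :
    ∫ x, F (x m, x n) * ∏ l ∈ Finset.univ.filter fun l => ¬ (l = m ∨ l = n), g l (x l)
        ∂Measure.pi (fun _ => μ)
      = (∫ p, F p ∂μ.prod μ)
        * ∏ l ∈ Finset.univ.filter fun l => ¬ (l = m ∨ l = n), ∫ y, g l y ∂μ := by
  have h := (measurePreserving_splitTwo μ hmn).integral_comp'
    (fun q : (X × X) × ({l : ι // ¬ (l = m ∨ l = n)} → X) => F q.1 * ∏ l : {l : ι // ¬ (l = m ∨ l = n)}, g l.1 (q.2 l))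
  rw [integral_prod_mul F (fun r : {l : ι // ¬ (l = m ∨ l = n)} → X => ∏ l : {l : ι // ¬ (l = m ∨ l = n)}, g l.1 (r l)),
    integral_fintype_prod_eq_prod (fun (l : {l : ι // ¬ (l = m ∨ l = n)}) => g l.1)] at h
  simp only [splitTwo_apply] at h
  simp only [prod_subtype_pair (fun l => l = m ∨ l = n)]
  exact h

theorem integrable_pair_mul_prod (μ : Measure X) [SigmaFinite μ] {m n : ι} (hmn : m ≠ n)
    {F : X × X → ℂ} (hF : Integrable F (μ.prod μ)) {g : ι → X → ℂ} (hg : ∀ l, Integrable (g l) μ) :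
    Integrable (fun x => F (x m, x n)
      * ∏ l ∈ Finset.univ.filter fun l => ¬ (l = m ∨ l = n), g l (x l))
        (Measure.pi (fun _ => μ)) := by
  have h1 : Integrable (fun r : {l : ι // ¬ (l = m ∨ l = n)} → X => ∏ l, g l.1 (r l))
      (Measure.pi fun _ => μ) :=
    Integrable.fintype_prod (f := fun (l : {l : ι // ¬ (l = m ∨ l = n)}) => g l.1)
      (μ := fun _ => μ) fun l => hg l.1
  have h := hF.mul_prod h1
  have h2 := (measurePreserving_splitTwo μ hmn).integrable_comp_of_integrable h
  simp only [prod_subtype_pair (fun l => l = m ∨ l = n)]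
  exact h2

end Split

/-! ### Weak derivatives of products -/

section ProductDeriv

open ContinuousLinearMap

variable {ι : Type*} [Fintype ι] [DecidableEq ι] {E : Type*} [NormedAddCommGroup E]
  [NormedSpace ℝ E] [FiniteDimensional ℝ E] [MeasureSpace E] [BorelSpace E]
  [(volume : Measure E).IsAddHaarMeasure]

/-- By Fubini, with the other variables frozen, a test function on the product restricts to a test
function of the `n`-th variable alone, and the factor `c` is a constant. No regularity of `c` enters
beyond local integrability of the products. -/
theorem isWeakDeriv_mul_of_split (n : ι) {v : E} {a b : E → ℂ}
    {c : ({l : ι // ¬ l = n} → E) → ℂ} (hab : IsWeakDeriv v a b)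
    (ha : LocallyIntegrable fun x : ι → E => a (x n) * c fun l : {l : ι // ¬ l = n} => x l.1)
    (hb : LocallyIntegrable fun x : ι → E => b (x n) * c fun l : {l : ι // ¬ l = n} => x l.1) :
    IsWeakDeriv (Pi.single n v) (fun x : ι → E => a (x n) * c fun l : {l : ι // ¬ l = n} => x l.1)
      (fun x : ι → E => b (x n) * c fun l : {l : ι // ¬ l = n} => x l.1) := by
  intro φ hφ hc
  have hmp := (measurePreserving_splitOne (volume : Measure E) n).symm
  have key : ∀ (ψ : (ι → E) → ℝ) (d : E → ℂ), Continuous ψ → HasCompactSupport ψ →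
      (LocallyIntegrable fun x : ι → E => d (x n) * c fun l : {l : ι // ¬ l = n} => x l.1) →
      ∫ x : ι → E, ψ x • (d (x n) * c fun l : {l : ι // ¬ l = n} => x l.1) = ∫ r : {l : ι // ¬ l = n} → E,
        (∫ y : E, ψ ((splitOne E n).symm (y, r)) • d y) * c r := by
    intro ψ d hψ hψc hd
    have h1 : ∀ q : E × ({l : ι // ¬ l = n} → E),
        (d ((splitOne E n).symm q n) * c fun l : {l : ι // ¬ l = n} => (splitOne E n).symm q l.1) = d q.1 * c q.2 := by
      intro q
      have h : splitOne E n ((splitOne E n).symm q) = q := MeasurableEquiv.apply_symm_apply _ _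
      rw [splitOne_apply] at h
      have h2 := (Prod.ext_iff.1 h)
      rw [← h2.1, ← h2.2]
    have hint : Integrable (fun x : ι → E => ψ x • (d (x n) * c fun l : {l : ι // ¬ l = n} => x l.1)) :=
      hd.integrable_smul_left_of_hasCompactSupport hψ hψc
    rw [volume_pi] at hint ⊢
    rw [← hmp.integral_comp']
    have h2 := (hmp.integrable_comp_emb (MeasurableEquiv.measurableEmbedding _)).2 hint
    simp only [Function.comp_def, h1] at h2 ⊢
    rw [integral_prod_symm _ h2]
    refine integral_congr_ae (Filter.Eventually.of_forall fun r => ?_)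
    simp only [← smul_mul_assoc]
    exact integral_mul_const _ _
  have hφ' : Continuous fun x => fderiv ℝ φ x (Pi.single n v) :=
    continuous_fderiv_apply_of_contDiff hφ _
  rw [key _ a hφ' (hc.fderiv_apply ℝ _) ha, key _ b hφ.continuous hc hb, ← integral_neg]
  refine integral_congr_ae (Filter.Eventually.of_forall fun r => ?_)
  simp only
  rw [← neg_mul]
  congr 1
  set x₀ := (splitOne E n).symm (0, r) with hx₀
  have hup : ∀ y, (splitOne E n).symm (y, r) = Function.update x₀ n y := fun y =>
    splitOne_symm_eq_update n y r 0
  simp only [hup]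
  have hψ : ContDiff ℝ ∞ fun y => φ (Function.update x₀ n y) := hφ.comp (contDiff_update _ _ _)
  have hψc : HasCompactSupport fun y => φ (Function.update x₀ n y) := by
    refine HasCompactSupport.intro (hc.isCompact.image (continuous_apply n)) fun y hy => ?_
    refine image_eq_zero_of_notMem_tsupport fun h => hy ⟨_, h, ?_⟩
    simp
  rw [← hab _ hψ hψc]
  refine integral_congr_ae (Filter.Eventually.of_forall fun y => ?_)
  have hd : HasFDerivAt (fun y => φ (Function.update x₀ n y)) _ y :=
    ((hφ.differentiable (by simp)) (Function.update x₀ n y)).hasFDerivAt.comp y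
      (hasFDerivAt_update x₀ y)
  have hs : (ContinuousLinearMap.pi (Pi.single n (ContinuousLinearMap.id ℝ E)) : E →L[ℝ] ι → E) v
      = Pi.single n v := by
    ext l
    rw [ContinuousLinearMap.pi_apply]
    rcases eq_or_ne l n with rfl | hl
    · simp
    · simp [hl]
  simp only
  rw [hd.fderiv, ContinuousLinearMap.comp_apply, hs]

end ProductDeriv

/-! ### Tensor products of orbitals -/

section Tensor

variable {N : ℕ}

theorem memLp_tensor (f : Fin N → L2One) :
    MemLp (fun x : Fin N → SpaceSpin => ∏ m, f m (x m)) 2 (configMeasure N) := by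
  have hmeas : AEStronglyMeasurable (fun x : Fin N → SpaceSpin => ∏ m, f m (x m))
      (configMeasure N) := by
    refine Finset.aestronglyMeasurable_fun_prod _ fun m _ => ?_
    exact (Lp.aestronglyMeasurable (f m)).comp_quasiMeasurePreserving
      (Measure.quasiMeasurePreserving_eval _ m)
  rw [memLp_two_iff_integrable_sq_norm hmeas]
  simp only [norm_prod, ← Finset.prod_pow]
  exact Integrable.fintype_prod_dep (f := fun m y => ‖f m y‖ ^ 2) fun m =>
    (Lp.memLp (f m)).integrable_norm_pow two_ne_zero

/-- The tensor product `f₁ ⊗ ⋯ ⊗ f_N`. -/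
noncomputable def tensor (f : Fin N → L2One) : L2N N := (memLp_tensor f).toLp _

theorem coeFn_tensor (f : Fin N → L2One) :
    tensor f =ᵐ[configMeasure N] fun x => ∏ m, f m (x m) := (memLp_tensor f).coeFn_toLp

theorem inner_tensor (f g : Fin N → L2One) : ⟪tensor f, tensor g⟫_ℂ = ∏ m, ⟪f m, g m⟫_ℂ := by
  rw [L2.inner_def]
  simp only [L2.inner_def]
  rw [← integral_fintype_prod_eq_prod (fun m y => ⟪f m y, g m y⟫_ℂ)]
  refine integral_congr_ae ?_
  filter_upwards [coeFn_tensor f, coeFn_tensor g] with x hf hg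
  rw [hf, hg]
  simp only [RCLike.inner_apply, map_prod, Finset.prod_mul_distrib]

theorem IsWeakDeriv.congr {V : Type*} [NormedAddCommGroup V] [NormedSpace ℝ V] [MeasureSpace V]
    {v : V} {f g f' g' : V → ℂ} (h : IsWeakDeriv v f g) (hf : f =ᵐ[volume] f')
    (hg : g =ᵐ[volume] g') : IsWeakDeriv v f' g' := by
  intro φ hφ hc
  have h1 : ∫ x, fderiv ℝ φ x v • f x = ∫ x, fderiv ℝ φ x v • f' x :=
    integral_congr_ae (hf.mono fun x hx => by simp only [hx])
  have h2 : ∫ x, φ x • g x = ∫ x, φ x • g' x :=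
    integral_congr_ae (hg.mono fun x hx => by simp only [hx])
  rw [← h1, ← h2, h φ hφ hc]

theorem isWeakPartial_tensor (f : Fin N → L2One) (n : Fin N) {i : Fin 3} {g : L2One}
    (h : IsWeakPartialOne i (f n) g) :
    IsWeakPartial n i (tensor f) (tensor (Function.update f n g)) := by
  intro s
  have hsl := isSlicing_config N
  have hfac : ∀ k : L2One, ∀ x : Fin N → Space,
      ∏ m, (Function.update f n k) m (x m, s m) = k (x n, s n)
        * ∏ l : {l : Fin N // ¬ l = n}, f l.1 (x l.1, s l.1) := by
    intro k x
    rw [← Finset.mul_prod_erase _ _ (Finset.mem_univ n), Function.update_self]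
    congr 1
    rw [← prod_subtype_pair (fun l => l = n) (fun l => f l (x l, s l))]
    refine Finset.prod_congr (by ext; simp) fun l hl => ?_
    rw [Function.update_of_ne (by simpa using hl)]
  have hae : ∀ k : L2One, (fun x : Fin N → Space => tensor (Function.update f n k)
      fun m => (x m, s m)) =ᵐ[volume] fun x => k (x n, s n)
        * ∏ l : {l : Fin N // ¬ l = n}, f l.1 (x l.1, s l.1) := by
    intro k
    filter_upwards [hsl.ae_eq_comp (coeFn_tensor (Function.update f n k)) s] with x hx
    rw [hx, hfac]
  have hli : ∀ k : L2One, LocallyIntegrable fun x : Fin N → Space => k (x n, s n)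
        * ∏ l : {l : Fin N // ¬ l = n}, f l.1 (x l.1, s l.1) := by
    intro k
    have h1 : MemLp (fun x : Fin N → Space => tensor (Function.update f n k)
      fun m => (x m, s m)) 2 := hsl.memLp (Lp.memLp (tensor (Function.update f n k))) s
    exact ((memLp_congr_ae (hae k)).1 h1).locallyIntegrable one_le_two
  have hmain := isWeakDeriv_mul_of_split n
    (c := fun r : {l : Fin N // ¬ l = n} → Space => ∏ l : {l : Fin N // ¬ l = n}, f l.1 (r l, s l.1)) (h (s n)) (hli _) (hli _)
  have h3 := hae (f n)
  rw [Function.update_eq_self] at h3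
  exact hmain.congr h3.symm (hae g).symm

end Tensor

/-! ### Coulomb integrals of pairs of orbitals -/

section Pair

theorem aestronglyMeasurable_comp_fst (u : L2One) :
    AEStronglyMeasurable (fun p : SpaceSpin × SpaceSpin => u p.1)
      (spaceSpinMeasure.prod spaceSpinMeasure) :=
  (Lp.aestronglyMeasurable u).comp_fst

theorem aestronglyMeasurable_comp_snd (u : L2One) :
    AEStronglyMeasurable (fun p : SpaceSpin × SpaceSpin => u p.2)
      (spaceSpinMeasure.prod spaceSpinMeasure) :=
  (Lp.aestronglyMeasurable u).comp_snd

theorem measurable_dist_pair :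
    Measurable fun p : SpaceSpin × SpaceSpin => ‖p.1.1 - p.2.1‖ := by fun_prop

/-- Hardy's inequality in the second variable, centred at the position of the first particle, has a
bound independent of that centre. Hence only `v` needs a gradient. -/
theorem lintegral_pair_le (u : L2One) {v : L2One} (hv : v ∈ sobolevOne) {t : ℝ} (ht : 0 < t) :
    ∫⁻ p : SpaceSpin × SpaceSpin, ENNReal.ofReal (‖u p.1‖ ^ 2 * ‖v p.2‖ ^ 2 / ‖p.1.1 - p.2.1‖)
        ∂spaceSpinMeasure.prod spaceSpinMeasure
      ≤ ENNReal.ofReal ((t * gradNormSq v + t⁻¹ * ‖v‖ ^ 2) / 2 * ‖u‖ ^ 2) := by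
  have hb : 0 ≤ (t * gradNormSq v + t⁻¹ * ‖v‖ ^ 2) / 2 := by
    have := gradNormSq_nonneg v; positivity
  have hm : AEMeasurable (fun p : SpaceSpin × SpaceSpin =>
      ENNReal.ofReal (‖u p.1‖ ^ 2 * ‖v p.2‖ ^ 2 / ‖p.1.1 - p.2.1‖))
      (spaceSpinMeasure.prod spaceSpinMeasure) :=
    (((((aestronglyMeasurable_comp_fst u).norm.aemeasurable.pow_const 2).mul
      ((aestronglyMeasurable_comp_snd v).norm.aemeasurable.pow_const 2))).div
        measurable_dist_pair.aemeasurable).ennreal_ofReal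
  rw [lintegral_prod _ hm]
  calc _ ≤ ∫⁻ x, ENNReal.ofReal ((t * gradNormSq v + t⁻¹ * ‖v‖ ^ 2) / 2) * ‖u x‖ₑ ^ 2
          ∂spaceSpinMeasure := by
        refine lintegral_mono fun x => ?_
        have h1 : ∀ y : SpaceSpin, ENNReal.ofReal (‖u x‖ ^ 2 * ‖v y‖ ^ 2 / ‖x.1 - y.1‖)
            = ENNReal.ofReal (‖u x‖ ^ 2 / 2) * ENNReal.ofReal (2 * ‖v y‖ ^ 2 / ‖y.1 - x.1‖) := by
          intro y
          rw [← ENNReal.ofReal_mul (by positivity), norm_sub_rev]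
          congr 1; ring
        simp only [h1]
        rw [lintegral_const_mul' _ _ ENNReal.ofReal_ne_top]
        refine (mul_le_mul_right (hardy_one hv x.1 ht) _).trans (le_of_eq ?_)
        rw [← ENNReal.ofReal_mul (by positivity), ← ofReal_norm, ← ENNReal.ofReal_pow (norm_nonneg _),
          ← ENNReal.ofReal_mul hb]
        congr 1; ring
    _ = _ := by
        rw [lintegral_const_mul' _ _ ENNReal.ofReal_ne_top,
          ← ofReal_integral_norm_sq (Lp.memLp u), integral_norm_sq_eq, ← ENNReal.ofReal_mul hb]

theorem integrable_pair (u : L2One) {v : L2One} (hv : v ∈ sobolevOne) :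
    Integrable (fun p : SpaceSpin × SpaceSpin => ‖u p.1‖ ^ 2 * ‖v p.2‖ ^ 2 / ‖p.1.1 - p.2.1‖)
      (spaceSpinMeasure.prod spaceSpinMeasure) := by
  refine ⟨((((aestronglyMeasurable_comp_fst u).norm.pow 2).mul
      ((aestronglyMeasurable_comp_snd v).norm.pow 2)).aemeasurable.div
        measurable_dist_pair.aemeasurable).aestronglyMeasurable, ?_⟩
  rw [hasFiniteIntegral_iff_ofReal (ae_of_all _ fun p => by positivity)]
  exact (lintegral_pair_le u hv one_pos).trans_lt ENNReal.ofReal_lt_top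

theorem integral_pair_le (u : L2One) {v : L2One} (hv : v ∈ sobolevOne) {t : ℝ} (ht : 0 < t) :
    ∫ p : SpaceSpin × SpaceSpin, ‖u p.1‖ ^ 2 * ‖v p.2‖ ^ 2 / ‖p.1.1 - p.2.1‖
        ∂spaceSpinMeasure.prod spaceSpinMeasure
      ≤ (t * gradNormSq v + t⁻¹ * ‖v‖ ^ 2) / 2 * ‖u‖ ^ 2 := by
  have hb : 0 ≤ (t * gradNormSq v + t⁻¹ * ‖v‖ ^ 2) / 2 * ‖u‖ ^ 2 := by
    have := gradNormSq_nonneg v; positivity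
  rw [← ENNReal.ofReal_le_ofReal_iff hb, ofReal_integral_eq_lintegral_ofReal
    (integrable_pair u hv) (ae_of_all _ fun p => by positivity)]
  exact lintegral_pair_le u hv ht

/-- Bounding |a||b||c||d| by |a|²|b|² + |c|²|d|² pairs each orbital of the first variable with one
of the second, and derivatives are only needed for the latter. -/
theorem integrable_four {a b c d : L2One} (hb : b ∈ sobolevOne) (hd : d ∈ sobolevOne) :
    Integrable (fun p : SpaceSpin × SpaceSpin => ((‖p.1.1 - p.2.1‖⁻¹ : ℝ) : ℂ)
      * (starRingEnd ℂ (a p.1) * c p.1 * (starRingEnd ℂ (b p.2) * d p.2)))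
      (spaceSpinMeasure.prod spaceSpinMeasure) := by
  refine ((integrable_pair a hb).add (integrable_pair c hd)).mono' ?_ (ae_of_all _ fun p => ?_)
  · refine (Complex.measurable_ofReal.comp measurable_dist_pair.inv).aestronglyMeasurable.mul ?_
    exact (((aestronglyMeasurable_comp_fst a).star).mul (aestronglyMeasurable_comp_fst c)).mul
      (((aestronglyMeasurable_comp_snd b).star).mul (aestronglyMeasurable_comp_snd d))
  · simp only [norm_mul, Complex.norm_real, RCLike.norm_conj, norm_inv, norm_norm, Pi.add_apply,
      div_eq_mul_inv]
    have h1 := sq_nonneg (‖a p.1‖ * ‖b p.2‖ - ‖c p.1‖ * ‖d p.2‖)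
    have h2 : 0 ≤ (‖a p.1‖ * ‖b p.2‖) ^ 2 + (‖c p.1‖ * ‖d p.2‖) ^ 2 := by positivity
    rw [← add_mul, mul_comm]
    refine mul_le_mul_of_nonneg_right ?_ (by positivity)
    nlinarith

/-- `½ ∬ |u(x) v(y) - v(x) u(y)|² / |𝐱 - 𝐲|`, the direct minus the exchange integral. -/
noncomputable def pairEnergy (u v : L2One) : ℝ :=
  (1 / 2) * ∫ p : SpaceSpin × SpaceSpin, ‖u p.1 * v p.2 - v p.1 * u p.2‖ ^ 2 / ‖p.1.1 - p.2.1‖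
    ∂spaceSpinMeasure.prod spaceSpinMeasure

theorem pairEnergy_nonneg (u v : L2One) : 0 ≤ pairEnergy u v :=
  mul_nonneg (by norm_num) (integral_nonneg fun p => by positivity)

theorem pairEnergy_comm (u v : L2One) : pairEnergy u v = pairEnergy v u := by
  simp only [pairEnergy]
  congr 2; ext p
  rw [norm_sub_rev]

theorem pairEnergy_self (u : L2One) : pairEnergy u u = 0 := by
  simp [pairEnergy]

theorem integrable_pairEnergy {u v : L2One} (hu : u ∈ sobolevOne) (hv : v ∈ sobolevOne) :
    Integrable (fun p : SpaceSpin × SpaceSpin =>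
      ‖u p.1 * v p.2 - v p.1 * u p.2‖ ^ 2 / ‖p.1.1 - p.2.1‖)
      (spaceSpinMeasure.prod spaceSpinMeasure) := by
  refine (((integrable_pair u hv).add (integrable_pair v hu)).const_mul 2).mono' ?_
    (ae_of_all _ fun p => ?_)
  · exact (((((aestronglyMeasurable_comp_fst u).mul (aestronglyMeasurable_comp_snd v)).sub
      ((aestronglyMeasurable_comp_fst v).mul
        (aestronglyMeasurable_comp_snd u))).norm.pow 2).aemeasurable.div
          measurable_dist_pair.aemeasurable).aestronglyMeasurable
  · rw [Real.norm_of_nonneg (by positivity)]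
    simp only [Pi.add_apply]
    rw [← add_div, ← mul_div_assoc]
    gcongr
    have h1 := norm_sub_le (u p.1 * v p.2) (v p.1 * u p.2)
    rw [norm_mul, norm_mul] at h1
    have h2 := sq_nonneg (‖u p.1‖ * ‖v p.2‖ - ‖v p.1‖ * ‖u p.2‖)
    nlinarith [norm_nonneg (u p.1 * v p.2 - v p.1 * u p.2)]

/-- The square of the difference is at most twice the sum of the squares, and both squares have the
same Coulomb integral by the symmetry of the two particles. The parameter `t` stays free because a
slowly varying `v` requires a large `t`. -/
theorem pairEnergy_le {u v : L2One} (hu : u ∈ sobolevOne) (hv : v ∈ sobolevOne) {t : ℝ}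
    (ht : 0 < t) : pairEnergy u v ≤ 2 * ((t * gradNormSq v + t⁻¹ * ‖v‖ ^ 2) / 2 * ‖u‖ ^ 2) := by
  have h1 := integrable_pair u hv
  have h2 : Integrable (fun p : SpaceSpin × SpaceSpin =>
      ‖v p.1‖ ^ 2 * ‖u p.2‖ ^ 2 / ‖p.1.1 - p.2.1‖)
      (spaceSpinMeasure.prod spaceSpinMeasure) := integrable_pair v hu
  have h3 : ∫ p : SpaceSpin × SpaceSpin, ‖v p.1‖ ^ 2 * ‖u p.2‖ ^ 2 / ‖p.1.1 - p.2.1‖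
        ∂spaceSpinMeasure.prod spaceSpinMeasure
      = ∫ p : SpaceSpin × SpaceSpin, ‖u p.1‖ ^ 2 * ‖v p.2‖ ^ 2 / ‖p.1.1 - p.2.1‖
        ∂spaceSpinMeasure.prod spaceSpinMeasure := by
    rw [← integral_prod_swap]
    refine integral_congr_ae (ae_of_all _ fun p => ?_)
    simp only [Prod.fst_swap, Prod.snd_swap]
    rw [norm_sub_rev, mul_comm]
  have h4 := integral_pair_le u hv ht
  have h5 : ∫ p : SpaceSpin × SpaceSpin, ‖u p.1 * v p.2 - v p.1 * u p.2‖ ^ 2 / ‖p.1.1 - p.2.1‖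
      ∂spaceSpinMeasure.prod spaceSpinMeasure ≤ ∫ p : SpaceSpin × SpaceSpin,
        2 * (‖u p.1‖ ^ 2 * ‖v p.2‖ ^ 2 / ‖p.1.1 - p.2.1‖
          + ‖v p.1‖ ^ 2 * ‖u p.2‖ ^ 2 / ‖p.1.1 - p.2.1‖)
      ∂spaceSpinMeasure.prod spaceSpinMeasure := by
    refine integral_mono (integrable_pairEnergy hu hv) ((h1.add h2).const_mul 2) fun p => ?_
    simp only
    rw [← add_div, ← mul_div_assoc]
    gcongr
    have h1 := norm_sub_le (u p.1 * v p.2) (v p.1 * u p.2)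
    rw [norm_mul, norm_mul] at h1
    have h2 := sq_nonneg (‖u p.1‖ * ‖v p.2‖ - ‖v p.1‖ * ‖u p.2‖)
    nlinarith [norm_nonneg (u p.1 * v p.2 - v p.1 * u p.2)]
  rw [integral_const_mul, integral_add h1 h2, h3] at h5
  rw [pairEnergy]
  linarith

/-- The Coulomb integral of four orbitals. -/
noncomputable def coulombFour (a b c d : L2One) : ℂ :=
  ∫ p : SpaceSpin × SpaceSpin, ((‖p.1.1 - p.2.1‖⁻¹ : ℝ) : ℂ)
      * (starRingEnd ℂ (a p.1) * c p.1 * (starRingEnd ℂ (b p.2) * d p.2))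
    ∂spaceSpinMeasure.prod spaceSpinMeasure

theorem coulombFour_swap (a b c d : L2One) : coulombFour b a d c = coulombFour a b c d := by
  rw [coulombFour, ← integral_prod_swap, coulombFour]
  refine integral_congr_ae (ae_of_all _ fun p => ?_)
  simp only [Prod.fst_swap, Prod.snd_swap]
  rw [norm_sub_rev]
  ring

/-- Expanding |a(x) b(y) - b(x) a(y)|² gives two direct and two exchange terms; those of each kind
agree after swapping the particles, which cancels the factor 1/2. -/
theorem coulombFour_sub {a b : L2One} (ha : a ∈ sobolevOne) (hb : b ∈ sobolevOne) :
    coulombFour a b a b - coulombFour a b b a = (pairEnergy a b : ℂ) := by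
  have h1 : (pairEnergy a b : ℂ) = (1 / 2) * (coulombFour a b a b - coulombFour a b b a
      - coulombFour b a a b + coulombFour b a b a) := by
    have i1 := integrable_four (a := a) (b := b) (c := a) (d := b) hb hb
    have i2 := integrable_four (a := a) (b := b) (c := b) (d := a) hb ha
    have i3 := integrable_four (a := b) (b := a) (c := a) (d := b) ha hb
    have i4 := integrable_four (a := b) (b := a) (c := b) (d := a) ha ha
    rw [coulombFour, coulombFour, coulombFour, coulombFour, ← integral_sub' i1 i2,
      ← integral_sub' (i1.sub i2) i3, ← integral_add' ((i1.sub i2).sub i3) i4, pairEnergy,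
      Complex.ofReal_mul, ← integral_complex_ofReal]
    congr 1
    · simp
    · refine integral_congr_ae (ae_of_all _ fun p => ?_)
      simp only [Pi.sub_apply, Pi.add_apply]
      rw [Complex.ofReal_div, Complex.ofReal_pow, ← Complex.conj_mul', Complex.ofReal_inv,
        div_eq_mul_inv]
      simp only [map_sub, map_mul]
      ring
  rw [h1, coulombFour_swap a b a b, coulombFour_swap a b b a]
  ring

end Pair

/-! ### Double sums over permutations -/

section Perm

variable {N : ℕ}

/-- The sign of a permutation as a complex number. -/
noncomputable def csign (σ : Equiv.Perm (Fin N)) : ℂ := ((Equiv.Perm.sign σ : ℤ) : ℂ)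

theorem csign_mul (σ τ : Equiv.Perm (Fin N)) : csign (σ * τ) = csign σ * csign τ := by
  simp [csign]

theorem csign_mul_self (σ : Equiv.Perm (Fin N)) : csign σ * csign σ = 1 := by
  rw [← csign_mul, csign, Equiv.Perm.sign_mul, Int.units_mul_self]
  simp

theorem conj_csign (σ : Equiv.Perm (Fin N)) : starRingEnd ℂ (csign σ) = csign σ := by
  simp [csign]

theorem csign_inv (σ : Equiv.Perm (Fin N)) : csign σ⁻¹ = csign σ := by
  simp [csign]

theorem sum_perm_diagonal {c : Equiv.Perm (Fin N) → Equiv.Perm (Fin N) → ℂ}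
    (hc : ∀ σ τ, σ ≠ τ → c σ τ = 0) :
    ∑ σ, ∑ τ, csign σ * csign τ * c σ τ = ∑ σ, c σ σ := by
  refine Finset.sum_congr rfl fun σ _ => ?_
  rw [Fintype.sum_eq_single σ fun τ hτ => by rw [hc σ τ (Ne.symm hτ), mul_zero], csign_mul_self,
    one_mul]

theorem perm_eq_of_eq_off {σ τ : Equiv.Perm (Fin N)} {n : Fin N} (h : ∀ l, l ≠ n → σ l = τ l) :
    σ = τ := by
  ext1 l
  rcases eq_or_ne l n with rfl | hl
  · by_contra hne
    have hs : σ (σ⁻¹ (τ l)) = τ l := σ.apply_symm_apply _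
    have h1 : σ⁻¹ (τ l) ≠ l := fun h2 => hne (by rw [h2] at hs; exact hs)
    have h2 := h _ h1
    rw [hs] at h2
    exact h1 (τ.injective h2).symm
  · exact h l hl

theorem perm_eq_or_eq_swap {σ τ : Equiv.Perm (Fin N)} {m n : Fin N}
    (h : ∀ l, ¬ (l = m ∨ l = n) → σ l = τ l) : τ = σ ∨ τ = σ * Equiv.swap m n := by
  have h1 : ∀ l, ¬ (l = m ∨ l = n) → (σ⁻¹ * τ) l = l := fun l hl => by
    rw [Equiv.Perm.mul_apply, ← h l hl]; exact σ.symm_apply_apply l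
  set π := σ⁻¹ * τ with hπ
  have hτ : τ = σ * π := by rw [hπ, mul_inv_cancel_left]
  have h2 : ∀ k, (k = m ∨ k = n) → (π k = m ∨ π k = n) := fun k hk => by
    by_contra hl
    have := π.injective (h1 _ hl)
    exact hl (by rw [this]; exact hk)
  rw [hτ]
  rcases h2 m (Or.inl rfl) with hm | hm
  · left
    have : π = 1 := by
      refine (perm_eq_of_eq_off (n := n) fun l hl => ?_)
      rcases eq_or_ne l m with rfl | hlm
      · simpa using hm
      · simpa using h1 l (by tauto)
    rw [this, mul_one]
  · right
    congr 1
    refine (perm_eq_of_eq_off (n := n) fun l hl => ?_)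
    rcases eq_or_ne l m with rfl | hlm
    · rw [hm, Equiv.swap_apply_left]
    · rw [h1 l (by tauto), Equiv.swap_apply_of_ne_of_ne hlm hl]

/-- The Slater-Condon rule for a two-body operator: orthogonality in the remaining variables forces
the permutations to agree there, so they are equal or differ by the transposition of `m` and `n`.
The latter has sign -1 and yields the exchange term. -/
theorem sum_perm_pair {m n : Fin N} (hmn : m ≠ n)
    {c : Equiv.Perm (Fin N) → Equiv.Perm (Fin N) → ℂ}
    (hc : ∀ σ τ l, ¬ (l = m ∨ l = n) → σ l ≠ τ l → c σ τ = 0) :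
    ∑ σ, ∑ τ, csign σ * csign τ * c σ τ = ∑ σ, (c σ σ - c σ (σ * Equiv.swap m n)) := by
  refine Finset.sum_congr rfl fun σ _ => ?_
  have hne : σ ≠ σ * Equiv.swap m n := by
    intro h
    have := congrArg (fun π => π m) h
    simp only [Equiv.Perm.mul_apply, Equiv.swap_apply_left] at this
    exact hmn (σ.injective this)
  rw [Fintype.sum_eq_add σ (σ * Equiv.swap m n) hne fun τ hτ => ?_]
  · rw [csign_mul_self, csign_mul, ← mul_assoc (csign σ), csign_mul_self]
    simp [csign, Equiv.Perm.sign_swap hmn]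
    ring
  · by_cases h : ∀ l, ¬ (l = m ∨ l = n) → σ l = τ l
    · rcases perm_eq_or_eq_swap h with h1 | h1
      · exact absurd h1 hτ.1
      · exact absurd h1 hτ.2
    · push Not at h
      obtain ⟨l, hl, hl2⟩ := h
      rw [hc σ τ l (by tauto) hl2, mul_zero]

theorem sum_lt_eq_half_sum {W : Fin N → Fin N → ℝ} (hs : ∀ i j, W i j = W j i)
    (h0 : ∀ i, W i i = 0) :
    ∑ n, ∑ m ∈ Finset.univ.filter (· < n), W m n = (1 / 2) * ∑ i, ∑ j, W i j := by
  have h1 : ∀ n, ∑ m, W m n = ∑ m ∈ Finset.univ.filter (· < n), W m n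
      + ∑ m ∈ Finset.univ.filter (n < ·), W m n := by
    intro n
    rw [← Finset.sum_union (Finset.disjoint_filter.2 fun x _ h => not_lt.2 h.le)]
    symm
    refine Finset.sum_subset (Finset.subset_univ _) fun x _ hx => ?_
    simp only [Finset.mem_union, Finset.mem_filter, Finset.mem_univ, true_and, not_or, not_lt] at hx
    rw [le_antisymm hx.2 hx.1, h0]
  have h2 : ∑ n, ∑ m ∈ Finset.univ.filter (n < ·), W m n
      = ∑ n, ∑ m ∈ Finset.univ.filter (· < n), W m n := by
    simp only [Finset.sum_filter]
    rw [Finset.sum_comm]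
    refine Finset.sum_congr rfl fun i _ => Finset.sum_congr rfl fun j _ => ?_
    rw [hs]
  have h3 : ∑ i, ∑ j, W i j = ∑ n, ∑ m, W m n := Finset.sum_comm
  rw [h3, Finset.sum_congr rfl fun n _ => h1 n, Finset.sum_add_distrib, h2]
  ring

end Perm

/-! ### Slater determinants -/

section Slater

variable {N : ℕ}

/-- The (unnormalized) Slater determinant of the orbitals `φ`. -/
noncomputable def slater (φ : Fin N → L2One) : L2N N :=
  ∑ σ : Equiv.Perm (Fin N), csign σ • tensor fun m => φ (σ m)

theorem compMeasurePreserving_tensor (π : Equiv.Perm (Fin N)) (f : Fin N → L2One) :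
    Lp.compMeasurePreserving _ (measurePreserving_perm N π) (tensor f)
      = tensor fun m => f (π⁻¹ m) := by
  refine Lp.ext ?_
  filter_upwards [Lp.coeFn_compMeasurePreserving (tensor f) (measurePreserving_perm N π),
    (measurePreserving_perm N π).quasiMeasurePreserving.ae (coeFn_tensor f),
    coeFn_tensor fun m => f (π⁻¹ m)] with x h1 h2 h3
  rw [h1, h3, Function.comp_apply, h2]
  refine Fintype.prod_equiv π _ _ fun m => ?_
  simp

theorem slater_mem_antisymmetric (φ : Fin N → L2One) : slater φ ∈ antisymmetric N := by
  intro π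
  have h : ∀ (c : ℂ) (f : L2N N), Lp.compMeasurePreserving _ (measurePreserving_perm N π) (c • f)
      = c • Lp.compMeasurePreserving _ (measurePreserving_perm N π) f := fun c f =>
    (Lp.compMeasurePreservingₗ ℂ _ (measurePreserving_perm N π)).map_smul c f
  rw [slater, map_sum, Finset.smul_sum]
  refine Fintype.sum_equiv (Equiv.mulRight π⁻¹) _ _ fun σ => ?_
  rw [h, compMeasurePreserving_tensor, smul_smul]
  congr 1
  rw [Equiv.coe_mulRight, csign_mul, csign_inv, mul_comm, mul_assoc]
  change csign σ = csign σ * (csign π * csign π)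
  rw [csign_mul_self, mul_one]

/-- The Slater determinant with the orbitals in the `n`-th variable replaced by `χ`. -/
noncomputable def slaterUpdate (φ χ : Fin N → L2One) (n : Fin N) : L2N N :=
  ∑ σ : Equiv.Perm (Fin N),
    csign σ • tensor (Function.update (fun m => φ (σ m)) n (χ (σ n)))

theorem isWeakPartial_slater {φ : Fin N → L2One} (hφ : ∀ j, φ j ∈ sobolevOne) (n : Fin N)
    (i : Fin 3) :
    IsWeakPartial n i (slater φ) (slaterUpdate φ (fun j => partialOne i (φ j)) n) :=
  HasWeakDeriv.sum (isSlicing_config N) _ fun σ _ =>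
    HasWeakDeriv.smul (isSlicing_config N) _
      (isWeakPartial_tensor _ n (isWeakPartialOne_partialOne (hφ (σ n)) i))

theorem inner_sum_perm (a b : Equiv.Perm (Fin N) → L2N N) :
    ⟪∑ σ, csign σ • a σ, ∑ τ, csign τ • b τ⟫_ℂ
      = ∑ σ, ∑ τ, csign σ * csign τ * ⟪a σ, b τ⟫_ℂ := by
  simp only [sum_inner, inner_sum, inner_smul_left, inner_smul_right, conj_csign, Finset.mul_sum]
  rw [Finset.sum_comm]
  exact Finset.sum_congr rfl fun σ _ => Finset.sum_congr rfl fun τ _ => by ring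

variable {φ : Fin N → L2One}

theorem norm_sq_slater (ho : Orthonormal ℂ φ) : ‖slater φ‖ ^ 2 = (Nat.factorial N : ℝ) := by
  have h : ⟪slater φ, slater φ⟫_ℂ = (Nat.factorial N : ℂ) := by
    rw [slater, inner_sum_perm]
    rw [sum_perm_diagonal (c := fun σ τ => ⟪tensor fun m => φ (σ m), tensor fun m => φ (τ m)⟫_ℂ)]
    · simp only [inner_tensor, orthonormal_iff_ite.1 ho]
      simp [Fintype.card_perm]
    · intro σ τ hne
      obtain ⟨l, hl⟩ : ∃ l, σ l ≠ τ l := by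
        by_contra! h
        exact hne (Equiv.ext h)
      rw [inner_tensor]
      exact Finset.prod_eq_zero (Finset.mem_univ l) (ho.2 hl)
  rw [inner_self_eq_ofReal] at h
  exact_mod_cast h

/-- Altering the factor in one variable costs the orthogonality in that variable only. Two
permutations that agree at all other indices are equal, so still only the diagonal contributes. -/
theorem inner_slaterUpdate (ho : Orthonormal ℂ φ) (χ : Fin N → L2One) (n : Fin N) :
    ⟪slaterUpdate φ χ n, slaterUpdate φ χ n⟫_ℂ
      = ∑ σ : Equiv.Perm (Fin N), ((‖χ (σ n)‖ ^ 2 : ℝ) : ℂ) := by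
  rw [slaterUpdate, inner_sum_perm, sum_perm_diagonal
    (c := fun σ τ => ⟪tensor (Function.update (fun m => φ (σ m)) n (χ (σ n))),
      tensor (Function.update (fun m => φ (τ m)) n (χ (τ n)))⟫_ℂ)]
  · refine Finset.sum_congr rfl fun σ _ => ?_
    rw [inner_tensor, Finset.prod_eq_single n]
    · simp only [Function.update_self, inner_self_eq_ofReal]
    · intro l _ hl
      simp only [Function.update_of_ne hl]
      rw [inner_self_eq_ofReal, ho.1]; simp
    · simp
  · intro σ τ hne
    obtain ⟨l, hl, hl2⟩ : ∃ l, l ≠ n ∧ σ l ≠ τ l := by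
      by_contra! h
      exact hne (perm_eq_of_eq_off h)
    rw [inner_tensor]
    refine Finset.prod_eq_zero (Finset.mem_univ l) ?_
    simp only [Function.update_of_ne hl]
    exact ho.2 hl2

theorem conj_slater_mul_slater_ae (φ : Fin N → L2One) :
    ∀ᵐ x ∂configMeasure N, starRingEnd ℂ (slater φ x) * slater φ x
      = ∑ σ : Equiv.Perm (Fin N), ∑ τ : Equiv.Perm (Fin N), csign σ * csign τ
        * ∏ m, (starRingEnd ℂ (φ (σ m) (x m)) * φ (τ m) (x m)) := by
  have h1 : ∀ᵐ x ∂configMeasure N, slater φ x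
      = ∑ σ : Equiv.Perm (Fin N), csign σ * ∏ m, φ (σ m) (x m) := by
    have h2 : ∀ᵐ x ∂configMeasure N, ∀ σ : Equiv.Perm (Fin N),
        (csign σ • tensor fun m => φ (σ m) : L2N N) x = csign σ * ∏ m, φ (σ m) (x m) := by
      refine ae_all_iff.2 fun σ => ?_
      filter_upwards [Lp.coeFn_smul (csign σ) (tensor fun m => φ (σ m)),
        coeFn_tensor fun m => φ (σ m)] with x h3 h4
      rw [h3, Pi.smul_apply, h4, smul_eq_mul]
    have h5 := Lp.coeFn_finsetSum (Finset.univ : Finset (Equiv.Perm (Fin N)))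
      fun σ => csign σ • tensor fun m => φ (σ m)
    filter_upwards [h2, h5] with x h6 h7
    rw [slater, h7]
    simp only [h6, Finset.sum_apply]
  filter_upwards [h1] with x hx
  rw [hx, map_sum, Finset.sum_mul_sum]
  refine Finset.sum_congr rfl fun σ _ => Finset.sum_congr rfl fun τ _ => ?_
  rw [map_mul, conj_csign, map_prod, Finset.prod_mul_distrib]
  ring

theorem integral_conj_mul (f g : L2One) :
    ∫ x, starRingEnd ℂ (f x) * g x ∂spaceSpinMeasure = ⟪f, g⟫_ℂ := by
  rw [L2.inner_def]
  refine integral_congr_ae (ae_of_all _ fun x => ?_)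
  simp only [RCLike.inner_apply, mul_comm]

theorem integrable_conj_mul (f g : L2One) :
    Integrable (fun x => starRingEnd ℂ (f x) * g x) spaceSpinMeasure := by
  refine (L2.integrable_inner (𝕜 := ℂ) f g).congr (ae_of_all _ fun x => ?_)
  simp only [RCLike.inner_apply, mul_comm]

theorem integral_potential_slater (ho : Orthonormal ℂ φ) (n : Fin N) (V : Space → ℝ)
    (hV : ∀ a b, Integrable (fun x : SpaceSpin => (V x.1 : ℂ)
      * (starRingEnd ℂ (φ a x) * φ b x)) spaceSpinMeasure) :
    ∫ x, (V (x n).1 : ℂ) * (starRingEnd ℂ (slater φ x) * slater φ x) ∂configMeasure N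
      = ∑ σ : Equiv.Perm (Fin N), ∫ x : SpaceSpin, (V x.1 : ℂ)
        * (starRingEnd ℂ (φ (σ n) x) * φ (σ n) x) ∂spaceSpinMeasure := by
  let F : Equiv.Perm (Fin N) → Equiv.Perm (Fin N) → Fin N → SpaceSpin → ℂ := fun σ τ m y =>
    (if m = n then (V y.1 : ℂ) else 1) * (starRingEnd ℂ (φ (σ m) y) * φ (τ m) y)
  have hFi : ∀ σ τ m, Integrable (F σ τ m) spaceSpinMeasure := fun σ τ m => by
    by_cases h : m = n
    · simp only [F, if_pos h]; exact hV _ _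
    · simp only [F, if_neg h, one_mul]; exact integrable_conj_mul _ _
  have hF : ∀ σ τ (x : Fin N → SpaceSpin), (V (x n).1 : ℂ)
      * ∏ m, (starRingEnd ℂ (φ (σ m) (x m)) * φ (τ m) (x m)) = ∏ m, F σ τ m (x m) := by
    intro σ τ x
    rw [Finset.prod_mul_distrib (f := fun m => if m = n then (V (x m).1 : ℂ) else 1)]
    simp
  have h1 : ∫ x, (V (x n).1 : ℂ) * (starRingEnd ℂ (slater φ x) * slater φ x) ∂configMeasure N
      = ∫ x, ∑ σ, ∑ τ, csign σ * csign τ * ∏ m, F σ τ m (x m) ∂configMeasure N := by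
    refine integral_congr_ae ?_
    filter_upwards [conj_slater_mul_slater_ae φ] with x hx
    rw [hx, Finset.mul_sum]
    refine Finset.sum_congr rfl fun σ _ => ?_
    rw [Finset.mul_sum]
    refine Finset.sum_congr rfl fun τ _ => ?_
    rw [← hF]; ring
  have hint : ∀ σ τ, Integrable (fun x : Fin N → SpaceSpin =>
      csign σ * csign τ * ∏ m, F σ τ m (x m)) (configMeasure N) := fun σ τ =>
    (Integrable.fintype_prod (f := F σ τ) fun m => hFi σ τ m).const_mul _
  rw [h1, integral_finsetSum _ fun σ _ => integrable_finsetSum _ fun τ _ => hint σ τ]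
  simp only [integral_finsetSum _ fun τ _ => hint _ τ, integral_const_mul]
  rw [sum_perm_diagonal (c := fun σ τ => ∫ x, ∏ m, F σ τ m (x m) ∂configMeasure N)]
  · refine Finset.sum_congr rfl fun σ _ => ?_
    rw [configMeasure, integral_fintype_prod_eq_prod, Finset.prod_eq_single n]
    · simp only [F, if_true]
    · intro l _ hl
      simp only [F, if_neg hl, one_mul]
      rw [integral_conj_mul, inner_self_eq_ofReal, ho.1]; simp
    · simp
  · intro σ τ hne
    obtain ⟨l, hl, hl2⟩ : ∃ l, l ≠ n ∧ σ l ≠ τ l := by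
      by_contra! h
      exact hne (perm_eq_of_eq_off h)
    rw [configMeasure, integral_fintype_prod_eq_prod]
    refine Finset.prod_eq_zero (Finset.mem_univ l) ?_
    simp only [F, if_neg hl, one_mul]
    rw [integral_conj_mul]
    exact ho.2 hl2

/-- The Coulomb interaction couples two variables, so besides the diagonal there are the transposed
terms: direct minus exchange integral for each permutation. -/
theorem integral_coulomb_slater (ho : Orthonormal ℂ φ) (hφ : ∀ j, φ j ∈ sobolevOne)
    {m n : Fin N} (hmn : m ≠ n) :
    ∫ x, starRingEnd ℂ (slater φ x) * slater φ x / (‖(x m).1 - (x n).1‖ : ℂ) ∂configMeasure N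
      = ∑ σ : Equiv.Perm (Fin N), (pairEnergy (φ (σ m)) (φ (σ n)) : ℂ) := by
  let F : Equiv.Perm (Fin N) → Equiv.Perm (Fin N) → SpaceSpin × SpaceSpin → ℂ := fun σ τ p =>
    ((‖p.1.1 - p.2.1‖⁻¹ : ℝ) : ℂ) * (starRingEnd ℂ (φ (σ m) p.1) * φ (τ m) p.1
      * (starRingEnd ℂ (φ (σ n) p.2) * φ (τ n) p.2))
  let G : Equiv.Perm (Fin N) → Equiv.Perm (Fin N) → (Fin N → SpaceSpin) → ℂ := fun σ τ x =>
    F σ τ (x m, x n) * ∏ l ∈ Finset.univ.filter fun l => ¬ (l = m ∨ l = n),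
      (starRingEnd ℂ (φ (σ l) (x l)) * φ (τ l) (x l))
  have hF : ∀ σ τ (x : Fin N → SpaceSpin),
      (∏ l, (starRingEnd ℂ (φ (σ l) (x l)) * φ (τ l) (x l))) / (‖(x m).1 - (x n).1‖ : ℂ)
        = G σ τ x := by
    intro σ τ x
    have h2 : (Finset.univ.filter fun l => l = m ∨ l = n) = {m, n} := by ext; simp
    rw [← Finset.prod_filter_mul_prod_filter_not Finset.univ (fun l => l = m ∨ l = n), h2,
      Finset.prod_pair hmn]
    simp only [G, F, Complex.ofReal_inv, div_eq_mul_inv]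
    ring
  have h1 : ∫ x, starRingEnd ℂ (slater φ x) * slater φ x / (‖(x m).1 - (x n).1‖ : ℂ)
      ∂configMeasure N = ∫ x, ∑ σ, ∑ τ, csign σ * csign τ * G σ τ x ∂configMeasure N := by
    refine integral_congr_ae ?_
    filter_upwards [conj_slater_mul_slater_ae φ] with x hx
    rw [hx, Finset.sum_div]
    refine Finset.sum_congr rfl fun σ _ => ?_
    rw [Finset.sum_div]
    refine Finset.sum_congr rfl fun τ _ => ?_
    rw [mul_div_assoc, hF]
  have hint : ∀ σ τ, Integrable (fun x : Fin N → SpaceSpin =>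
      csign σ * csign τ * G σ τ x) (configMeasure N) := fun σ τ =>
    (integrable_pair_mul_prod spaceSpinMeasure hmn (F := F σ τ)
      (g := fun l y => starRingEnd ℂ (φ (σ l) y) * φ (τ l) y)
      (integrable_four (hφ _) (hφ _)) fun l => integrable_conj_mul _ _).const_mul _
  have hG : ∀ σ τ, ∫ x, G σ τ x ∂configMeasure N
      = coulombFour (φ (σ m)) (φ (σ n)) (φ (τ m)) (φ (τ n))
        * ∏ l ∈ Finset.univ.filter fun l => ¬ (l = m ∨ l = n), ⟪φ (σ l), φ (τ l)⟫_ℂ := fun σ τ => by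
    have := integral_pair_mul_prod spaceSpinMeasure hmn (F σ τ)
      fun l y => starRingEnd ℂ (φ (σ l) y) * φ (τ l) y
    simp only [integral_conj_mul] at this
    exact this
  rw [h1, integral_finsetSum _ fun σ _ => integrable_finsetSum _ fun τ _ => hint σ τ]
  simp only [integral_finsetSum _ fun τ _ => hint _ τ, integral_const_mul]
  rw [sum_perm_pair hmn (c := fun σ τ => ∫ x, G σ τ x ∂configMeasure N)]
  · refine Finset.sum_congr rfl fun σ _ => ?_
    have h3 : ∀ τ : Equiv.Perm (Fin N), (∀ l, ¬ (l = m ∨ l = n) → τ l = σ l) →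
        ∏ l ∈ Finset.univ.filter fun l => ¬ (l = m ∨ l = n), ⟪φ (σ l), φ (τ l)⟫_ℂ = 1 := by
      intro τ hτ
      refine Finset.prod_eq_one fun l hl => ?_
      rw [hτ l (by simpa using hl), inner_self_eq_ofReal, ho.1]; simp
    rw [hG, hG, h3 σ fun _ _ => rfl, h3 (σ * Equiv.swap m n) fun l hl => ?_, mul_one, mul_one,
      Equiv.Perm.mul_apply, Equiv.Perm.mul_apply, Equiv.swap_apply_left, Equiv.swap_apply_right,
      coulombFour_sub (hφ _) (hφ _)]
    rw [not_or] at hl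
    rw [Equiv.Perm.mul_apply, Equiv.swap_apply_of_ne_of_ne hl.1 hl.2]
  · intro σ τ l hl hl2
    rw [hG, Finset.prod_eq_zero (i := l) (by simpa using hl) (ho.2 hl2), mul_zero]

end Slater

/-! ### The energy of a Slater determinant -/

/-- The energy of one orbital in the field of the nucleus. -/
noncomputable def orbitalEnergy (Z : ℝ) (u : L2One) : ℝ :=
  (1 / 2) * gradNormSq u - Z * ∫ x, ‖u x‖ ^ 2 / ‖x.1‖ ∂spaceSpinMeasure

theorem integrable_nuclear {u : L2One} (hu : u ∈ sobolevOne) :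
    Integrable (fun x : SpaceSpin => ‖u x‖ ^ 2 / ‖x.1‖) spaceSpinMeasure := by
  refine ⟨((Lp.aestronglyMeasurable u).norm.pow 2).aemeasurable.div
    (by fun_prop : Measurable fun x : SpaceSpin => ‖x.1‖).aemeasurable |>.aestronglyMeasurable, ?_⟩
  rw [hasFiniteIntegral_iff_ofReal (ae_of_all _ fun p => by positivity)]
  refine lt_of_le_of_lt (lintegral_mono fun x => ENNReal.ofReal_le_ofReal ?_)
    ((hardy_one hu 0 one_pos).trans_lt ENNReal.ofReal_lt_top)
  rw [sub_zero]
  gcongr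
  nlinarith [sq_nonneg ‖u x‖]

theorem integral_nuclear_le {u : L2One} (hu : u ∈ sobolevOne) :
    ∫ x, ‖u x‖ ^ 2 / ‖x.1‖ ∂spaceSpinMeasure ≤ gradNormSq u + ‖u‖ ^ 2 := by
  have h0 := gradNormSq_nonneg u
  rw [← ENNReal.ofReal_le_ofReal_iff (by positivity),
    ofReal_integral_eq_lintegral_ofReal (integrable_nuclear hu) (ae_of_all _ fun p => by positivity)]
  have h := hardy_one hu 0 one_pos
  rw [one_mul, inv_one, one_mul] at h
  refine le_trans (lintegral_mono fun x => ENNReal.ofReal_le_ofReal ?_) h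
  rw [sub_zero]
  gcongr
  nlinarith [sq_nonneg ‖u x‖]

theorem integrable_nuclear_conj_mul {Z : ℝ} {u v : L2One} (hu : u ∈ sobolevOne)
    (hv : v ∈ sobolevOne) :
    Integrable (fun x : SpaceSpin => ((-Z / ‖x.1‖ : ℝ) : ℂ) * (starRingEnd ℂ (u x) * v x))
      spaceSpinMeasure := by
  refine (((integrable_nuclear hu).add (integrable_nuclear hv)).const_mul |Z|).mono' ?_
    (ae_of_all _ fun x => ?_)
  · refine (Measurable.aestronglyMeasurable (by fun_prop)).mul ?_
    exact (Lp.aestronglyMeasurable u).star.mul (Lp.aestronglyMeasurable v)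
  · simp only [norm_mul, Complex.norm_real, RCLike.norm_conj, norm_div, norm_neg,
      Pi.add_apply, Real.norm_eq_abs, abs_norm]
    rw [← add_div, div_mul_eq_mul_div, mul_div_assoc]
    have := sq_nonneg (‖u x‖ - ‖v x‖)
    gcongr
    nlinarith [norm_nonneg (u x), norm_nonneg (v x)]

/-- The energy of a family of orbitals. -/
noncomputable def slaterEnergy (Z : ℝ) {ι : Type*} [Fintype ι] (φ : ι → L2One) : ℝ :=
  ∑ i, orbitalEnergy Z (φ i) + (1 / 2) * ∑ i, ∑ j, pairEnergy (φ i) (φ j)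

theorem groundStateEnergy_le_slaterEnergy {Z : ℝ} (hZ : 0 ≤ Z) {N : ℕ} {φ : Fin N → L2One}
    (ho : Orthonormal ℂ φ) (hφ : ∀ j, φ j ∈ sobolevOne) :
    groundStateEnergy Z N ≤ slaterEnergy Z φ := by
  let Ψ : antisymmetric N := ⟨slater φ, slater_mem_antisymmetric φ⟩
  have hΨ : Ψ ∈ formDomain N := fun n i => ⟨_, isWeakPartial_slater hφ n i⟩
  have h := groundStateEnergy_mul_le hZ N hΨ
  have hn : ‖Ψ‖ ^ 2 = (Nat.factorial N : ℝ) := norm_sq_slater ho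
  -- Each index is hit by electron n for (N-1)! permutations, and there are N electrons. The
  -- resulting N! also is the squared norm of the determinant, and it cancels in the end.
  have hperm : ∀ (X : Fin N → ℝ), ∑ n, ∑ σ : Equiv.Perm (Fin N), X (σ n)
      = (Nat.factorial N : ℝ) * ∑ j, X j := fun X => by
    rw [Finset.sum_comm]
    simp only [Equiv.sum_comp, Finset.sum_const, Finset.card_univ, Fintype.card_perm,
      Fintype.card_fin, nsmul_eq_mul]
  have h1 : ∀ n : Fin N, ((1 / 2) * (∑ i, ⟪weakPartial n i (Ψ : L2N N),
      weakPartial n i (Ψ : L2N N)⟫_ℂ) + ∫ x, ((-Z / ‖(x n).1‖ : ℝ) : ℂ)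
        * (starRingEnd ℂ ((Ψ : L2N N) x) * (Ψ : L2N N) x) ∂configMeasure N)
      = ((∑ σ : Equiv.Perm (Fin N), orbitalEnergy Z (φ (σ n)) : ℝ) : ℂ) := by
    intro n
    rw [integral_potential_slater ho n (fun y => -Z / ‖y‖) fun a b =>
      integrable_nuclear_conj_mul (hφ a) (hφ b)]
    have h2 : ∀ i, ⟪weakPartial n i (Ψ : L2N N), weakPartial n i (Ψ : L2N N)⟫_ℂ
        = ∑ σ : Equiv.Perm (Fin N), ((‖partialOne i (φ (σ n))‖ ^ 2 : ℝ) : ℂ) := fun i => by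
      rw [IsWeakPartial.weakPartial_eq (isWeakPartial_slater hφ n i), inner_slaterUpdate ho]
    simp only [h2]
    rw [Finset.sum_comm, Complex.ofReal_sum, Finset.mul_sum, ← Finset.sum_add_distrib]
    refine Finset.sum_congr rfl fun σ _ => ?_
    rw [orbitalEnergy, Complex.ofReal_sub, sub_eq_add_neg]
    congr 1
    · rw [gradNormSq]; push_cast; rfl
    · rw [← Complex.ofReal_neg, ← neg_mul, ← integral_const_mul, ← integral_complex_ofReal]
      refine integral_congr_ae (ae_of_all _ fun x => ?_)
      simp only
      rw [Complex.conj_mul']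
      push_cast
      ring
  have h3 : energyForm (fun x => -Z / ‖x‖) N Ψ Ψ
      = (((Nat.factorial N : ℝ) * slaterEnergy Z φ : ℝ) : ℂ) := by
    rw [energyForm, Finset.sum_congr rfl fun n _ => h1 n, ← Complex.ofReal_sum,
      hperm fun j => orbitalEnergy Z (φ j)]
    have h4 : ∀ n : Fin N, ∀ m ∈ Finset.univ.filter (· < n),
        ∫ x, starRingEnd ℂ ((Ψ : L2N N) x) * (Ψ : L2N N) x / (‖(x m).1 - (x n).1‖ : ℂ)
          ∂configMeasure N = ((∑ σ : Equiv.Perm (Fin N),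
            pairEnergy (φ (σ m)) (φ (σ n)) : ℝ) : ℂ) := by
      intro n m hm
      rw [Complex.ofReal_sum]
      exact integral_coulomb_slater ho hφ (by simpa using hm : m < n).ne
    rw [Finset.sum_congr rfl fun n _ => Finset.sum_congr rfl fun m hm => h4 n m hm]
    have h5 : ∑ n : Fin N, ∑ m ∈ Finset.univ.filter (· < n), ∑ σ : Equiv.Perm (Fin N),
        pairEnergy (φ (σ m)) (φ (σ n))
        = (Nat.factorial N : ℝ) * ((1 / 2) * ∑ i, ∑ j, pairEnergy (φ i) (φ j)) := by
      have h6 : ∀ σ : Equiv.Perm (Fin N), ∑ n : Fin N, ∑ m ∈ Finset.univ.filter (· < n),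
          pairEnergy (φ (σ m)) (φ (σ n)) = (1 / 2) * ∑ i, ∑ j, pairEnergy (φ i) (φ j) := by
        intro σ
        rw [sum_lt_eq_half_sum (W := fun m n => pairEnergy (φ (σ m)) (φ (σ n)))
          (fun _ _ => pairEnergy_comm _ _) fun _ => pairEnergy_self _]
        congr 1
        rw [← Equiv.sum_comp σ fun i => ∑ j, pairEnergy (φ i) (φ j)]
        refine Finset.sum_congr rfl fun i _ => ?_
        rw [← Equiv.sum_comp σ fun j => pairEnergy (φ (σ i)) (φ j)]
      rw [Finset.sum_congr rfl fun n _ => Finset.sum_comm, Finset.sum_comm,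
        Finset.sum_congr rfl fun σ _ => h6 σ]
      simp [Fintype.card_perm]
    rw [slaterEnergy, mul_add, ← h5]
    push_cast
    rfl
  rw [h3, Complex.ofReal_re, hn, mul_comm] at h
  exact le_of_mul_le_mul_left h (by positivity)

/-! ### Smooth functions as orbitals -/

section Smooth

theorem memLp_spin_mul (a : Fin 2 → ℂ) {χ : Space → ℝ} (hχ : Continuous χ)
    (hc : HasCompactSupport χ) :
    MemLp (fun p : SpaceSpin => a p.2 * (χ p.1 : ℂ)) 2 spaceSpinMeasure := by
  have hm : Measurable fun p : SpaceSpin => a p.2 * (χ p.1 : ℂ) := by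
    have h1 : Measurable a := measurable_of_countable a
    have h2 := hχ.measurable
    fun_prop
  rw [memLp_two_iff_lintegral hm.aestronglyMeasurable, isSlicing_spaceSpin.lintegral_eq]
  refine ENNReal.sum_lt_top.2 fun s _ => ?_
  exact (memLp_two_iff_lintegral (by fun_prop)).1
    ((memLp_ofReal_of_hasCompactSupport hχ hc).const_mul (a s))

/-- The orbital `(𝐱, σ) ↦ a(σ) χ(𝐱)`. -/
noncomputable def spinMul (a : Fin 2 → ℂ) {χ : Space → ℝ} (hχ : Continuous χ)
    (hc : HasCompactSupport χ) : L2One := (memLp_spin_mul a hχ hc).toLp _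

theorem coeFn_spinMul (a : Fin 2 → ℂ) {χ : Space → ℝ} (hχ : Continuous χ)
    (hc : HasCompactSupport χ) :
    spinMul a hχ hc =ᵐ[spaceSpinMeasure] fun p => a p.2 * (χ p.1 : ℂ) :=
  (memLp_spin_mul a hχ hc).coeFn_toLp

theorem isWeakPartialOne_spinMul (a : Fin 2 → ℂ) {χ : Space → ℝ} (hχ : ContDiff ℝ ∞ χ)
    (hc : HasCompactSupport χ) (i : Fin 3) :
    IsWeakPartialOne i (spinMul a hχ.continuous hc)
      (spinMul a (continuous_fderiv_apply_of_contDiff hχ (EuclideanSpace.single i 1))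
        (hc.fderiv_apply ℝ _)) := by
  intro s
  have h1 : ContDiff ℝ 1 fun x => a s * (χ x : ℂ) :=
    contDiff_const.mul (Complex.ofRealCLM.contDiff.comp (hχ.of_le (by simp)))
  refine (isWeakDeriv_of_contDiff h1 (EuclideanSpace.single i 1)).congr
    (isSlicing_spaceSpin.ae_eq_comp (coeFn_spinMul a hχ.continuous hc) s).symm ?_
  refine Filter.EventuallyEq.trans (ae_of_all _ fun x => ?_)
    (isSlicing_spaceSpin.ae_eq_comp (coeFn_spinMul a
      (continuous_fderiv_apply_of_contDiff hχ (EuclideanSpace.single i 1))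
        (hc.fderiv_apply ℝ _)) s).symm
  have h2 : HasFDerivAt (fun x => a s * (χ x : ℂ))
      (a s • (Complex.ofRealCLM.comp (fderiv ℝ χ x))) x :=
    (Complex.ofRealCLM.hasFDerivAt.comp x
      ((hχ.differentiable (by simp)) x).hasFDerivAt).const_mul (a s)
  simp only
  rw [h2.fderiv]
  simp

theorem inner_spinMul (a : Fin 2 → ℂ) {χ : Space → ℝ} (hχ : Continuous χ)
    (hc : HasCompactSupport χ) (f : L2One) :
    ⟪spinMul a hχ hc, f⟫_ℂ = ∑ s, starRingEnd ℂ (a s) * ∫ x, χ x • f (x, s) := by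
  have h := L2.integrable_inner (𝕜 := ℂ) (spinMul a hχ hc) f
  rw [L2.inner_def, isSlicing_spaceSpin.integral_eq h]
  refine Finset.sum_congr rfl fun s _ => ?_
  rw [← integral_const_mul]
  refine integral_congr_ae ?_
  filter_upwards [isSlicing_spaceSpin.ae_eq_comp (coeFn_spinMul a hχ hc) s] with x hx
  rw [RCLike.inner_apply, hx]
  simp only [map_mul, Complex.conj_ofReal, Complex.real_smul]
  ring

/-- `H¹` is dense in `L²`. -/
theorem eq_zero_of_orthogonal_sobolevOne {f : L2One} (h : ∀ φ ∈ sobolevOne, ⟪φ, f⟫_ℂ = 0) :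
    f = 0 := by
  refine Lp.ext ?_
  refine Filter.EventuallyEq.trans ?_ (Lp.coeFn_zero ℂ 2 spaceSpinMeasure).symm
  refine isSlicing_spaceSpin.ae_iff.2 fun s => ?_
  refine ae_eq_zero_of_integral_contDiff_smul_eq_zero
    ((isSlicing_spaceSpin.memLp (Lp.memLp f) s).locallyIntegrable one_le_two) fun χ hχ hc => ?_
  have h1 := h (spinMul (Pi.single s 1) hχ.continuous hc)
    fun i => ⟨_, isWeakPartialOne_spinMul _ hχ hc i⟩
  rw [inner_spinMul, Finset.sum_eq_single s] at h1
  · simpa using h1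
  · intro t _ hts
    simp [Pi.single_eq_of_ne hts]
  · simp

theorem inner_spinMul_spinMul {χ η : Space → ℝ} (hχ : Continuous χ) (hχc : HasCompactSupport χ)
    (hη : Continuous η) (hηc : HasCompactSupport η) :
    ⟪spinMul 1 hχ hχc, spinMul 1 hη hηc⟫_ℂ = ((2 * ∫ x, χ x * η x : ℝ) : ℂ) := by
  rw [inner_spinMul]
  have h : ∀ s : Fin 2, ∫ x, χ x • spinMul 1 hη hηc (x, s) = ((∫ x, χ x * η x : ℝ) : ℂ) := by
    intro s
    rw [← integral_complex_ofReal]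
    refine integral_congr_ae ?_
    filter_upwards [isSlicing_spaceSpin.ae_eq_comp (coeFn_spinMul 1 hη hηc) s] with x hx
    rw [hx]
    simp
  simp only [h]
  simp [two_mul]

theorem sum_smul_inner_self {H α : Type*} [NormedAddCommGroup H] [InnerProductSpace ℂ H]
    [Fintype α] [DecidableEq α] (c : α → ℂ) {f : α → H} {M : ℝ}
    (h : ∀ i j, ⟪f i, f j⟫_ℂ = if i = j then (M : ℂ) else 0) :
    ‖∑ i, c i • f i‖ ^ 2 = M * ∑ i, ‖c i‖ ^ 2 := by
  have h1 := inner_self_eq_ofReal (∑ i, c i • f i)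
  simp only [sum_inner, inner_sum, inner_smul_left, inner_smul_right, h, mul_ite, mul_zero,
    Finset.sum_ite_eq', Finset.mem_univ, if_true] at h1
  apply Complex.ofReal_injective
  rw [← h1]
  push_cast
  rw [Finset.mul_sum]
  refine Finset.sum_congr rfl fun i _ => ?_
  rw [← Complex.conj_mul']
  ring

/-- There are orthonormal families of orbitals of any size with small kinetic energy. -/
theorem exists_slow_family (m : ℕ) {ε : ℝ} (hε : 0 < ε) :
    ∃ (f : Fin m → L2One) (g : Fin 3 → Fin m → L2One) (κ : Fin 3 → ℝ),
      (∀ i j, IsWeakPartialOne i (f j) (g i j)) ∧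
      (∀ j k, ⟪f j, f k⟫_ℂ = if j = k then ((1 : ℝ) : ℂ) else 0) ∧
      (∀ i j k, ⟪g i j, g i k⟫_ℂ = if j = k then (κ i : ℂ) else 0) ∧ ∑ i, κ i ≤ ε := by
  let b : ContDiffBump (0 : Space) := ⟨1 / 2, 1, by norm_num, by norm_num⟩
  have hb : ContDiff ℝ ∞ (b : Space → ℝ) := b.contDiff
  have hbc : HasCompactSupport (b : Space → ℝ) := b.hasCompactSupport
  let d : Fin 3 → Space → ℝ := fun i x => fderiv ℝ b x (EuclideanSpace.single i 1)
  set A : ℝ := ∫ x, b x * b x with hA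
  have hA0 : 0 < A := by
    have hcont : Continuous fun x => b x * b x := hb.continuous.mul hb.continuous
    refine hcont.integral_pos_of_hasCompactSupport_nonneg_nonzero hbc.mul_right
      (fun x => mul_self_nonneg _) (x := 0) ?_
    have : b 0 = 1 := b.one_of_mem_closedBall (by simp [b])
    simp [this]
  set D : Fin 3 → ℝ := fun i => ∫ x, d i x * d i x with hD
  have hD0 : ∀ i, 0 ≤ D i := fun i => integral_nonneg fun x => mul_self_nonneg _
  set S : ℝ := (∑ i, D i) / A with hS
  have hS0 : 0 ≤ S := div_nonneg (Finset.sum_nonneg fun i _ => hD0 i) hA0.le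
  -- Stretching a profile by 1/r multiplies its normalized kinetic energy S by r², and r² S = ε S /
  -- (S + 1) ≤ ε.
  set r : ℝ := √(ε / (S + 1)) with hr
  have hr0 : 0 < r := Real.sqrt_pos.2 (by positivity)
  have hr2 : r ^ 2 = ε / (S + 1) := Real.sq_sqrt (by positivity)
  -- In the stretched coordinate the bumps have radius 1 and centres at distance at least 3. Their
  -- supports are disjoint, which makes the functions, and likewise their derivatives, mutually
  -- orthogonal.
  let p : Fin m → Space := fun j => EuclideanSpace.single 0 (3 * (j : ℝ))
  let T : Fin m → Space → Space := fun j x => r • x - p j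
  let χ : Fin m → Space → ℝ := fun j x => b (T j x)
  have hχ : ∀ j, ContDiff ℝ ∞ (χ j) := fun j =>
    hb.comp ((contDiff_const_smul r).sub contDiff_const)
  have hT : ∀ j, HasCompactSupport (χ j) := fun j =>
    hbc.comp_homeomorph ((Homeomorph.smulOfNeZero r hr0.ne').trans (Homeomorph.subRight (p j)))
  have hdχ : ∀ i j x, fderiv ℝ (χ j) x (EuclideanSpace.single i 1) = r * d i (T j x) := by
    intro i j x
    have h1 : HasFDerivAt (T j) (r • ContinuousLinearMap.id ℝ Space) x :=
      ((hasFDerivAt_id x).const_smul r).sub_const (p j)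
    have h2 : HasFDerivAt (χ j) _ x :=
      ((hb.differentiable (by simp)) (T j x)).hasFDerivAt.comp x h1
    rw [h2.fderiv]
    simp [d]
  have hint : ∀ (F : Space → ℝ) (j : Fin m), ∫ x, F (T j x) = (r ^ 3)⁻¹ * ∫ x, F x := by
    intro F j
    have h1 := Measure.integral_comp_smul (volume : Measure Space) (fun y => F (y - p j)) r
    rw [integral_sub_right_eq_self F (p j)] at h1
    simp only [finrank_euclideanSpace, Fintype.card_fin, smul_eq_mul] at h1
    rw [abs_of_pos (by positivity)] at h1
    exact h1
  have hdist : ∀ j k : Fin m, ∀ x, T j x ∈ tsupport (b : Space → ℝ) →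
      T k x ∈ tsupport (b : Space → ℝ) → j = k := by
    intro j k x hj hk
    rw [b.tsupport_eq, mem_closedBall_zero_iff] at hj hk
    by_contra hne
    have h1 : ‖p j - p k‖ ≤ 2 := by
      have : p j - p k = T k x - T j x := by simp only [T]; abel
      rw [this]
      refine (norm_sub_le _ _).trans ?_
      have : b.rOut = 1 := rfl
      linarith
    have h2 : p j - p k = EuclideanSpace.single 0 (3 * ((j : ℝ) - k)) := by
      ext l
      rcases eq_or_ne l 0 with rfl | hl
      · simp [p]; ring
      · simp [p, hl]
    rw [h2, PiLp.norm_single, Real.norm_eq_abs, abs_mul] at h1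
    have h3 : (1 : ℝ) ≤ |(j : ℝ) - k| := by
      have h4 : ((j : ℕ) : ℤ) - (k : ℕ) ≠ 0 := by
        intro h; exact hne (Fin.ext (by omega))
      have := Int.one_le_abs h4
      exact_mod_cast this
    norm_num at h1
    linarith
  have hdz : ∀ i y, y ∉ tsupport (b : Space → ℝ) → d i y = 0 := fun i y hy => by
    simp only [d]
    rw [image_eq_zero_of_notMem_tsupport (fun h => hy (tsupport_fderiv_subset ℝ h))]
    rfl
  -- Normalization: the two spin values contribute A / r³ each.
  set c : ℝ := √((r ^ 3) / (2 * A)) with hc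
  have hc2 : c * c = r ^ 3 / (2 * A) := Real.mul_self_sqrt (by positivity)
  let f₀ : Fin m → L2One := fun j => spinMul 1 (hχ j).continuous (hT j)
  let g₀ : Fin 3 → Fin m → L2One := fun i j => spinMul 1
    (continuous_fderiv_apply_of_contDiff (hχ j) (EuclideanSpace.single i 1))
      ((hT j).fderiv_apply ℝ _)
  refine ⟨fun j => (c : ℂ) • f₀ j, fun i j => (c : ℂ) • g₀ i j,
    fun i => r ^ 2 * D i / A, fun i j => ?_, fun j k => ?_, fun i j k => ?_, ?_⟩
  · exact HasWeakDeriv.smul isSlicing_spaceSpin _ (isWeakPartialOne_spinMul 1 (hχ j) (hT j) i)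
  · rw [inner_smul_left, inner_smul_right, inner_spinMul_spinMul, Complex.conj_ofReal]
    split_ifs with h
    · subst h
      have h1 : ∫ x, χ j x * χ j x = (r ^ 3)⁻¹ * A := hint (fun y => b y * b y) j
      rw [h1, ← Complex.ofReal_mul, ← Complex.ofReal_mul]
      congr 1
      rw [← mul_assoc, hc2]
      field_simp
    · have h1 : ∀ x, χ j x * χ k x = 0 := fun x => by
        by_contra h2
        exact h (hdist j k x (subset_tsupport _ (left_ne_zero_of_mul h2))
          (subset_tsupport _ (right_ne_zero_of_mul h2)))
      simp [h1]
  · rw [inner_smul_left, inner_smul_right, inner_spinMul_spinMul, Complex.conj_ofReal]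
    simp only [hdχ]
    split_ifs with h
    · subst h
      have h1 : ∫ x, r * d i (T j x) * (r * d i (T j x)) = r ^ 2 * ((r ^ 3)⁻¹ * D i) := by
        rw [← hint (fun y => d i y * d i y) j, ← integral_const_mul]
        congr 1; ext x; ring
      rw [h1, ← Complex.ofReal_mul, ← Complex.ofReal_mul]
      congr 1
      rw [← mul_assoc, hc2]
      field_simp
    · have h1 : ∀ x, r * d i (T j x) * (r * d i (T k x)) = 0 := fun x => by
        by_contra h2
        refine h (hdist j k x ?_ ?_)
        · by_contra h3; exact h2 (by rw [hdz i _ h3]; ring)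
        · by_contra h3; exact h2 (by rw [hdz i _ h3]; ring)
      simp [h1]
  · rw [← Finset.sum_div, ← Finset.mul_sum, mul_div_assoc, ← hS, hr2, div_mul_eq_mul_div,
      div_le_iff₀ (by positivity)]
    nlinarith

/-- There are orbitals of small kinetic energy orthogonal to given ones. -/
theorem exists_slow_orthogonal {k : ℕ} (φ : Fin k → L2One) {ε : ℝ} (hε : 0 < ε) :
    ∃ ψ ∈ sobolevOne, ‖ψ‖ = 1 ∧ (∀ i, ⟪φ i, ψ⟫_ℂ = 0) ∧ gradNormSq ψ ≤ ε := by
  obtain ⟨f, g, κ, hfg, hf, hg, hκ⟩ := exists_slow_family (k + 1) hε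
  -- One more slow orbital than there are orthogonality conditions, so some nontrivial combination
  -- satisfies all of them.
  let L : (Fin (k + 1) → ℂ) →ₗ[ℂ] (Fin k → ℂ) :=
    { toFun := fun c i => ∑ j, c j * ⟪φ i, f j⟫_ℂ
      map_add' := fun c d => by
        ext i; simp [add_mul, Finset.sum_add_distrib]
      map_smul' := fun a c => by
        ext i; simp [Finset.mul_sum, mul_assoc] }
  have hker : LinearMap.ker L ≠ ⊥ := LinearMap.ker_ne_bot_of_finrank_lt (by simp)
  obtain ⟨c, hc, hc0⟩ := Submodule.exists_mem_ne_zero_of_ne_bot hker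
  have hpos : 0 < ∑ j, ‖c j‖ ^ 2 := by
    obtain ⟨j, hj⟩ := Function.ne_iff.1 hc0
    refine Finset.sum_pos' (fun _ _ => by positivity) ⟨j, Finset.mem_univ j, ?_⟩
    have := norm_pos_iff.2 hj
    positivity
  set s : ℝ := (√(∑ j, ‖c j‖ ^ 2))⁻¹ with hs
  have hs2 : s ^ 2 * ∑ j, ‖c j‖ ^ 2 = 1 := by
    rw [hs, inv_pow, Real.sq_sqrt hpos.le, inv_mul_cancel₀ hpos.ne']
  -- The derivatives in each direction are orthogonal with equal norms, so every normalized
  -- combination is exactly as slow as the members of the family.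
  have hsum : ∀ (F : Fin (k + 1) → L2One) (M : ℝ),
      (∀ i j, ⟪F i, F j⟫_ℂ = if i = j then (M : ℂ) else 0) →
      ‖∑ j, ((s : ℂ) * c j) • F j‖ ^ 2 = M := by
    intro F M hF
    rw [sum_smul_inner_self _ hF]
    simp only [norm_mul, Complex.norm_real, mul_pow, Real.norm_eq_abs, sq_abs]
    rw [← Finset.mul_sum, hs2, mul_one]
  have hder : ∀ i, IsWeakPartialOne i (∑ j, ((s : ℂ) * c j) • f j)
      (∑ j, ((s : ℂ) * c j) • g i j) := fun i => IsWeakPartialOne.sum _ _ fun j _ => hfg i j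
  refine ⟨∑ j, ((s : ℂ) * c j) • f j, fun i => ⟨_, hder i⟩, ?_, fun i => ?_, ?_⟩
  · have := hsum f 1 hf
    exact (pow_eq_one_iff_of_nonneg (norm_nonneg _) two_ne_zero).1 this
  · have h1 : ∑ j, c j * ⟪φ i, f j⟫_ℂ = 0 := congrFun (LinearMap.mem_ker.1 hc) i
    simp only [inner_sum, inner_smul_right, mul_assoc]
    rw [← Finset.mul_sum, h1, mul_zero]
  · rw [gradNormSq]
    refine le_trans (le_of_eq (Finset.sum_congr rfl fun i _ => ?_)) hκ
    rw [(hder i).partialOne_eq]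
    exact hsum (g i) (κ i) (hg i)

end Smooth

/-! ### From occupation numbers to Slater determinants -/

theorem slaterEnergy_cons (Z : ℝ) {k : ℕ} (ψ : L2One) (φ : Fin k → L2One) :
    slaterEnergy Z (Fin.cons ψ φ : Fin (k + 1) → L2One)
      = slaterEnergy Z φ + orbitalEnergy Z ψ + ∑ i, pairEnergy (φ i) ψ := by
  have h : ∀ i, pairEnergy ψ (φ i) = pairEnergy (φ i) ψ := fun i => pairEnergy_comm _ _
  simp only [slaterEnergy, Fin.sum_univ_succ, Fin.cons_zero, Fin.cons_succ, pairEnergy_self, h,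
    Finset.sum_add_distrib]
  ring

/-- Adding an orbital of small kinetic energy almost does not increase the energy. -/
theorem exists_slaterEnergy_succ_le {Z : ℝ} (hZ : 0 ≤ Z) {k : ℕ} {φ : Fin k → L2One}
    (ho : Orthonormal ℂ φ) (hφ : ∀ j, φ j ∈ sobolevOne) {ε : ℝ} (hε : 0 < ε) :
    ∃ φ' : Fin (k + 1) → L2One, Orthonormal ℂ φ' ∧ (∀ j, φ' j ∈ sobolevOne) ∧
      slaterEnergy Z φ' ≤ slaterEnergy Z φ + ε := by
  -- An orbital with ‖∇ψ‖² ≤ δ² has orbital energy at most δ, as the attraction only helps, and pair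
  -- energy at most 2 δ with each of the k others, by Hardy's inequality with t = 1/δ. The total is
  -- δ (1 + 2 k) ≤ ε.
  set δ : ℝ := min 1 (ε / (1 + 2 * k)) with hδ
  have hδ0 : 0 < δ := lt_min one_pos (by positivity)
  have hδ1 : δ ≤ 1 := min_le_left _ _
  have hδε : δ * (1 + 2 * k) ≤ ε := by
    rw [← le_div_iff₀ (by positivity)]; exact min_le_right _ _
  obtain ⟨ψ, hψ, hψ1, hψφ, hψg⟩ := exists_slow_orthogonal φ (pow_pos hδ0 2)
  refine ⟨Fin.cons ψ φ, ⟨?_, ?_⟩, ?_, ?_⟩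
  · intro i
    refine Fin.cases ?_ (fun j => ?_) i
    · simpa using hψ1
    · simpa using ho.1 j
  · intro i j
    refine Fin.cases ?_ (fun i => ?_) i <;> refine Fin.cases ?_ (fun j => ?_) j
    · simp
    · intro _; simpa using inner_eq_zero_symm.1 (hψφ j)
    · intro _; simpa using hψφ i
    · intro h; simpa using ho.2 (fun h' => h (by rw [h']))
  · intro i
    refine Fin.cases ?_ (fun j => ?_) i
    · simpa using hψ
    · simpa using hφ j
  rw [slaterEnergy_cons, add_assoc]
  gcongr
  have h1 : orbitalEnergy Z ψ ≤ δ := by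
    rw [orbitalEnergy]
    have h2 : 0 ≤ ∫ x, ‖ψ x‖ ^ 2 / ‖x.1‖ ∂spaceSpinMeasure :=
      integral_nonneg fun x => by positivity
    nlinarith [mul_nonneg hZ h2]
  have h2 : ∀ i ∈ Finset.univ, pairEnergy (φ i) ψ ≤ 2 * δ := fun i _ => by
    refine (pairEnergy_le (hφ i) hψ (inv_pos.2 hδ0)).trans ?_
    rw [ho.1 i, hψ1, inv_inv]
    have : δ⁻¹ * gradNormSq ψ ≤ δ := by
      rw [inv_mul_le_iff₀ hδ0]; nlinarith
    linarith
  have h3 := Finset.sum_le_card_nsmul _ _ _ h2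
  rw [Finset.card_univ, Fintype.card_fin, nsmul_eq_mul] at h3
  linarith

/-- The ground-state energy of `N` electrons is at most the energy of `k ≤ N` orbitals. -/
theorem groundStateEnergy_le_slaterEnergy_of_le {Z : ℝ} (hZ : 0 ≤ Z) {N k : ℕ} (hk : k ≤ N)
    {φ : Fin k → L2One} (ho : Orthonormal ℂ φ) (hφ : ∀ j, φ j ∈ sobolevOne) :
    groundStateEnergy Z N ≤ slaterEnergy Z φ := by
  obtain ⟨d, rfl⟩ := Nat.exists_eq_add_of_le hk
  induction d generalizing k with
  | zero => exact groundStateEnergy_le_slaterEnergy hZ ho hφ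
  | succ d ih =>
    -- The additional electron is moved off to infinity: its cost tends to 0 but need not be
    -- attained, hence the ε.
    refine le_of_forall_pos_le_add fun ε hε => ?_
    obtain ⟨φ', ho', hφ', h⟩ := exists_slaterEnergy_succ_le hZ ho hφ hε
    refine le_trans ?_ h
    have := ih ho' hφ' (Nat.le_add_right _ _)
    rwa [show k + 1 + d = k + (d + 1) by ring] at this

theorem groundStateEnergy_le_slaterEnergy_subset {Z : ℝ} (hZ : 0 ≤ Z) {N : ℕ} {ι : Type*}
    {φ : ι → L2One} {S : Finset ι} (hS : S.card ≤ N) (ho : Orthonormal ℂ φ)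
    (hφ : ∀ j ∈ S, φ j ∈ sobolevOne) :
    groundStateEnergy Z N
      ≤ ∑ i ∈ S, orbitalEnergy Z (φ i)
        + (1 / 2) * ∑ i ∈ S, ∑ j ∈ S, pairEnergy (φ i) (φ j) := by
  have h := groundStateEnergy_le_slaterEnergy_of_le hZ hS
    (φ := fun i => φ (S.equivFin.symm i))
    (ho.comp _ (Subtype.val_injective.comp S.equivFin.symm.injective)) fun j => hφ _ (by simp)
  refine h.trans (le_of_eq ?_)
  have hsum : ∀ f : ι → ℝ, ∑ i, f (S.equivFin.symm i) = ∑ i ∈ S, f i := fun f => by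
    rw [Equiv.sum_comp S.equivFin.symm fun i => f i, Finset.sum_coe_sort]
  rw [slaterEnergy, hsum fun i => orbitalEnergy Z (φ i)]
  congr 2
  rw [← hsum fun i => ∑ j ∈ S, pairEnergy (φ i) (φ j)]
  exact Finset.sum_congr rfl fun i _ => hsum fun j => pairEnergy _ (φ j)

/-! ### Removing fractional occupation numbers. -/

section Occupation

variable {ι : Type*} [Fintype ι]

/-- The energy with occupation numbers `lam`. -/
noncomputable def occupationEnergy (h : ι → ℝ) (W : ι → ι → ℝ) (lam : ι → ℝ) : ℝ :=
  ∑ i, lam i * h i + (1 / 2) * ∑ i, ∑ j, lam i * lam j * W i j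

theorem occupationEnergy_add_smul {W : ι → ι → ℝ} (hW : ∀ i j, W i j = W j i) (h : ι → ℝ)
    (lam μ : ι → ℝ) (t : ℝ) :
    occupationEnergy h W (fun i => lam i + t * μ i) = occupationEnergy h W lam
      + t * (∑ i, μ i * h i + ∑ i, ∑ j, lam i * μ j * W i j)
      + t ^ 2 * ((1 / 2) * ∑ i, ∑ j, μ i * μ j * W i j) := by
  have h1 : ∑ i, ∑ j, μ i * lam j * W i j = ∑ i, ∑ j, lam i * μ j * W i j := by
    rw [Finset.sum_comm]
    refine Finset.sum_congr rfl fun i _ => Finset.sum_congr rfl fun j _ => ?_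
    rw [hW]; ring
  have h2 : ∑ i, ∑ j, (lam i + t * μ i) * (lam j + t * μ j) * W i j
      = ∑ i, ∑ j, lam i * lam j * W i j + t * (∑ i, ∑ j, lam i * μ j * W i j)
        + t * (∑ i, ∑ j, μ i * lam j * W i j) + t ^ 2 * ∑ i, ∑ j, μ i * μ j * W i j := by
    simp only [Finset.mul_sum, ← Finset.sum_add_distrib]
    refine Finset.sum_congr rfl fun i _ => Finset.sum_congr rfl fun j _ => ?_
    ring
  have h3 : ∑ i, (lam i + t * μ i) * h i = ∑ i, lam i * h i + t * ∑ i, μ i * h i := by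
    simp only [Finset.mul_sum, ← Finset.sum_add_distrib]
    refine Finset.sum_congr rfl fun i _ => ?_
    ring
  rw [occupationEnergy, occupationEnergy, h2, h3, h1]
  ring

/-- A function `c + t a + t² b` with `b ≤ 0` decreases in one of the directions `t > 0`, `t < 0`. -/
theorem exists_sign_decreasing (a : ℝ) {b : ℝ} (hb : b ≤ 0) :
    ∃ s : ℝ, (s = 1 ∨ s = -1) ∧ ∀ t : ℝ, 0 ≤ t → s * t * a + (s * t) ^ 2 * b ≤ 0 := by
  rcases le_total a 0 with ha | ha
  · refine ⟨1, Or.inl rfl, fun t ht => ?_⟩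
    nlinarith [mul_nonneg ht (neg_nonneg.2 ha), mul_nonneg (sq_nonneg t) (neg_nonneg.2 hb)]
  · refine ⟨-1, Or.inr rfl, fun t ht => ?_⟩
    nlinarith [mul_nonneg ht ha, mul_nonneg (sq_nonneg t) (neg_nonneg.2 hb)]

/-- The indices with occupation number different from `0` and `1`. -/
noncomputable def fractional (lam : ι → ℝ) : Finset ι :=
  Finset.univ.filter fun i => lam i ≠ 0 ∧ lam i ≠ 1

theorem mem_fractional {lam : ι → ℝ} {i : ι} : i ∈ fractional lam ↔ lam i ≠ 0 ∧ lam i ≠ 1 := by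
  simp [fractional]

theorem occupationEnergy_eq_of_fractional_eq_empty (h : ι → ℝ) (W : ι → ι → ℝ) {lam : ι → ℝ}
    (hf : fractional lam = ∅) {N : ℕ} (hN : ∑ i, lam i ≤ N) :
    ∃ S : Finset ι, S.card ≤ N ∧ occupationEnergy h W lam
      = ∑ i ∈ S, h i + (1 / 2) * ∑ i ∈ S, ∑ j ∈ S, W i j := by
  classical
  have h01 : ∀ i, lam i = if lam i = 1 then 1 else 0 := fun i => by
    split_ifs with h1
    · exact h1
    · by_contra h0
      have : i ∈ fractional lam := mem_fractional.2 ⟨h0, h1⟩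
      simp [hf] at this
  have hsum : ∀ f : ι → ℝ, ∑ i, lam i * f i = ∑ i ∈ Finset.univ.filter fun i => lam i = 1, f i :=
    fun f => by
      rw [Finset.sum_filter]
      refine Finset.sum_congr rfl fun i _ => ?_
      conv_lhs => rw [h01 i]
      split_ifs <;> simp
  refine ⟨Finset.univ.filter fun i => lam i = 1, ?_, ?_⟩
  · have := hsum fun _ => 1
    simp only [mul_one, Finset.sum_const, nsmul_eq_mul] at this
    rw [this] at hN
    exact_mod_cast hN
  · rw [occupationEnergy, hsum, ← hsum fun i => ∑ j ∈ Finset.univ.filter fun i => lam i = 1, W i j]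
    congr 2
    refine Finset.sum_congr rfl fun i _ => ?_
    rw [← hsum, Finset.mul_sum]
    exact Finset.sum_congr rfl fun j _ => mul_assoc _ _ _

/-- With two fractional occupation numbers, charge is shifted between them in the direction in which
the concave energy does not increase, until one of them reaches 0 or 1. A single fractional one is
moved to 0 or 1 along an affine function. -/
theorem exists_fractional_card_lt {W : ι → ι → ℝ} (hW : ∀ i j, W i j = W j i)
    (hW0 : ∀ i j, 0 ≤ W i j) (hWi : ∀ i, W i i = 0) (h : ι → ℝ) {lam : ι → ℝ}
    (h0 : ∀ i, 0 ≤ lam i) (h1 : ∀ i, lam i ≤ 1) {N : ℕ} (hN : ∑ i, lam i ≤ N)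
    (hf : (fractional lam).Nonempty) :
    ∃ lam' : ι → ℝ, (∀ i, 0 ≤ lam' i) ∧ (∀ i, lam' i ≤ 1) ∧ ∑ i, lam' i ≤ N ∧
      (fractional lam').card < (fractional lam).card ∧
      occupationEnergy h W lam' ≤ occupationEnergy h W lam := by
  classical
  obtain ⟨i, hi⟩ := hf
  obtain ⟨hi0, hi1⟩ := mem_fractional.1 hi
  by_cases hj : ∃ j ∈ fractional lam, j ≠ i
  · obtain ⟨j, hj, hji⟩ := hj
    have hdir : ∃ p ∈ fractional lam, ∃ q ∈ fractional lam, p ≠ q ∧ ∀ t : ℝ, 0 ≤ t →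
        occupationEnergy h W (fun k => lam k + t * ((Pi.single p 1 - Pi.single q 1 : ι → ℝ) k))
          ≤ occupationEnergy h W lam := by
      -- The coefficient of t² along the shift from q to p. The diagonal terms W p p and W q q
      -- vanish, so it is nonpositive; this is where the absence of self-interaction is decisive.
      have hb : ∀ p q : ι, (1 / 2) * ∑ k, ∑ l, (Pi.single p 1 - Pi.single q 1 : ι → ℝ) k
          * (Pi.single p 1 - Pi.single q 1 : ι → ℝ) l * W k l = - W p q := fun p q => by
        simp only [Pi.sub_apply, Pi.single_apply, sub_mul, mul_sub, ite_mul, mul_ite, one_mul,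
          mul_one, zero_mul, mul_zero, Finset.sum_sub_distrib, Finset.sum_ite_eq',
          Finset.mem_univ, if_true, hWi]
        rw [hW q p]; ring
      obtain ⟨s, hs, hdec⟩ := exists_sign_decreasing
        (∑ k, (Pi.single i 1 - Pi.single j 1 : ι → ℝ) k * h k
          + ∑ k, ∑ l, lam k * (Pi.single i 1 - Pi.single j 1 : ι → ℝ) l * W k l)
        (neg_nonpos.2 (hW0 i j))
      have hen := occupationEnergy_add_smul hW h lam (Pi.single i 1 - Pi.single j 1)
      simp only [hb i j] at hen
      rcases hs with rfl | rfl
      · refine ⟨i, hi, j, hj, hji.symm, fun t ht => ?_⟩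
        rw [hen]
        have := hdec t ht
        rw [one_mul] at this
        linarith
      · refine ⟨j, hj, i, hi, hji, fun t ht => ?_⟩
        have h2 : (fun k => lam k + t * ((Pi.single j 1 - Pi.single i 1 : ι → ℝ) k))
            = fun k => lam k + (-t) * ((Pi.single i 1 - Pi.single j 1 : ι → ℝ) k) := by
          ext k; simp only [Pi.sub_apply]; ring
        rw [h2, hen]
        have := hdec t ht
        rw [neg_one_mul] at this
        linarith
    obtain ⟨p, hp, q, hq, hpq, hdec⟩ := hdir
    -- The largest shift that keeps both numbers in [0, 1]; at this value p becomes full or q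
    -- becomes empty, and the total is unchanged.
    have ht : 0 ≤ min (1 - lam p) (lam q) := le_min (sub_nonneg.2 (h1 p)) (h0 q)
    have hvp : lam p + min (1 - lam p) (lam q) * (Pi.single p 1 - Pi.single q 1 : ι → ℝ) p
        = lam p + min (1 - lam p) (lam q) := by simp [hpq]
    have hvq : lam q + min (1 - lam p) (lam q) * (Pi.single p 1 - Pi.single q 1 : ι → ℝ) q
        = lam q - min (1 - lam p) (lam q) := by simp [hpq.symm]; ring
    have hvk : ∀ k, k ≠ p → k ≠ q → lam k + min (1 - lam p) (lam q)
        * (Pi.single p 1 - Pi.single q 1 : ι → ℝ) k = lam k := fun k hk hk' => by simp [hk, hk']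
    have hm1 := min_le_left (1 - lam p) (lam q)
    have hm2 := min_le_right (1 - lam p) (lam q)
    refine ⟨_, fun k => ?_, fun k => ?_, ?_, ?_, hdec _ ht⟩
    · by_cases hkp : k = p
      · subst hkp; rw [hvp]; linarith [h0 k]
      by_cases hkq : k = q
      · subst hkq; rw [hvq]; linarith
      rw [hvk k hkp hkq]; exact h0 k
    · by_cases hkp : k = p
      · subst hkp; rw [hvp]; linarith
      by_cases hkq : k = q
      · subst hkq; rw [hvq]; linarith [h1 k]
      rw [hvk k hkp hkq]; exact h1 k
    · rw [Finset.sum_add_distrib, ← Finset.mul_sum]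
      simpa using hN
    · refine Finset.card_lt_card ((Finset.ssubset_iff_of_subset fun k hk => ?_).2 ?_)
      · by_cases hkp : k = p
        · exact hkp ▸ hp
        by_cases hkq : k = q
        · exact hkq ▸ hq
        rw [mem_fractional, hvk k hkp hkq] at hk
        exact mem_fractional.2 hk
      · rcases min_choice (1 - lam p) (lam q) with hm | hm
        · refine ⟨p, hp, fun hp' => (mem_fractional.1 hp').2 ?_⟩
          rw [hvp, hm]; ring
        · refine ⟨q, hq, fun hq' => (mem_fractional.1 hq').1 ?_⟩
          rw [hvq, hm]; ring
  -- Only i is fractional. As W i i = 0, the energy is affine in its occupation number.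
  · push Not at hj
    have hen := occupationEnergy_add_smul hW h lam (Pi.single i 1)
    have hb : (1 / 2) * ∑ k, ∑ l, (Pi.single i 1 : ι → ℝ) k
        * (Pi.single i 1 : ι → ℝ) l * W k l = 0 := by
      simp [Pi.single_apply, hWi]
    simp only [hb] at hen
    obtain ⟨s, hs, hdec⟩ := exists_sign_decreasing
      (∑ k, (Pi.single i 1 : ι → ℝ) k * h k
          + ∑ k, ∑ l, lam k * (Pi.single i 1 : ι → ℝ) l * W k l) le_rfl
    have hex : ∃ t : ℝ, (lam i + t = 0 ∨ lam i + t = 1) ∧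
        occupationEnergy h W (fun k => lam k + t * (Pi.single i 1 : ι → ℝ) k)
          ≤ occupationEnergy h W lam := by
      rcases hs with rfl | rfl
      · refine ⟨1 - lam i, Or.inr (by ring), ?_⟩
        rw [hen]
        have := hdec (1 - lam i) (sub_nonneg.2 (h1 i))
        rw [one_mul] at this
        linarith
      · refine ⟨-lam i, Or.inl (by ring), ?_⟩
        rw [hen]
        have := hdec (lam i) (h0 i)
        rw [neg_one_mul] at this
        linarith
    obtain ⟨t, ht, hle⟩ := hex
    have hvi : lam i + t * (Pi.single i 1 : ι → ℝ) i = lam i + t := by simp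
    have hvk : ∀ k, k ≠ i → lam k + t * (Pi.single i 1 : ι → ℝ) k = lam k :=
      fun k hk => by simp [hk]
    refine ⟨_, fun k => ?_, fun k => ?_, ?_, ?_, hle⟩
    · by_cases hk : k = i
      · subst hk; rw [hvi]; rcases ht with ht | ht <;> rw [ht]; exact zero_le_one
      rw [hvk k hk]; exact h0 k
    · by_cases hk : k = i
      · subst hk; rw [hvi]; rcases ht with ht | ht <;> rw [ht]; exact zero_le_one
      rw [hvk k hk]; exact h1 k
    -- Only here does the total change. All other numbers are 0 or 1, so their sum is an integer;
    -- being less than N because lam i > 0, it is at most N - 1, which leaves room to fill i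
    -- completely.
    · have hrest : ∑ k ∈ Finset.univ.erase i, lam k
          = ((Finset.univ.erase i).filter fun k => lam k = 1).card := by
        rw [Finset.card_filter, Nat.cast_sum]
        refine Finset.sum_congr rfl fun k hk => ?_
        by_cases hk1 : lam k = 1
        · simp [hk1]
        · have : lam k = 0 := by
            by_contra hk0
            exact (Finset.ne_of_mem_erase hk) (hj k (mem_fractional.2 ⟨hk0, hk1⟩))
          simp [this]
      have hrest' : ∑ k ∈ Finset.univ.erase i, (lam k + t * (Pi.single i 1 : ι → ℝ) k)
          = ∑ k ∈ Finset.univ.erase i, lam k :=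
        Finset.sum_congr rfl fun k hk => hvk k (Finset.ne_of_mem_erase hk)
      rw [← Finset.add_sum_erase _ _ (Finset.mem_univ i), hrest] at hN
      have hipos : 0 < lam i := lt_of_le_of_ne (h0 i) (Ne.symm hi0)
      have hlt : ((Finset.univ.erase i).filter fun k => lam k = 1).card + 1 ≤ N := by
        have : (((Finset.univ.erase i).filter fun k => lam k = 1).card : ℝ) < N := by linarith
        exact_mod_cast this
      have hlt' : (((Finset.univ.erase i).filter fun k => lam k = 1).card : ℝ) + 1 ≤ N := by
        exact_mod_cast hlt
      rw [← Finset.add_sum_erase _ _ (Finset.mem_univ i), hrest', hrest, hvi]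
      rcases ht with ht | ht <;> rw [ht] <;> linarith
    · refine Finset.card_lt_card ((Finset.ssubset_iff_of_subset fun k hk => ?_).2
        ⟨i, hi, fun hi' => ?_⟩)
      · by_cases hki : k = i
        · exact hki ▸ hi
        rw [mem_fractional, hvk k hki] at hk
        exact mem_fractional.2 hk
      · rw [mem_fractional, hvi] at hi'
        rcases ht with ht | ht
        · exact hi'.1 ht
        · exact hi'.2 ht

theorem exists_finset_le_occupationEnergy {W : ι → ι → ℝ} (hW : ∀ i j, W i j = W j i)
    (hW0 : ∀ i j, 0 ≤ W i j) (hWi : ∀ i, W i i = 0) (h : ι → ℝ) {lam : ι → ℝ}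
    (h0 : ∀ i, 0 ≤ lam i) (h1 : ∀ i, lam i ≤ 1) {N : ℕ} (hN : ∑ i, lam i ≤ N) :
    ∃ S : Finset ι, S.card ≤ N ∧ ∑ i ∈ S, h i + (1 / 2) * ∑ i ∈ S, ∑ j ∈ S, W i j
      ≤ occupationEnergy h W lam := by
  induction hc : (fractional lam).card using Nat.strong_induction_on generalizing lam with
  | _ n ih =>
    rcases (fractional lam).eq_empty_or_nonempty with hf | hf
    · obtain ⟨S, hS, he⟩ := occupationEnergy_eq_of_fractional_eq_empty h W hf hN
      exact ⟨S, hS, he.ge⟩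
    · obtain ⟨lam', h0', h1', hN', hlt, hle⟩ := exists_fractional_card_lt hW hW0 hWi h h0 h1 hN hf
      obtain ⟨S, hS, he⟩ := ih _ (hc ▸ hlt) h0' h1' hN' rfl
      exact ⟨S, hS, he.trans hle⟩

end Occupation

/-- The ground-state energy is at most the energy of a Hartree-Fock state of finite rank, where
only the pair energies of distinct orbitals enter. -/
theorem groundStateEnergy_le_occupationEnergy {Z : ℝ} (hZ : 0 ≤ Z) {N : ℕ} {ι : Type*} [Fintype ι]
    {φ : ι → L2One} (ho : Orthonormal ℂ φ) {lam : ι → ℝ}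
    (hφ : ∀ j, lam j ≠ 0 → φ j ∈ sobolevOne) (h0 : ∀ i, 0 ≤ lam i) (h1 : ∀ i, lam i ≤ 1)
    (hN : ∑ i, lam i ≤ N) :
    groundStateEnergy Z N ≤ occupationEnergy (fun i => orbitalEnergy Z (φ i))
      (fun i j => pairEnergy (φ i) (φ j)) lam := by
  classical
  -- Orbitals with occupation number 0 are discarded beforehand, since they need not belong to H¹
  -- and could otherwise be filled.
  have key : ∀ f : ι → ℝ, ∑ i : {i // lam i ≠ 0}, lam i * f i = ∑ i, lam i * f i := fun f => by
    rw [← Finset.sum_subtype (Finset.univ.filter fun i => lam i ≠ 0) (by simp)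
      fun i => lam i * f i]
    refine Finset.sum_filter_of_ne fun i _ hi => left_ne_zero_of_mul hi
  obtain ⟨S, hS, hle⟩ := exists_finset_le_occupationEnergy
    (W := fun i j : {i // lam i ≠ 0} => pairEnergy (φ i) (φ j))
    (fun _ _ => pairEnergy_comm _ _) (fun _ _ => pairEnergy_nonneg _ _) (fun _ => pairEnergy_self _)
    (fun i => orbitalEnergy Z (φ i)) (lam := fun i => lam i) (fun i => h0 i) (fun i => h1 i)
    (N := N) (by simpa using (key fun _ => 1).trans_le (by simpa using hN))
  refine (groundStateEnergy_le_slaterEnergy_subset hZ hS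
    (ho.comp _ Subtype.val_injective) fun j _ => hφ j j.2).trans (hle.trans (le_of_eq ?_))
  simp only [occupationEnergy, mul_assoc, ← Finset.mul_sum]
  rw [key fun i => orbitalEnergy Z (φ i)]
  congr 2
  rw [← key fun i => ∑ j, lam j * pairEnergy (φ i) (φ j)]
  exact Finset.sum_congr rfl fun i _ => by rw [key fun j => pairEnergy (φ i) (φ j)]

/-! ### Orthonormal bases -/

section Hilbert

universe u

variable {H : Type u} [NormedAddCommGroup H] [InnerProductSpace ℂ H]

theorem HilbertBasis.hasSum_norm_sq {ι : Type*} (e : HilbertBasis ι ℂ H) (x : H) :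
    HasSum (fun i => ‖⟪e i, x⟫_ℂ‖ ^ 2) (‖x‖ ^ 2) := by
  have h := e.hasSum_inner_mul_inner x x
  rw [inner_self_eq_ofReal] at h
  rw [← Complex.hasSum_ofReal]
  refine h.congr_fun ?_
  intro i
  rw [← inner_conj_symm x (e i), Complex.conj_mul']
  push_cast
  rfl

theorem sum_norm_inner_mul_norm_inner_le {ι : Type*} {e : ι → H} (he : Orthonormal ℂ e)
    (x y : H) (s : Finset ι) : ∑ i ∈ s, ‖⟪e i, x⟫_ℂ‖ * ‖⟪e i, y⟫_ℂ‖ ≤ ‖x‖ * ‖y‖ := by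
  refine (Real.sum_mul_le_sqrt_mul_sqrt s _ _).trans ?_
  gcongr
  · exact Real.sqrt_le_iff.2 ⟨norm_nonneg _, he.sum_inner_products_le x⟩
  · exact Real.sqrt_le_iff.2 ⟨norm_nonneg _, he.sum_inner_products_le y⟩

theorem HilbertBasis.eq_zero {ι : Type*} (e : HilbertBasis ι ℂ H) {x : H}
    (h : ∀ i, ⟪e i, x⟫_ℂ = 0) : x = 0 := by
  have h1 := e.hasSum_repr x
  simp only [e.repr_apply_apply, h, zero_smul] at h1
  exact h1.unique hasSum_zero

variable [CompleteSpace H]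

theorem HilbertBasis.exists_reindex {ι κ : Type*} (e : HilbertBasis ι ℂ H) (σ : κ ≃ ι) :
    ∃ e' : HilbertBasis κ ℂ H, ∀ k, e' k = e (σ k) := by
  have hs : ⊤ ≤ (Submodule.span ℂ (Set.range (e ∘ σ))).topologicalClosure := by
    rw [σ.surjective.range_comp, e.dense_span]
  exact ⟨HilbertBasis.mk (e.orthonormal.comp σ σ.injective) hs, fun k => by simp⟩

theorem HilbertBasis.exists_range {ι : Type*} (e : HilbertBasis ι ℂ H) :
    ∃ e' : HilbertBasis (Set.range e) ℂ H, ∀ i, e' (Set.rangeFactorization e i) = e i := by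
  have hs : ⊤ ≤ (Submodule.span ℂ (Set.range ((↑) : Set.range e → H))).topologicalClosure := by
    rw [Subtype.range_coe, e.dense_span]
  exact ⟨HilbertBasis.mk e.orthonormal.toSubtypeRange hs, fun i => by simp⟩

/-- The definition speaks of bases indexed by subsets of `H`; an arbitrary basis is indexed by its
range instead. -/
theorem IsTraceClass.summable {T : H →L[ℂ] H} (hT : IsTraceClass T) {ι : Type*}
    (e : HilbertBasis ι ℂ H) : Summable fun n => (⟪e n, CFC.abs T (e n)⟫_ℂ).re := by
  obtain ⟨e', he'⟩ := HilbertBasis.exists_range e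
  have hinj : Function.Injective (Set.rangeFactorization e) := fun i j h =>
    e.orthonormal.linearIndependent.injective (congrArg Subtype.val h)
  refine ((hT _ e').comp_injective hinj).congr fun i => ?_
  simp only [Function.comp_apply, he']

/-! ### Positive operators with finite trace -/

theorem norm_sqrt_apply_sq {A : H →L[ℂ] H} (hA : 0 ≤ A) (x : H) :
    ‖CFC.sqrt A x‖ ^ 2 = (⟪x, A x⟫_ℂ).re := by
  have h1 : IsSelfAdjoint (CFC.sqrt A) := (CFC.sqrt_nonneg A).isSelfAdjoint
  have h2 : A x = CFC.sqrt A (CFC.sqrt A x) := by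
    rw [← mul_apply_eq_comp, CFC.sqrt_mul_sqrt_self A hA]
  have h3 : ⟪CFC.sqrt A x, CFC.sqrt A x⟫_ℂ = ⟪x, CFC.sqrt A (CFC.sqrt A x)⟫_ℂ :=
    h1.isSymmetric x (CFC.sqrt A x)
  rw [h2, ← h3, inner_self_eq_ofReal, Complex.ofReal_re]

/-- A selfadjoint Hilbert-Schmidt operator is compact. -/
theorem isCompactOperator_of_summable {B : H →L[ℂ] H} (hB : IsSelfAdjoint B) {ι : Type*}
    (e : HilbertBasis ι ℂ H) (hs : Summable fun n => ‖B (e n)‖ ^ 2) : IsCompactOperator B := by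
  let R : ι → H →L[ℂ] H := fun n =>
    ContinuousLinearMap.toSpanSingleton ℂ (e n) ∘L (innerSL ℂ (e n) ∘L B)
  have hR : ∀ n x, R n x = ⟪e n, B x⟫_ℂ • e n := fun n x => by simp [R]
  have hRc : ∀ n, IsCompactOperator (R n) := fun n => by
    have h1 : IsCompactOperator (innerSL ℂ (e n) ∘L B) :=
      isCompactOperator_of_locallyCompactSpace_dom _
    exact h1.clm_comp (ContinuousLinearMap.toSpanSingleton ℂ (e n))
  refine isCompactOperator_of_tendsto (l := Filter.atTop) (F := fun F : Finset ι => ∑ n ∈ F, R n)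
    ?_ (Filter.Eventually.of_forall fun F =>
      (compactOperator (RingHom.id ℂ) H H).sum_mem fun n _ => hRc n)
  have htail : Filter.Tendsto (fun F : Finset ι => ∑' n : {n // n ∉ F}, ‖B (e n)‖ ^ 2)
      Filter.atTop (nhds 0) := tendsto_tsum_compl_atTop_zero fun n => ‖B (e n)‖ ^ 2
  rw [tendsto_iff_norm_sub_tendsto_zero]
  have hsq : Filter.Tendsto (fun F : Finset ι => √(∑' n : {n // n ∉ F}, ‖B (e n)‖ ^ 2))
      Filter.atTop (nhds 0) := by
    simpa using htail.sqrt
  refine squeeze_zero (fun _ => norm_nonneg _) (fun F => ?_) hsq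
  refine ContinuousLinearMap.opNorm_le_bound _ (Real.sqrt_nonneg _) fun y => ?_
  rw [← norm_neg, ← neg_apply, neg_sub]
  classical
  have h1 : ∀ i, ⟪e i, (B - ∑ n ∈ F, R n) y⟫_ℂ = if i ∈ F then 0 else ⟪e i, B y⟫_ℂ := fun i => by
    rw [sub_apply, sum_apply, inner_sub_right, inner_sum]
    simp only [hR, inner_smul_right, orthonormal_iff_ite.1 e.orthonormal]
    split_ifs with hi <;> simp [hi]
  have h2 := HilbertBasis.hasSum_norm_sq e ((B - ∑ n ∈ F, R n) y)
  have h3 : HasSum (fun i => Set.indicator {n | n ∉ F} (fun n => ‖B (e n)‖ ^ 2) i * ‖y‖ ^ 2)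
      ((∑' n : {n // n ∉ F}, ‖B (e n)‖ ^ 2) * ‖y‖ ^ 2) :=
    (hasSum_subtype_iff_indicator.1 (hs.subtype {n | n ∉ F}).hasSum).mul_right _
  -- The partial sums of `R` project the range of `B` onto finitely many basis vectors. By
  -- selfadjointness the remaining coefficients are ⟪B eᵢ, y⟫, so the operator norm of the remainder
  -- is bounded by the Hilbert-Schmidt tail.
  have h4 : ‖(B - ∑ n ∈ F, R n) y‖ ^ 2 ≤ (∑' n : {n // n ∉ F}, ‖B (e n)‖ ^ 2) * ‖y‖ ^ 2 := by
    refine hasSum_le (fun i => ?_) h2 h3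
    rw [h1]
    by_cases hi : i ∈ F
    · simp [hi]
    · have h5 : ⟪B (e i), y⟫_ℂ = ⟪e i, B y⟫_ℂ := hB.isSymmetric (e i) y
      have h6 := norm_inner_le_norm (𝕜 := ℂ) (B (e i)) y
      simp only [hi, if_false, ← h5, Set.indicator, Set.mem_ofPred_eq, not_false_eq_true, if_true]
      rw [← mul_pow]
      gcongr
  rw [← Real.sqrt_sq (norm_nonneg y), ← Real.sqrt_mul (tsum_nonneg fun _ => by positivity)]
  exact Real.le_sqrt_of_sq_le h4

/-- The square root of |T| is Hilbert-Schmidt, since ‖|T|^(1/2) eₙ‖² = ⟪eₙ, |T| eₙ⟫; hence it is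
compact, and so is its square. -/
theorem IsTraceClass.isCompactOperator_abs {T : H →L[ℂ] H} (hT : IsTraceClass T) :
    IsCompactOperator (CFC.abs T : H →L[ℂ] H) := by
  have h0 := CFC.abs_nonneg T
  have h1 : IsCompactOperator (CFC.sqrt (CFC.abs T) : H →L[ℂ] H) :=
    isCompactOperator_of_summable (CFC.sqrt_nonneg _).isSelfAdjoint (someHilbertBasis H)
      ((hT.summable (someHilbertBasis H)).congr fun n => (norm_sqrt_apply_sq h0 _).symm)
  have h2 := h1.clm_comp (CFC.sqrt (CFC.abs T) : H →L[ℂ] H)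
  have h3 : ⇑(CFC.sqrt (CFC.abs T) : H →L[ℂ] H) ∘ ⇑(CFC.sqrt (CFC.abs T) : H →L[ℂ] H)
      = ⇑(CFC.abs T : H →L[ℂ] H) := by
    ext x
    rw [Function.comp_apply, ← mul_apply_eq_comp, CFC.sqrt_mul_sqrt_self _ h0]
  rwa [h3] at h2

theorem IsTraceClass.isCompactOperator {T : H →L[ℂ] H} (hT : IsTraceClass T) (h0 : 0 ≤ T) :
    IsCompactOperator T := by
  have h1 := hT.isCompactOperator_abs
  rwa [CFC.abs_of_nonneg T h0] at h1

/-- The spectral theorem for compact positive operators. -/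
theorem exists_hilbertBasis_eigenvectors {A : H →L[ℂ] H} (hA : 0 ≤ A) (hc : IsCompactOperator A) :
    ∃ (ι : Type u) (e : HilbertBasis ι ℂ H) (μ : ι → ℝ), ∀ i, A (e i) = (μ i : ℂ) • e i := by
  have hsym : A.IsSymmetric := (ContinuousLinearMap.nonneg_iff_isPositive A).1 hA |>.isSymmetric
  let E : ℂ → Submodule ℂ H := Module.End.eigenspace (A : Module.End ℂ H)
  have hcl : ∀ μ, CompleteSpace (E μ) := fun μ => by
    have : IsClosed ((E μ : Submodule ℂ H) : Set H) := by
      have h1 : ((E μ : Submodule ℂ H) : Set H) = {x | A x = μ • x} := by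
        ext x; exact Module.End.mem_eigenspace_iff
      rw [h1]
      exact isClosed_eq A.continuous (continuous_const_smul μ)
    exact this.completeSpace_coe
  choose w b hb using fun μ => exists_hilbertBasis ℂ (E μ)
  let v : (Σ μ, w μ) → H := fun p => (b p.1 p.2 : H)
  have hv : Orthonormal ℂ v :=
    hsym.orthogonalFamily_eigenspaces.orthonormal_sigma_orthonormal fun μ => (b μ).orthonormal
  have hEv : ∀ p, A (v p) = p.1 • v p := fun p => Module.End.mem_eigenspace_iff.1 (b p.1 p.2).2
  have hspan : (Submodule.span ℂ (Set.range v))ᗮ = ⊥ := by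
    rw [eq_bot_iff, ← ContinuousLinearMap.orthogonalComplement_iSup_eigenspaces_eq_bot hc hsym]
    intro x hx
    rw [← Submodule.iInf_orthogonal, Submodule.mem_iInf]
    intro μ
    rw [Submodule.mem_orthogonal]
    intro u hu
    have h1 := ((b μ).hasSum_repr ⟨u, hu⟩).mapL (E μ).subtypeL
    have h2 := h1.mapL (innerSL ℂ x)
    have h3 : ∀ i, innerSL ℂ x ((E μ).subtypeL ((b μ).repr ⟨u, hu⟩ i • b μ i)) = 0 := fun i => by
      have h4 : ⟪v ⟨μ, i⟩, x⟫_ℂ = 0 :=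
        (Submodule.mem_orthogonal _ _).1 hx _ (Submodule.subset_span ⟨_, rfl⟩)
      rw [map_smul, map_smul, innerSL_apply_apply]
      exact smul_eq_zero_of_right _ (inner_eq_zero_symm.1 h4)
    simp only [h3] at h2
    exact inner_eq_zero_symm.1 (h2.unique hasSum_zero)
  have hreal : ∀ p : (Σ μ, w μ), p.1 = ((p.1.re : ℝ) : ℂ) := fun p => by
    have h1 := hsym (v p) (v p)
    simp only [ContinuousLinearMap.coe_coe, hEv, inner_smul_left, inner_smul_right] at h1
    rw [inner_self_eq_ofReal, hv.1] at h1
    exact (Complex.conj_eq_iff_re.1 (by simpa using h1)).symm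
  refine ⟨_, HilbertBasis.mkOfOrthogonalEqBot hv hspan, fun p => p.1.re, fun p => ?_⟩
  rw [HilbertBasis.coe_mkOfOrthogonalEqBot, hEv, ← hreal]

/-! ### The trace -/

theorem norm_abs_apply (T : H →L[ℂ] H) (x : H) : ‖CFC.abs T x‖ = ‖T x‖ := by
  have h1 : IsSelfAdjoint (CFC.abs T) := (CFC.abs_nonneg T).isSelfAdjoint
  have h2 : ⟪CFC.abs T x, CFC.abs T x⟫_ℂ = ⟪x, CFC.abs T (CFC.abs T x)⟫_ℂ :=
    h1.isSymmetric x (CFC.abs T x)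
  rw [← mul_apply_eq_comp, CFC.abs_mul_abs, mul_apply_eq_comp,
    ContinuousLinearMap.star_eq_adjoint, ContinuousLinearMap.adjoint_inner_right,
    inner_self_eq_ofReal, inner_self_eq_ofReal] at h2
  exact (pow_left_inj₀ (norm_nonneg _) (norm_nonneg _) two_ne_zero).1 (Complex.ofReal_injective h2)

/-- In an eigenbasis of |T| one has ‖T f‖ = ‖|T| f‖ = ⟪f, |T| f⟫. Summable norms in one basis are
what makes the trace independent of the basis. -/
theorem IsTraceClass.exists_summable_norm {T : H →L[ℂ] H} (hT : IsTraceClass T) :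
    ∃ (ι : Type u) (f : HilbertBasis ι ℂ H), Summable fun m => ‖T (f m)‖ := by
  obtain ⟨ι, f, μ, hf⟩ := exists_hilbertBasis_eigenvectors (CFC.abs_nonneg T)
    hT.isCompactOperator_abs
  refine ⟨ι, f, (hT.summable f).congr fun m => ?_⟩
  have h0 : 0 ≤ (⟪f m, CFC.abs T (f m)⟫_ℂ).re := by
    rw [← norm_sqrt_apply_sq (CFC.abs_nonneg T)]; positivity
  rw [hf, inner_smul_right, inner_self_eq_ofReal, f.orthonormal.1] at h0 ⊢
  rw [← norm_abs_apply, hf, norm_smul, f.orthonormal.1]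
  norm_num at h0 ⊢
  exact (abs_of_nonneg h0).symm

/-- The double family ⟪eₙ, T fₘ⟫ ⟪fₘ, eₙ⟫ is absolutely summable: for fixed m, Cauchy-Schwarz and
Bessel bound the sum over n by ‖T fₘ‖. Summing in the two orders gives the two traces. -/
theorem IsTraceClass.hasSum_tsum {T : H →L[ℂ] H} {κ ι : Type*} (f : HilbertBasis κ ℂ H)
    (hf : Summable fun m => ‖T (f m)‖) (e : HilbertBasis ι ℂ H) :
    HasSum (fun n => ⟪e n, T (e n)⟫_ℂ) (∑' m, ⟪f m, T (f m)⟫_ℂ) := by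
  let g : κ × ι → ℂ := fun p => ⟪e p.2, T (f p.1)⟫_ℂ * ⟪f p.1, e p.2⟫_ℂ
  have hb : ∀ m, ∀ s : Finset ι, ∑ n ∈ s, ‖g (m, n)‖ ≤ ‖T (f m)‖ := fun m s => by
    have h1 := sum_norm_inner_mul_norm_inner_le e.orthonormal (T (f m)) (f m) s
    rw [f.orthonormal.1, mul_one] at h1
    refine le_trans (le_of_eq (Finset.sum_congr rfl fun n _ => ?_)) h1
    rw [norm_mul, norm_inner_symm (f m)]
  have hgs : Summable g := by
    refine Summable.of_norm ((summable_prod_of_nonneg fun _ => norm_nonneg _).2 ⟨fun m =>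
      summable_of_sum_le (fun _ => norm_nonneg _) (hb m), ?_⟩)
    exact Summable.of_nonneg_of_le (fun m => tsum_nonneg fun _ => norm_nonneg _)
      (fun m => Real.tsum_le_of_sum_le (fun _ => norm_nonneg _) (hb m)) hf
  have h1 : ∀ m, HasSum (fun n => g (m, n)) ⟪f m, T (f m)⟫_ℂ := fun m => by
    simpa only [g, mul_comm] using e.hasSum_inner_mul_inner (f m) (T (f m))
  have h2 : ∀ n, HasSum (fun m => g (m, n)) ⟪e n, T (e n)⟫_ℂ := fun n => by
    have h3 := (((f.hasSum_repr (e n)).mapL T).mapL (innerSL ℂ (e n)))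
    simp only [map_smul, innerSL_apply_apply, f.repr_apply_apply, smul_eq_mul] at h3
    simpa only [g, mul_comm] using h3
  have h3 := hgs.hasSum.prod_fiberwise h1
  have h4 : HasSum (fun n => ⟪e n, T (e n)⟫_ℂ) (∑' p, g p) := by
    have := ((Equiv.prodComm ι κ).hasSum_iff.2 hgs.hasSum).prod_fiberwise h2
    exact this
  rwa [h3.tsum_eq]

/-- The trace can be computed in any orthonormal basis. -/
theorem IsTraceClass.hasSum_trace {T : H →L[ℂ] H} (hT : IsTraceClass T) {ι : Type*}
    (e : HilbertBasis ι ℂ H) : HasSum (fun n => ⟪e n, T (e n)⟫_ℂ) (trace T) := by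
  obtain ⟨κ, f, hf⟩ := hT.exists_summable_norm
  rw [trace, (IsTraceClass.hasSum_tsum f hf (someHilbertBasis H)).tsum_eq]
  exact IsTraceClass.hasSum_tsum f hf e

/-- The trace of the difference of two trace class operators. -/
theorem IsTraceClass.hasSum_trace_sub {S T : H →L[ℂ] H} (hS : IsTraceClass S)
    (hT : IsTraceClass T) {ι : Type*} (e : HilbertBasis ι ℂ H) :
    HasSum (fun n => ⟪e n, (S - T) (e n)⟫_ℂ) (trace (S - T)) := by
  -- The sums are subtracted basis by basis, so it need not be known that the difference is again
  -- trace class.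
  have h : ∀ {κ : Type _} (b : HilbertBasis κ ℂ H),
      HasSum (fun n => ⟪b n, (S - T) (b n)⟫_ℂ) (trace S - trace T) := fun b => by
    simpa only [sub_apply, inner_sub_right] using
      (hS.hasSum_trace b).sub (hT.hasSum_trace b)
  rw [trace, (h (someHilbertBasis H)).tsum_eq]
  simpa only [sub_apply, inner_sub_right] using
      (hS.hasSum_trace e).sub (hT.hasSum_trace e)

theorem HilbertBasis.countable [TopologicalSpace.SeparableSpace H] {ι : Type*}
    (e : HilbertBasis ι ℂ H) : Countable ι := by
  refine Pairwise.countable_of_isOpen_disjoint (s := fun i => Metric.ball (e i) (1 / 2))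
    (fun i j hij => ?_) (fun _ => Metric.isOpen_ball) fun i => ⟨e i, by simp⟩
  refine Metric.ball_disjoint_ball ?_
  have h1 : ‖e i - e j‖ ^ 2 = 2 := by
    have h2 := @norm_sub_sq ℂ H _ _ _ (e i) (e j)
    rw [e.orthonormal.2 hij, e.orthonormal.1, e.orthonormal.1] at h2
    rw [h2]
    norm_num
  rw [dist_eq_norm]
  nlinarith [norm_nonneg (e i - e j)]

end Hilbert

/-! ### Eigenbases of density matrices -/

/-- Eigenbases of density matrices are indexed by ℕ, so L²(Γ) must be infinite dimensional:
`exists_slow_orthogonal` provides a unit vector orthogonal to any finite family. -/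
theorem infinite_of_hilbertBasis {ι : Type*} (e : HilbertBasis ι ℂ L2One) : Infinite ι := by
  by_contra h
  rw [not_infinite_iff_finite] at h
  obtain ⟨n, ⟨σ⟩⟩ := Finite.exists_equiv_fin ι
  obtain ⟨ψ, -, h1, h2, -⟩ := exists_slow_orthogonal (fun k => e (σ.symm k)) one_pos
  have : ψ = 0 := HilbertBasis.eq_zero e fun i => by simpa using h2 (σ i)
  simp [this] at h1

/-- This ensures that `density` is given by an actual eigenbasis and not by its default value 0. -/
theorem exists_isEigenbasis {γ : L2One →L[ℂ] L2One} (h0 : 0 ≤ γ) (hγ : IsTraceClass γ) :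
    ∃ p : (ℕ → ℝ) × HilbertBasis ℕ ℂ L2One, IsEigenbasis γ p.1 p.2 := by
  obtain ⟨ι, e, μ, he⟩ := exists_hilbertBasis_eigenvectors h0 (hγ.isCompactOperator h0)
  have : Fact ((2 : ENNReal) ≠ ⊤) := ⟨ENNReal.ofNat_ne_top⟩
  have : SecondCountableTopology L2One := Lp.SecondCountableTopology
  have : Countable ι := HilbertBasis.countable e
  have : Infinite ι := infinite_of_hilbertBasis e
  obtain ⟨σ⟩ := nonempty_equiv_of_countable (α := ℕ) (β := ι)
  obtain ⟨e', he'⟩ := HilbertBasis.exists_reindex e σ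
  exact ⟨(μ ∘ σ, e'), fun n => by simp only [he', he, Function.comp_apply]⟩

/-! ### Eigenvalues and kinetic energy of density matrices -/

theorem IsNegLaplacian.unique {u v w : L2One} (hv : IsNegLaplacian u v)
    (hw : IsNegLaplacian u w) : v = w := by
  refine sub_eq_zero.1 (eq_zero_of_orthogonal_sobolevOne fun φ hφ => ?_)
  rw [inner_sub_right, ← hv.2 φ hφ, ← hw.2 φ hφ, sub_self]

theorem isNegLaplacian_zero : IsNegLaplacian 0 0 := by
  have h0 : ∀ i, IsWeakPartialOne i 0 0 := fun i => HasWeakDeriv.zero isSlicing_spaceSpin _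
  refine ⟨fun i => ⟨0, h0 i⟩, fun φ _ => ?_⟩
  simp only [dirichletForm, (h0 _).partialOne_eq, inner_zero_right, Finset.sum_const_zero]

theorem dirichletForm_self (u : L2One) : dirichletForm u u = ((gradNormSq u : ℝ) : ℂ) := by
  simp only [dirichletForm, gradNormSq, inner_self_eq_ofReal, Complex.ofReal_sum]

section Eigenbasis

variable {γ : L2One →L[ℂ] L2One} {lam : ℕ → ℝ} {ξ : HilbertBasis ℕ ℂ L2One}

theorem IsEigenbasis.inner_apply (h : IsEigenbasis γ lam ξ) (n : ℕ) :
    ⟪ξ n, γ (ξ n)⟫_ℂ = (lam n : ℂ) := by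
  rw [h n, inner_smul_right, inner_self_eq_ofReal, ξ.orthonormal.1]
  simp

theorem IsEigenbasis.nonneg (h : IsEigenbasis γ lam ξ) (h0 : 0 ≤ γ) (n : ℕ) : 0 ≤ lam n := by
  have h1 := norm_sqrt_apply_sq h0 (ξ n)
  rw [h.inner_apply, Complex.ofReal_re] at h1
  rw [← h1]; positivity

theorem IsEigenbasis.le_one (h : IsEigenbasis γ lam ξ) (h1 : γ ≤ 1) (n : ℕ) : lam n ≤ 1 := by
  have h2 := norm_sqrt_apply_sq (sub_nonneg.2 h1) (ξ n)
  rw [sub_apply, inner_sub_right, h.inner_apply,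
    one_apply_eq_self, inner_self_eq_ofReal, ξ.orthonormal.1] at h2
  have h3 : 0 ≤ 1 - lam n := by
    have : (((1 ^ 2 : ℝ) : ℂ) - (lam n : ℂ)).re = 1 - lam n := by simp
    rw [← this, ← h2]; positivity
  linarith

theorem IsEigenbasis.hasSum (h : IsEigenbasis γ lam ξ) (hγ : IsTraceClass γ) :
    HasSum lam (trace γ).re := by
  have h1 := Complex.hasSum_re (hγ.hasSum_trace ξ)
  simpa only [h.inner_apply, Complex.ofReal_re] using h1

/-- Since ξₙ = λₙ⁻¹ γ ξₙ, it lies in the range of γ, which is contained in the domain of the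
Laplacian. For λₙ = 0 this argument gives no regularity. -/
theorem IsEigenbasis.mem_sobolevOne (h : IsEigenbasis γ lam ξ) {K : L2One →L[ℂ] L2One}
    (hK : ∀ f, IsNegLaplacian (γ f) (K f)) {n : ℕ} (hn : lam n ≠ 0) : ξ n ∈ sobolevOne := by
  have h1 := smul_mem_sobolevOne ((lam n : ℂ)⁻¹) (hK (ξ n)).1
  rwa [h n, inv_smul_smul₀ (by exact_mod_cast hn)] at h1

theorem IsEigenbasis.inner_negLaplacian (h : IsEigenbasis γ lam ξ) {K : L2One →L[ℂ] L2One}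
    (hK : ∀ f, IsNegLaplacian (γ f) (K f)) (n : ℕ) :
    ⟪ξ n, K (ξ n)⟫_ℂ = ((lam n * gradNormSq (ξ n) : ℝ) : ℂ) := by
  -- Here γ ξₙ = 0 forces K ξₙ = 0, and on the right the factor 0 makes the value of `gradNormSq`
  -- irrelevant, even if ξₙ is not in H¹.
  by_cases hn : lam n = 0
  · have h1 := hK (ξ n)
    rw [h n, hn, Complex.ofReal_zero, zero_smul] at h1
    rw [h1.unique isNegLaplacian_zero, hn]
    simp
  · have hξ := h.mem_sobolevOne hK hn
    rw [← (hK (ξ n)).2 _ hξ, h n, dirichletForm]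
    simp only [partialOne_smul _ hξ, inner_smul_right]
    rw [← Finset.mul_sum, ← dirichletForm, dirichletForm_self, Complex.ofReal_mul]

theorem negLaplacianMul_eq {K : L2One →L[ℂ] L2One} (hK : ∀ f, IsNegLaplacian (γ f) (K f)) :
    negLaplacianMul γ = K := by
  have h : ∃ K : L2One →L[ℂ] L2One, ∀ f, IsNegLaplacian (γ f) (K f) := ⟨K, hK⟩
  rw [negLaplacianMul, dif_pos h]
  ext1 f
  exact (h.choose_spec f).unique (hK f)

theorem IsEigenbasis.hasSum_kinetic (h : IsEigenbasis γ lam ξ) (hγ : IsTraceClass γ)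
    {T : L2One →L[ℂ] L2One} (hT : IsTraceClass T)
    (hTγ : ∀ f, IsNegLaplacian (γ f) (T f - γ f)) :
    HasSum (fun n => lam n * gradNormSq (ξ n)) (trace (negLaplacianMul γ)).re := by
  have hK : ∀ f, IsNegLaplacian (γ f) ((T - γ) f) := hTγ
  rw [negLaplacianMul_eq hK]
  have h1 := Complex.hasSum_re (hT.hasSum_trace_sub hγ ξ)
  simpa only [h.inner_negLaplacian hK, Complex.ofReal_re] using h1

end Eigenbasis

/-! ### Sums of nonnegative functions -/

section Tsum

variable {α ι : Type*} [MeasurableSpace α] {μ : Measure α} [Countable ι] {F : ι → α → ℝ}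

theorem ae_summable_of_summable_integral (h0 : ∀ i x, 0 ≤ F i x) (hF : ∀ i, Integrable (F i) μ)
    (hs : Summable fun i => ∫ x, F i x ∂μ) :
    (∀ᵐ x ∂μ, Summable fun i => F i x) ∧ Integrable (fun x => ∑' i, F i x) μ := by
  have hm : ∀ i, AEMeasurable (fun x => ENNReal.ofReal (F i x)) μ := fun i =>
    (hF i).aestronglyMeasurable.aemeasurable.ennreal_ofReal
  have hlt : ∫⁻ x, ∑' i, ENNReal.ofReal (F i x) ∂μ ≠ ⊤ := by
    rw [lintegral_tsum hm]
    simp only [← ofReal_integral_eq_lintegral_ofReal (hF _) (ae_of_all _ (h0 _))]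
    exact hs.tsum_ofReal_ne_top
  have hint := integrable_toReal_of_lintegral_ne_top (AEMeasurable.tsum hm) hlt
  have heq : (fun x => (∑' i, ENNReal.ofReal (F i x)).toReal) = fun x => ∑' i, F i x := by
    ext x
    rw [ENNReal.tsum_toReal_eq fun _ => ENNReal.ofReal_ne_top]
    simp only [ENNReal.toReal_ofReal (h0 _ _)]
  rw [heq] at hint
  refine ⟨?_, hint⟩
  filter_upwards [ae_lt_top' (AEMeasurable.tsum hm) hlt] with x hx
  have := ENNReal.summable_toReal hx.ne
  simpa only [ENNReal.toReal_ofReal (h0 _ _)] using this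

theorem integral_tsum_of_summable_integral (h0 : ∀ i x, 0 ≤ F i x)
    (hF : ∀ i, Integrable (F i) μ) (hs : Summable fun i => ∫ x, F i x ∂μ) :
    HasSum (fun i => ∫ x, F i x ∂μ) (∫ x, ∑' i, F i x ∂μ) :=
  hasSum_integral_of_summable_integral_norm hF
    (hs.congr fun i => integral_congr_ae (ae_of_all _ fun x => by
      simp only [Real.norm_of_nonneg (h0 i x)]))

end Tsum

/-! ### Coulomb and exchange energy -/

theorem integral_sum_spin {f : SpaceSpin → ℝ} (hf : Integrable f spaceSpinMeasure) :
    ∫ x : Space, ∑ s : Fin 2, f (x, s) = ∫ z, f z ∂spaceSpinMeasure := by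
  rw [isSlicing_spaceSpin.integral_eq hf,
    integral_finsetSum _ fun s _ => isSlicing_spaceSpin.integrable_iff.1 hf s]

theorem integral_integral_sum_spin {P : SpaceSpin → ℝ}
    (hP : Integrable (fun p : SpaceSpin × SpaceSpin => P p.1 * P p.2 / ‖p.1.1 - p.2.1‖)
      (spaceSpinMeasure.prod spaceSpinMeasure)) :
    ∫ x : Space, ∫ y : Space, (∑ s : Fin 2, P (x, s)) * (∑ s : Fin 2, P (y, s)) / ‖x - y‖
      = ∫ p : SpaceSpin × SpaceSpin, P p.1 * P p.2 / ‖p.1.1 - p.2.1‖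
        ∂spaceSpinMeasure.prod spaceSpinMeasure := by
  rw [integral_prod _ hP, ← integral_sum_spin hP.integral_prod_left]
  refine integral_congr_ae ?_
  have h : ∀ᵐ x : Space, ∀ s : Fin 2, Integrable
      (fun y : SpaceSpin => P (x, s) * P y / ‖x - y.1‖) spaceSpinMeasure :=
    ae_all_iff.2 (isSlicing_spaceSpin.ae_iff.1 hP.prod_right_ae)
  filter_upwards [h] with x hx
  rw [Finset.sum_congr rfl fun s _ => (integral_sum_spin (hx s)).symm,
    ← integral_finsetSum]
  · refine integral_congr_ae (ae_of_all _ fun y => ?_)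
    simp only [Finset.sum_mul_sum, Finset.sum_div]
  · exact fun s _ => integrable_finsetSum _ fun t _ =>
      isSlicing_spaceSpin.integrable_iff.1 (hx s) t

/-- Lagrange's identity. -/
theorem sum_mul_sum_sub_norm_sq (s : Finset ℕ) (lam : ℕ → ℝ) (a b : ℕ → ℂ) :
    (∑ i ∈ s, lam i * ‖a i‖ ^ 2) * (∑ i ∈ s, lam i * ‖b i‖ ^ 2)
        - ‖∑ i ∈ s, (lam i : ℂ) * (a i * starRingEnd ℂ (b i))‖ ^ 2
      = (1 / 2) * ∑ i ∈ s, ∑ j ∈ s, lam i * lam j * ‖a i * b j - a j * b i‖ ^ 2 := by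
  have h1 : ∀ i j, lam i * lam j * ‖a i * b j - a j * b i‖ ^ 2
      = (lam i * ‖a i‖ ^ 2) * (lam j * ‖b j‖ ^ 2) + (lam i * ‖b i‖ ^ 2) * (lam j * ‖a j‖ ^ 2)
        - 2 * ((((lam i : ℂ) * (a i * starRingEnd ℂ (b i)))
          * starRingEnd ℂ ((lam j : ℂ) * (a j * starRingEnd ℂ (b j))))).re := by
    intro i j
    simp only [← Complex.normSq_eq_norm_sq, Complex.normSq_apply, map_mul, Complex.conj_conj,
      Complex.conj_ofReal, Complex.mul_re, Complex.mul_im, Complex.sub_re, Complex.sub_im,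
      Complex.conj_re, Complex.conj_im, Complex.ofReal_re, Complex.ofReal_im]
    ring
  have h2 : ‖∑ i ∈ s, (lam i : ℂ) * (a i * starRingEnd ℂ (b i))‖ ^ 2
      = ∑ i ∈ s, ∑ j ∈ s, (((lam i : ℂ) * (a i * starRingEnd ℂ (b i)))
          * starRingEnd ℂ ((lam j : ℂ) * (a j * starRingEnd ℂ (b j)))).re := by
    rw [← Complex.ofReal_re (‖_‖ ^ 2), Complex.ofReal_pow, ← Complex.mul_conj', map_sum,
      Finset.sum_mul_sum, Complex.re_sum]
    simp only [Complex.re_sum]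
  simp only [h1, Finset.sum_sub_distrib, Finset.sum_add_distrib, ← Finset.mul_sum]
  rw [← h2, ← Finset.sum_mul, ← Finset.sum_mul]
  ring

section Kernel

variable {γ : L2One →L[ℂ] L2One} {lam : ℕ → ℝ} {ξ : HilbertBasis ℕ ℂ L2One}

/-- The expansion of the integral kernel in eigenvectors. -/
theorem IsEigenbasis.tendsto_kernel (h : IsEigenbasis γ lam ξ) {k : SpaceSpin × SpaceSpin → ℂ}
    (hk : IsIntegralKernel γ k) :
    ∀ᵐ x ∂spaceSpinMeasure, ∀ᵐ y ∂spaceSpinMeasure, ∃ ns : ℕ → ℕ, StrictMono ns ∧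
      Filter.Tendsto (fun m => ∑ n ∈ Finset.range (ns m),
        (lam n : ℂ) * (ξ n x * starRingEnd ℂ (ξ n y))) Filter.atTop (nhds (k (x, y))) := by
  have hk2 : Integrable (fun p => ‖k p‖ ^ 2) (spaceSpinMeasure.prod spaceSpinMeasure) :=
    (memLp_two_iff_integrable_sq_norm hk.1.1).1 hk.1
  have hev : ∀ᵐ x ∂spaceSpinMeasure, ∀ n,
      (lam n : ℂ) * ξ n x = ∫ y, k (x, y) * ξ n y ∂spaceSpinMeasure := by
    refine ae_all_iff.2 fun n => ?_
    filter_upwards [hk.2 (ξ n), Lp.coeFn_smul (lam n : ℂ) (ξ n)] with x hx hx'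
    rw [← hx, h n, hx', Pi.smul_apply, smul_eq_mul]
  filter_upwards [hev, hk2.prod_right_ae, hk.1.1.prodMk_left] with x hx hx2 hxm
  have hmem : MemLp (fun y => starRingEnd ℂ (k (x, y))) 2 spaceSpinMeasure := by
    refine (memLp_two_iff_integrable_sq_norm (Complex.continuous_conj.comp_aestronglyMeasurable
      hxm)).2 ?_
    simpa using hx2
  -- For almost every x, the eigenvalue equation evaluated at x gives the Fourier coefficients of
  -- the conjugate of k(x, ·).
  have hcoef : ∀ n, ξ.repr hmem.toLp n = starRingEnd ℂ ((lam n : ℂ) * ξ n x) := fun n => by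
    rw [ξ.repr_apply_apply, ← inner_conj_symm, L2.inner_def, hx n]
    congr 1
    refine integral_congr_ae ?_
    filter_upwards [hmem.coeFn_toLp] with y hy
    rw [hy, RCLike.inner_apply, Complex.conj_conj, mul_comm]
  have hsum := (ξ.hasSum_repr hmem.toLp).tendsto_sum_nat
  -- The Fourier series converges in L² of the second variable, hence almost everywhere along a
  -- subsequence, which may depend on x.
  obtain ⟨ns, hns, hns'⟩ := (tendstoInMeasure_of_tendsto_Lp hsum).exists_seq_tendsto_ae
  have hfin : ∀ᵐ y ∂spaceSpinMeasure, ∀ m : ℕ,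
      (∑ n ∈ Finset.range m, ξ.repr hmem.toLp n • ξ n : L2One) y
        = ∑ n ∈ Finset.range m, ξ.repr hmem.toLp n * ξ n y := by
    have h1 : ∀ᵐ y ∂spaceSpinMeasure, ∀ n, (ξ.repr hmem.toLp n • ξ n : L2One) y
        = ξ.repr hmem.toLp n * ξ n y :=
      ae_all_iff.2 fun n => Lp.coeFn_smul (ξ.repr hmem.toLp n) (ξ n)
    refine ae_all_iff.2 fun m => ?_
    filter_upwards [h1, Lp.coeFn_finsetSum (Finset.range m)
      (fun n => ξ.repr hmem.toLp n • ξ n)] with y hy hy'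
    rw [hy', Finset.sum_apply]
    exact Finset.sum_congr rfl fun n _ => hy n
  filter_upwards [hns', hfin, hmem.coeFn_toLp] with y hy hyf hyk
  refine ⟨ns, hns, ?_⟩
  have h2 := (Complex.continuous_conj.tendsto _).comp hy
  rw [hyk, Complex.conj_conj] at h2
  refine h2.congr fun m => ?_
  rw [Function.comp_apply, hyf, map_sum]
  refine Finset.sum_congr rfl fun n _ => ?_
  rw [map_mul, hcoef, Complex.conj_conj, mul_assoc]

end Kernel

/-! ### The energy of a density matrix in terms of its eigenvectors -/

/-- The density for each value of the spin. -/
noncomputable def spinDensity (lam : ℕ → ℝ) (ξ : ℕ → L2One) (x : SpaceSpin) : ℝ :=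
  ∑' n, lam n * ‖ξ n x‖ ^ 2

section SpinDensity

variable {lam : ℕ → ℝ} {ξ : ℕ → L2One}

theorem measurable_spinDensity (h0 : ∀ n, 0 ≤ lam n) : Measurable (spinDensity lam ξ) := by
  have h1 : spinDensity lam ξ
      = fun x => (∑' n, ENNReal.ofReal (lam n * ‖ξ n x‖ ^ 2)).toReal := by
    ext x
    rw [ENNReal.tsum_toReal_eq fun _ => ENNReal.ofReal_ne_top]
    exact tsum_congr fun n => (ENNReal.toReal_ofReal (mul_nonneg (h0 n) (sq_nonneg _))).symm
  rw [h1]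
  refine (Measurable.tsum fun n => ?_).ennreal_toReal
  exact (((Lp.stronglyMeasurable (ξ n)).norm.measurable.pow_const 2).const_mul _).ennreal_ofReal

theorem ae_summable_spinDensity (h0 : ∀ n, 0 ≤ lam n) (hξ : ∀ n, ‖ξ n‖ = 1)
    (hs : Summable lam) :
    ∀ᵐ x ∂spaceSpinMeasure, Summable fun n => lam n * ‖ξ n x‖ ^ 2 := by
  refine (ae_summable_of_summable_integral (F := fun n x => lam n * ‖ξ n x‖ ^ 2)
    (fun n x => mul_nonneg (h0 n) (sq_nonneg _)) (fun n => Integrable.const_mul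
      ((memLp_two_iff_integrable_sq_norm (Lp.aestronglyMeasurable _)).1 (Lp.memLp _)) _) ?_).1
  refine hs.congr fun n => ?_
  rw [integral_const_mul, integral_norm_sq_eq, hξ]
  ring

theorem integrable_mul_of_ne_zero {α : Type*} [MeasurableSpace α] {μ : Measure α} {c : ℝ}
    {f : α → ℝ} (h : c ≠ 0 → Integrable f μ) : Integrable (fun x => c * f x) μ := by
  by_cases hc : c = 0
  · simp [hc]
  · exact (h hc).const_mul c

/-- Hardy's inequality with t = 1 dominates the n-th integral by the n-th terms of kinetic energy
and trace, which justifies integration term by term. -/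
theorem hasSum_nuclear (h0 : ∀ n, 0 ≤ lam n) (hξ : ∀ n, ‖ξ n‖ = 1) (hs : Summable lam)
    (hH : ∀ n, lam n ≠ 0 → ξ n ∈ sobolevOne) (hg : Summable fun n => lam n * gradNormSq (ξ n)) :
    Integrable (fun x : SpaceSpin => spinDensity lam ξ x / ‖x.1‖) spaceSpinMeasure ∧
    HasSum (fun n => lam n * ∫ x, ‖ξ n x‖ ^ 2 / ‖x.1‖ ∂spaceSpinMeasure)
      (∫ x, spinDensity lam ξ x / ‖x.1‖ ∂spaceSpinMeasure) := by
  let F : ℕ → SpaceSpin → ℝ := fun n x => lam n * (‖ξ n x‖ ^ 2 / ‖x.1‖)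
  have hF0 : ∀ n x, 0 ≤ F n x := fun n x => mul_nonneg (h0 n) (by positivity)
  have hF : ∀ n, Integrable (F n) spaceSpinMeasure := fun n =>
    integrable_mul_of_ne_zero fun hn => integrable_nuclear (hH n hn)
  have hFs : Summable fun n => ∫ x, F n x ∂spaceSpinMeasure := by
    refine Summable.of_nonneg_of_le (fun n => integral_nonneg (hF0 n)) (fun n => ?_) (hg.add hs)
    simp only [F, integral_const_mul]
    by_cases hn : lam n = 0
    · simp [hn]
    · have h1 := integral_nuclear_le (hH n hn)
      rw [hξ] at h1
      nlinarith [h0 n]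
  have heq : (fun x : SpaceSpin => spinDensity lam ξ x / ‖x.1‖) = fun x => ∑' n, F n x := by
    ext x
    simp only [F, spinDensity, ← mul_div_assoc, tsum_div_const]
  have h1 := integral_tsum_of_summable_integral hF0 hF hFs
  rw [heq]
  exact ⟨(ae_summable_of_summable_integral hF0 hF hFs).2, by
    simpa only [F, integral_const_mul] using h1⟩

theorem integrable_coulomb (h0 : ∀ n, 0 ≤ lam n) (hξ : ∀ n, ‖ξ n‖ = 1) (hs : Summable lam)
    (hH : ∀ n, lam n ≠ 0 → ξ n ∈ sobolevOne) (hg : Summable fun n => lam n * gradNormSq (ξ n)) :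
    Integrable (fun p : SpaceSpin × SpaceSpin =>
      spinDensity lam ξ p.1 * spinDensity lam ξ p.2 / ‖p.1.1 - p.2.1‖)
      (spaceSpinMeasure.prod spaceSpinMeasure) := by
  let F : ℕ × ℕ → SpaceSpin × SpaceSpin → ℝ := fun n p =>
    (lam n.1 * lam n.2) * (‖ξ n.1 p.1‖ ^ 2 * ‖ξ n.2 p.2‖ ^ 2 / ‖p.1.1 - p.2.1‖)
  have hF0 : ∀ n p, 0 ≤ F n p := fun n p =>
    mul_nonneg (mul_nonneg (h0 _) (h0 _)) (by positivity)
  have hF : ∀ n, Integrable (F n) (spaceSpinMeasure.prod spaceSpinMeasure) := fun n =>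
    integrable_mul_of_ne_zero fun hn => integrable_pair _ (hH n.2 (right_ne_zero_of_mul hn))
  have hFs : Summable fun n => ∫ p, F n p ∂spaceSpinMeasure.prod spaceSpinMeasure := by
    refine Summable.of_nonneg_of_le (fun n => integral_nonneg (hF0 n)) (fun n => ?_)
      (hs.mul_of_nonneg (hg.add hs) h0 fun n => add_nonneg
        (mul_nonneg (h0 n) (gradNormSq_nonneg _)) (h0 n))
    simp only [F, integral_const_mul]
    by_cases hn : lam n.2 = 0
    · simp [hn]
    · have h1 := integral_pair_le (ξ n.1) (hH n.2 hn) one_pos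
      rw [hξ, hξ] at h1
      have h2 : (0 : ℝ) ≤ gradNormSq (ξ n.2) := gradNormSq_nonneg _
      have h3 : ∫ p : SpaceSpin × SpaceSpin, ‖ξ n.1 p.1‖ ^ 2 * ‖ξ n.2 p.2‖ ^ 2
          / ‖p.1.1 - p.2.1‖ ∂spaceSpinMeasure.prod spaceSpinMeasure
          ≤ gradNormSq (ξ n.2) + 1 := by
        refine h1.trans ?_
        norm_num
        linarith
      have h4 := mul_le_mul_of_nonneg_left h3 (mul_nonneg (h0 n.1) (h0 n.2))
      linarith
  refine (ae_summable_of_summable_integral hF0 hF hFs).2.congr ?_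
  have h1 := ae_summable_spinDensity h0 hξ hs
  filter_upwards [Measure.quasiMeasurePreserving_fst.ae h1,
    Measure.quasiMeasurePreserving_snd.ae h1] with p hp hq
  have h2 : ∀ n : ℕ × ℕ, F n p
      = (lam n.1 * ‖ξ n.1 p.1‖ ^ 2) * (lam n.2 * ‖ξ n.2 p.2‖ ^ 2) / ‖p.1.1 - p.2.1‖ :=
    fun n => by simp only [F]; ring
  simp only [h2, tsum_div_const]
  rw [spinDensity, spinDensity, hp.tsum_mul_tsum hq
    (hp.mul_of_nonneg hq (fun n => mul_nonneg (h0 n) (sq_nonneg _))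
      fun n => mul_nonneg (h0 n) (sq_nonneg _))]

/-- The energies of the pairs formed by the first orbitals are at most the full energy, minus the
exchange term. -/
theorem norm_sq_add_le_of_tendsto (h0 : ∀ n, 0 ≤ lam n) {x y : SpaceSpin}
    (hx : Summable fun n => lam n * ‖ξ n x‖ ^ 2) (hy : Summable fun n => lam n * ‖ξ n y‖ ^ 2)
    {k : ℂ} {ns : ℕ → ℕ} (hns : StrictMono ns)
    (hk : Filter.Tendsto (fun m => ∑ n ∈ Finset.range (ns m),
        (lam n : ℂ) * (ξ n x * starRingEnd ℂ (ξ n y))) Filter.atTop (nhds k)) (M : ℕ) :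
    ‖k‖ ^ 2 + (1 / 2) * ∑ i ∈ Finset.range M, ∑ j ∈ Finset.range M,
      lam i * lam j * ‖ξ i x * ξ j y - ξ j x * ξ i y‖ ^ 2
        ≤ spinDensity lam ξ x * spinDensity lam ξ y := by
  have h1 := (hx.hasSum.tendsto_sum_nat.comp hns.tendsto_atTop).mul
    (hy.hasSum.tendsto_sum_nat.comp hns.tendsto_atTop)
  refine le_of_tendsto_of_tendsto ((hk.norm.pow 2).add_const _) h1 ?_
  filter_upwards [hns.tendsto_atTop.eventually_ge_atTop M] with m hm
  have h2 := sum_mul_sum_sub_norm_sq (Finset.range (ns m)) lam (fun n => ξ n x) (fun n => ξ n y)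
  have h3 : ∀ i j, 0 ≤ lam i * lam j * ‖ξ i x * ξ j y - ξ j x * ξ i y‖ ^ 2 := fun i j =>
    mul_nonneg (mul_nonneg (h0 i) (h0 j)) (sq_nonneg _)
  -- `M` stays fixed while the partial sums grow, and the pair terms beyond `M` are nonnegative and
  -- discarded.
  have hsub := Finset.range_subset_range.2 hm
  have h4 : ∑ i ∈ Finset.range M, ∑ j ∈ Finset.range M,
      lam i * lam j * ‖ξ i x * ξ j y - ξ j x * ξ i y‖ ^ 2
      ≤ ∑ i ∈ Finset.range (ns m), ∑ j ∈ Finset.range (ns m),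
        lam i * lam j * ‖ξ i x * ξ j y - ξ j x * ξ i y‖ ^ 2 :=
    (Finset.sum_le_sum fun i _ => Finset.sum_le_sum_of_subset_of_nonneg hsub
      fun j _ _ => h3 i j).trans (Finset.sum_le_sum_of_subset_of_nonneg hsub
        fun i _ _ => Finset.sum_nonneg fun j _ => h3 i j)
  simp only [Function.comp_apply]
  linarith

end SpinDensity

section Exchange

variable {γ : L2One →L[ℂ] L2One} {lam : ℕ → ℝ} {ξ : HilbertBasis ℕ ℂ L2One}

theorem aestronglyMeasurable_integralKernel (γ : L2One →L[ℂ] L2One) :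
    AEStronglyMeasurable (integralKernel γ) (spaceSpinMeasure.prod spaceSpinMeasure) := by
  rw [integralKernel]
  split_ifs with h
  · exact h.choose_spec.1.1
  · exact aestronglyMeasurable_const

theorem IsEigenbasis.norm_integralKernel_sq_add_le (h : IsEigenbasis γ lam ξ)
    (h0 : ∀ n, 0 ≤ lam n) (hs : Summable lam) (M : ℕ) :
    ∀ᵐ p ∂spaceSpinMeasure.prod spaceSpinMeasure, ‖integralKernel γ p‖ ^ 2
      + (1 / 2) * ∑ i ∈ Finset.range M, ∑ j ∈ Finset.range M,
        lam i * lam j * ‖ξ i p.1 * ξ j p.2 - ξ j p.1 * ξ i p.2‖ ^ 2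
        ≤ spinDensity lam ξ p.1 * spinDensity lam ξ p.2 := by
  have hsum := ae_summable_spinDensity h0 ξ.orthonormal.1 hs
  have hae : ∀ᵐ x ∂spaceSpinMeasure, ∀ᵐ y ∂spaceSpinMeasure, ‖integralKernel γ (x, y)‖ ^ 2
      + (1 / 2) * ∑ i ∈ Finset.range M, ∑ j ∈ Finset.range M,
        lam i * lam j * ‖ξ i x * ξ j y - ξ j x * ξ i y‖ ^ 2
        ≤ spinDensity lam ξ x * spinDensity lam ξ y := by
    by_cases hk : ∃ k, IsIntegralKernel γ k
    · have hk' : IsIntegralKernel γ (integralKernel γ) := by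
        rw [integralKernel, dif_pos hk]; exact hk.choose_spec
      filter_upwards [h.tendsto_kernel hk', hsum] with x hx hxs
      filter_upwards [hx, hsum] with y hy hys
      obtain ⟨ns, hns, hlim⟩ := hy
      exact norm_sq_add_le_of_tendsto h0 hxs hys hns hlim M
    -- If γ had no square integrable kernel, `integralKernel` would be 0. The bound then follows
    -- from the one with the series ∑ λₙ ξₙ(x) conj(ξₙ(y)) in place of the kernel.
    · filter_upwards [hsum] with x hxs
      filter_upwards [hsum] with y hys
      have hlim : Summable fun n => (lam n : ℂ) * (ξ n x * starRingEnd ℂ (ξ n y)) := by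
        refine Summable.of_norm_bounded (hxs.add hys) fun n => ?_
        rw [norm_mul, norm_mul, Complex.norm_real, RCLike.norm_conj, Real.norm_of_nonneg (h0 n),
          ← mul_add]
        refine mul_le_mul_of_nonneg_left ?_ (h0 n)
        nlinarith [sq_nonneg (‖ξ n x‖ - ‖ξ n y‖), sq_nonneg (‖ξ n x‖ + ‖ξ n y‖)]
      refine le_trans (add_le_add_left ?_ _)
        (norm_sq_add_le_of_tendsto h0 hxs hys strictMono_id hlim.hasSum.tendsto_sum_nat M)
      rw [integralKernel, dif_neg hk]
      rw [Pi.zero_apply, norm_zero, zero_pow two_ne_zero]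
      exact sq_nonneg _
  have hk := aestronglyMeasurable_integralKernel γ
  have hP := measurable_spinDensity (ξ := ξ) h0
  have hξ : ∀ n, Measurable (ξ n) := fun n => (Lp.stronglyMeasurable (ξ n)).measurable
  -- The kernel is replaced by a measurable representative so that "almost every x, almost every y"
  -- can be turned into "almost every pair".
  have hset : MeasurableSet {p : SpaceSpin × SpaceSpin | ‖hk.mk _ p‖ ^ 2
      + (1 / 2) * ∑ i ∈ Finset.range M, ∑ j ∈ Finset.range M,
        lam i * lam j * ‖ξ i p.1 * ξ j p.2 - ξ j p.1 * ξ i p.2‖ ^ 2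
        ≤ spinDensity lam ξ p.1 * spinDensity lam ξ p.2} := by
    refine measurableSet_le (Measurable.add (hk.stronglyMeasurable_mk.norm.measurable.pow_const 2)
      (Measurable.const_mul (Finset.measurable_fun_sum _ fun i _ => Finset.measurable_fun_sum _
        fun j _ => ?_) _)) ((hP.comp measurable_fst).mul (hP.comp measurable_snd))
    exact ((((hξ i).comp measurable_fst).mul ((hξ j).comp measurable_snd)).sub
      (((hξ j).comp measurable_fst).mul
        ((hξ i).comp measurable_snd))).norm.pow_const 2 |>.const_mul _
  have hae' := (Measure.ae_prod_iff_ae_ae hset).2 (by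
    filter_upwards [hae, Measure.ae_ae_of_ae_prod hk.ae_eq_mk] with x hx hx'
    filter_upwards [hx, hx'] with y hy hy'
    rwa [← hy'])
  filter_upwards [hae', hk.ae_eq_mk] with p hp hp'
  rwa [hp']

end Exchange

section HartreeFock

variable {γ : L2One →L[ℂ] L2One} {lam : ℕ → ℝ} {ξ : HilbertBasis ℕ ℂ L2One}

/-- The pointwise bound of |γ(x, y)|² plus the pair terms by the product of the densities is divided
by |𝐱 - 𝐲| and integrated. The double series of pair energies never has to be summed. -/
theorem IsEigenbasis.sum_pairEnergy_le (h : IsEigenbasis γ lam ξ) (h0 : ∀ n, 0 ≤ lam n)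
    (hs : Summable lam) (hH : ∀ n, lam n ≠ 0 → ξ n ∈ sobolevOne)
    (hg : Summable fun n => lam n * gradNormSq (ξ n)) (M : ℕ) :
    (1 / 2) * ∑ i ∈ Finset.range M, ∑ j ∈ Finset.range M,
        lam i * lam j * pairEnergy (ξ i) (ξ j)
      ≤ coulombEnergy (fun x => ∑ s : Fin 2, spinDensity lam ξ (x, s)) - exchangeEnergy γ := by
  have hG := integrable_coulomb h0 ξ.orthonormal.1 hs hH hg
  have hle := h.norm_integralKernel_sq_add_le h0 hs
  -- The case of no pair terms says |γ(x, y)|² ≤ ρ(x) ρ(y), so the finite Coulomb energy dominates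
  -- the exchange integrand.
  have hK : Integrable (fun p : SpaceSpin × SpaceSpin =>
      ‖integralKernel γ p‖ ^ 2 / ‖p.1.1 - p.2.1‖) (spaceSpinMeasure.prod spaceSpinMeasure) := by
    refine hG.mono' (((aestronglyMeasurable_integralKernel γ).norm.pow 2).aemeasurable.div
      measurable_dist_pair.aemeasurable).aestronglyMeasurable ?_
    filter_upwards [hle 0] with p hp
    rw [Real.norm_of_nonneg (by positivity)]
    gcongr
    simpa using hp
  have hR : ∀ i j, Integrable (fun p : SpaceSpin × SpaceSpin => lam i * lam j
      * (‖ξ i p.1 * ξ j p.2 - ξ j p.1 * ξ i p.2‖ ^ 2 / ‖p.1.1 - p.2.1‖))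
      (spaceSpinMeasure.prod spaceSpinMeasure) := fun i j =>
    integrable_mul_of_ne_zero fun hn => integrable_pairEnergy (hH i (left_ne_zero_of_mul hn))
      (hH j (right_ne_zero_of_mul hn))
  have hR' : Integrable (fun p : SpaceSpin × SpaceSpin => ∑ i ∈ Finset.range M,
      ∑ j ∈ Finset.range M, lam i * lam j
        * (‖ξ i p.1 * ξ j p.2 - ξ j p.1 * ξ i p.2‖ ^ 2 / ‖p.1.1 - p.2.1‖))
      (spaceSpinMeasure.prod spaceSpinMeasure) :=
    integrable_finsetSum _ fun i _ => integrable_finsetSum _ fun j _ => hR i j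
  have hRint : ∫ p : SpaceSpin × SpaceSpin, (∑ i ∈ Finset.range M,
      ∑ j ∈ Finset.range M, lam i * lam j
        * (‖ξ i p.1 * ξ j p.2 - ξ j p.1 * ξ i p.2‖ ^ 2 / ‖p.1.1 - p.2.1‖))
        ∂spaceSpinMeasure.prod spaceSpinMeasure
      = 2 * ∑ i ∈ Finset.range M, ∑ j ∈ Finset.range M,
        lam i * lam j * pairEnergy (ξ i) (ξ j) := by
    rw [integral_finsetSum _ fun i _ => integrable_finsetSum _ fun j _ => hR i j, Finset.mul_sum]
    refine Finset.sum_congr rfl fun i _ => ?_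
    rw [integral_finsetSum _ fun j _ => hR i j, Finset.mul_sum]
    refine Finset.sum_congr rfl fun j _ => ?_
    rw [integral_const_mul, pairEnergy]
    ring
  have hmono := integral_mono_ae ((hK.add (hR'.const_mul (1 / 2)))) hG (by
    filter_upwards [hle M] with p hp
    have h1 := div_le_div_of_nonneg_right hp (norm_nonneg (p.1.1 - p.2.1))
    refine le_trans (le_of_eq ?_) h1
    simp only [Pi.add_apply, add_div, mul_div_assoc, Finset.sum_div])
  rw [integral_add' hK (hR'.const_mul (1 / 2)), integral_const_mul, hRint] at hmono
  rw [coulombEnergy, integral_integral_sum_spin hG, exchangeEnergy,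
    integral_integral (f := fun x y : SpaceSpin =>
      ‖integralKernel γ (x, y)‖ ^ 2 / ‖x.1 - y.1‖) hK]
  linarith

/-- The energy of a density matrix dominates the energies of its truncations. -/
theorem groundStateEnergy_le_hartreeFock {Z : ℝ} (hZ : 0 ≤ Z) {N : ℕ}
    (hγ : γ ∈ densityMatricesLE N) : groundStateEnergy Z N ≤ hartreeFock Z γ := by
  obtain ⟨⟨htr, hnn, hle, T, hT, hTγ⟩, hN⟩ := hγ
  have hex := exists_isEigenbasis hnn htr
  -- The basis must be the one chosen inside `density`; the energy is then computed in this basis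
  -- throughout.
  obtain ⟨lam, ξ, h, hdens⟩ : ∃ (lam : ℕ → ℝ) (ξ : HilbertBasis ℕ ℂ L2One),
      IsEigenbasis γ lam ξ ∧ density γ = fun x => ∑ s : Fin 2, spinDensity lam ξ (x, s) := by
    refine ⟨_, _, hex.choose_spec, ?_⟩
    ext x
    rw [density, dif_pos hex]
    rfl
  have h0 := h.nonneg hnn
  have hsum := h.hasSum htr
  have hkin := h.hasSum_kinetic htr hT hTγ
  have hH : ∀ n, lam n ≠ 0 → ξ n ∈ sobolevOne := fun n hn =>
    h.mem_sobolevOne (K := T - γ) hTγ hn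
  obtain ⟨hnint, hnuc⟩ := hasSum_nuclear h0 ξ.orthonormal.1 hsum.summable hH hkin.summable
  have hnuc' : ∫ x : Space, Z * density γ x / ‖x‖
      = Z * ∫ x, spinDensity lam ξ x / ‖x.1‖ ∂spaceSpinMeasure := by
    rw [← integral_sum_spin hnint, ← integral_const_mul, hdens]
    simp only [mul_div_assoc, Finset.sum_div]
  have horb : HasSum (fun n => lam n * orbitalEnergy Z (ξ n))
      ((1 / 2) * (trace (negLaplacianMul γ)).re
        - ∫ x : Space, Z * density γ x / ‖x‖) := by
    rw [hnuc']
    refine ((hkin.mul_left (1 / 2)).sub (hnuc.mul_left Z)).congr_fun fun n => ?_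
    rw [orbitalEnergy]
    ring
  -- Keeping the first M eigenvectors leaves the eigenvalues in [0, 1] and can only lower the trace.
  -- The pair terms are already bounded by a quantity independent of M, so the limit concerns the
  -- one-body sums alone.
  have hbound : ∀ M : ℕ, groundStateEnergy Z N
      ≤ ∑ n ∈ Finset.range M, lam n * orbitalEnergy Z (ξ n)
        + (coulombEnergy (density γ) - exchangeEnergy γ) := fun M => by
    have h1 := groundStateEnergy_le_occupationEnergy hZ (N := N) (φ := fun i : Fin M => ξ i)
      (ξ.orthonormal.comp _ Fin.val_injective) (lam := fun i => lam i) (fun i hi => hH i hi)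
      (fun i => h0 i) (fun i => h.le_one hle i) (by
        rw [Fin.sum_univ_eq_sum_range fun i => lam i]
        exact (sum_le_hasSum _ (fun i _ => h0 i) hsum).trans hN)
    refine h1.trans ?_
    have h2 := h.sum_pairEnergy_le h0 hsum.summable hH hkin.summable M
    rw [hdens]
    rw [occupationEnergy, Fin.sum_univ_eq_sum_range fun i => lam i * orbitalEnergy Z (ξ i)]
    gcongr
    refine le_trans (le_of_eq ?_) h2
    congr 1
    rw [← Fin.sum_univ_eq_sum_range fun i => ∑ j ∈ Finset.range M,
      lam i * lam j * pairEnergy (ξ i) (ξ j)]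
    exact Finset.sum_congr rfl fun i _ =>
      Fin.sum_univ_eq_sum_range (fun j => lam i * lam j * pairEnergy (ξ i) (ξ j)) M
  have hlim := ge_of_tendsto' (horb.tendsto_sum_nat.add_const
    (coulombEnergy (density γ) - exchangeEnergy γ)) hbound
  rw [hartreeFock]
  linarith

end HartreeFock

end ElectronGas

theorem mainTheorem7 (Z : ℝ) (hZ : 0 ≤ Z) (N : ℕ)
    (hmin : ∃ γ₀ ∈ ElectronGas.densityMatricesEQ N,
      IsMinOn (ElectronGas.hartreeFock Z) (ElectronGas.densityMatricesEQ N) γ₀)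
    (γ : ElectronGas.L2One →L[ℂ] ElectronGas.L2One)
    (hγ : γ ∈ ElectronGas.densityMatricesLE N) :
    ElectronGas.groundStateEnergy Z N ≤ ElectronGas.hartreeFock Z γ :=
  ElectronGas.groundStateEnergy_le_hartreeFock hZ hγ
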